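/- Let $T>0$ and let $W$ be a standard $d$-dimensional Brownian motion on $[0,T]$ with respect to a complete filtered probability space $(\Omega,\mathcal F,(\mathcal F_t),\mathbb P)$ (all $\mathbb P$-null sets belong to $\mathcal F_0$). Let $\mu:[0,T]\to\mathbb R^n$ and $\sigma:[0,T]\to\mathbb R^{n\times d}$ be measurable functions such that $$\int_0^T(\|\mu(t)\|+\|\sigma(t)\|^2)\,dt<\infty ,$$ and such that for some $\varepsilon>0$ and all $z\in\mathbb R^n$, $$\inf_{0\le t\le T} z\,\sigma(t)\sigma(t)^{T}z^{T}\ \ge\ \varepsilon\|z\|^2 .$$ For $t\in[0,T]$ and $y\in(0,\infty)^n$ let $Y^{t,y}=(Y^{t,y,1},\dots,Y^{t,y,n})$ be the continuous adapted (log-normal) process on $[t,T]$ that starts from $y$ at time $t$ and follows the dynamics $$dY^i_s = Y^i_s\,(\mu_i(s)\,ds+\sigma_i(s)\,dW_s),\qquad i=1,\dots,n,$$ in the sense of Itô, where $\sigma_i$ is the $i$-th row of $\sigma$. Let $f:\mathbb R^n\to\mathbb R$ be bounded and measurable and put $$v(t,y)=\mathbb E[f(Y^{t,y}_T)] .$$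 Then for every $s\in[0,T)$ the function $v(s,\cdot)$ is infinitely differentiable on $(0,\infty)^n$, and for all $t\in[0,T)$, $y\in(0,\infty)^n$, $m\ge 0$ and $i_1,\dots,i_m\in\{1,\dots,n\}$ the process $$Y^{t,y,i_1}_s\cdots Y^{t,y,i_m}_s\,\frac{\partial^m v(s,Y^{t,y}_s)}{\partial y_{i_1}\cdots\partial y_{i_m}},\qquad t\le s<T,$$ is a martingale with respect to $(\mathcal F_s)_{t\le s<T}$. -/

import Mathlib

open MeasureTheory ProbabilityTheory Filter Topology Set
open scoped ENNReal RealInnerProductSpace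

namespace LogNormal

variable {Ω : Type*} {mΩ : MeasurableSpace Ω}

/-- The filtration is complete: every `P`-null set belongs to the initial σ-algebra. -/
def IsCompleteFiltration (ℱ : Filtration ℝ mΩ) (P : Measure Ω) : Prop :=
  ∀ A : Set Ω, P A = 0 → MeasurableSet[ℱ 0] A

/-- The restriction of a filtration to the times in a set `J`. -/
def restrictTo (ℱ : Filtration ℝ mΩ) (J : Set ℝ) : Filtration J mΩ where
  seq s := ℱ s
  mono' _ _ h := ℱ.mono h
  le' s := ℱ.le s

/-- `W` is a standard `d`-dimensional Brownian motion on `[0, T]` with respect to `ℱ` and `P`. -/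
structure IsBrownianMotion {d : ℕ} (ℱ : Filtration ℝ mΩ) (P : Measure Ω) (T : ℝ)
    (W : ℝ → Ω → EuclideanSpace ℝ (Fin d)) : Prop where
  adapted : ∀ s ∈ Icc 0 T, StronglyMeasurable[ℱ s] (W s)
  zero : ∀ᵐ ω ∂P, W 0 ω = 0
  continuous : ∀ᵐ ω ∂P, ContinuousOn (fun s => W s ω) (Icc 0 T)
  indep : ∀ s r, 0 ≤ s → s ≤ r → r ≤ T →
    Indep (MeasurableSpace.comap (fun ω => W r ω - W s ω) inferInstance) (ℱ s) P
  law : ∀ s r, 0 ≤ s → s ≤ r → r ≤ T →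
    P.map (fun ω => W r ω - W s ω) = multivariateGaussian 0 ((r - s) • 1)

/-- A simple (elementary predictable) `ℝᵈ`-valued process on `[a, b]`:
it equals `val k` on `(time k, time (k + 1)]` for `k < N`, where `val k` is bounded and
`ℱ (time k)`-measurable. -/
structure SimpleProcess (ℱ : Filtration ℝ mΩ) (a b : ℝ) (d : ℕ) where
  N : ℕ
  time : ℕ → ℝ
  time_mono : Monotone time
  time_zero : time 0 = a
  time_last : time N = b
  val : ℕ → Ω → EuclideanSpace ℝ (Fin d)
  measurable_val : ∀ k < N, StronglyMeasurable[ℱ (time k)] (val k)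
  bounded_val : ∃ C : ℝ, ∀ k < N, ∀ ω, ‖val k ω‖ ≤ C

/-- The value of a simple process at time `u`. -/
noncomputable def SimpleProcess.eval {ℱ : Filtration ℝ mΩ} {a b : ℝ} {d : ℕ}
    (S : SimpleProcess ℱ a b d) (u : ℝ) (ω : Ω) : EuclideanSpace ℝ (Fin d) :=
  ∑ k ∈ Finset.range S.N,
    (Ioc (S.time k) (S.time (k + 1))).indicator (fun _ => S.val k ω) u

/-- The elementary stochastic integral `∫_a^s ⟨S_u, dW_u⟩` of a simple process. -/
noncomputable def SimpleProcess.integral {ℱ : Filtration ℝ mΩ} {a b : ℝ} {d : ℕ}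
    (S : SimpleProcess ℱ a b d) (W : ℝ → Ω → EuclideanSpace ℝ (Fin d)) (s : ℝ) (ω : Ω) : ℝ :=
  ∑ k ∈ Finset.range S.N,
    ⟪S.val k ω, W (min (S.time (k + 1)) s) ω - W (min (S.time k) s) ω⟫

/-- `I` is (a continuous version of) the Itô integral process `I_s = ∫_a^s ⟨H_u, dW_u⟩`,
`s ∈ [a, b]`. The paths of `H` are almost surely square integrable on `[a, b]`, and for some
sequence of simple processes `S k` with `∫_a^b ‖S k - H‖² du → 0` in probability, the elementary
integrals of `S k` converge to `I` uniformly on `[a, b]` in probability. -/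
def IsItoIntegral {d : ℕ} (ℱ : Filtration ℝ mΩ) (P : Measure Ω)
    (W : ℝ → Ω → EuclideanSpace ℝ (Fin d)) (a b : ℝ)
    (H : ℝ → Ω → EuclideanSpace ℝ (Fin d)) (I : ℝ → Ω → ℝ) : Prop :=
  (∀ᵐ ω ∂P, MemLp (fun u => H u ω) 2 (volume.restrict (Icc a b))) ∧
  (∀ᵐ ω ∂P, ContinuousOn (fun s => I s ω) (Icc a b)) ∧
  ∃ S : ℕ → SimpleProcess ℱ a b d,
    (∀ ε : ℝ≥0∞, 0 < ε → Tendsto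
      (fun k => P {ω | ε ≤ ∫⁻ u in Icc a b, ‖(S k).eval u ω - H u ω‖ₑ ^ 2}) atTop (𝓝 0)) ∧
    (∀ ε : ℝ, 0 < ε → Tendsto
      (fun k => P {ω | ∃ s ∈ Icc a b, ε ≤ |(S k).integral W s ω - I s ω|}) atTop (𝓝 0))

/-- `Y` solves `dYⁱ_s = Yⁱ_s (μ_i(s) ds + σ_i(s) dW_s)` on `[t, T]` with `Y_t = y`, where `σ_i` is
the `i`-th row of the `n × d` matrix `σ`. -/
structure IsSolution {n d : ℕ} (ℱ : Filtration ℝ mΩ) (P : Measure Ω)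
    (W : ℝ → Ω → EuclideanSpace ℝ (Fin d))
    (μ : ℝ → EuclideanSpace ℝ (Fin n)) (σ : ℝ → Matrix (Fin n) (Fin d) ℝ) (T t : ℝ)
    (y : EuclideanSpace ℝ (Fin n)) (Y : ℝ → Ω → EuclideanSpace ℝ (Fin n)) : Prop where
  adapted : ∀ s ∈ Icc t T, StronglyMeasurable[ℱ s] (Y s)
  continuous : ∀ᵐ ω ∂P, ContinuousOn (fun s => Y s ω) (Icc t T)
  initial : ∀ᵐ ω ∂P, Y t ω = y
  dynamics : ∀ i : Fin n, ∃ I : ℝ → Ω → ℝ,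
    IsItoIntegral ℱ P W t T (fun u ω => Y u ω i • WithLp.toLp 2 (σ u i)) I ∧
    ∀ᵐ ω ∂P, ∀ s ∈ Icc t T,
      Y s ω i = y i + (∫ u in t..s, Y u ω i * μ u i) + I s ω

/-- The open positive orthant of `ℝⁿ`. -/
def orthant (n : ℕ) : Set (EuclideanSpace ℝ (Fin n)) := {y | ∀ i, 0 < y i}

/-- `v(t, y) = E[f(Y^{t,y}_T)]`. -/
noncomputable def value {n : ℕ} (P : Measure Ω) (T : ℝ) (f : EuclideanSpace ℝ (Fin n) → ℝ)
    (Y : ℝ → EuclideanSpace ℝ (Fin n) → ℝ → Ω → EuclideanSpace ℝ (Fin n))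
    (t : ℝ) (y : EuclideanSpace ℝ (Fin n)) : ℝ :=
  ∫ ω, f (Y t y T ω) ∂P

/-- The mixed partial derivative `∂ᵐ g / ∂y_{i_1} ⋯ ∂y_{i_m}` at `y`. -/
noncomputable def mixedPartial {n m : ℕ} (i : Fin m → Fin n)
    (g : EuclideanSpace ℝ (Fin n) → ℝ) (y : EuclideanSpace ℝ (Fin n)) : ℝ :=
  iteratedFDeriv ℝ m g y (fun k => EuclideanSpace.single (i k) 1)

end LogNormal

namespace LogNormal

/-! ### Linear integral equations with integrable coefficients -/

/-! In logarithmic coordinates x = log y, the increment of the solution over (s, r] is Gaussian and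
independent of ℱ_s. Its i-th mean is ∫(μ_i - ‖σ_i‖²/2) and its covariance is ∫σσᵀ (`logLaw`). Hence
v(s, y) = w_s(log y), where w_s (`logValue`) averages translates of f ∘ exp over a Gaussian law.
Nondegeneracy bounds the covariance below by ε(T - s), so w_s is smooth with all derivatives bounded
although f is only bounded and measurable (`bddSmooth_logValue`).

The weighted derivative y_{i_1}⋯y_{i_m} ∂_{i_1}⋯∂_{i_m} becomes a constant coefficient operator in
x, `eulerOp` (`prod_mul_mixedPartial`). Such an operator commutes with averaging over translations
(`eulerOp_integral`), and w_s is the average of w_r over the law of the increment from s to r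
(`logValue_eq_integral`). So `eulerOp` of w_s is the average of `eulerOp` of w_r. By the Markov
property (`IsSolution.condExp_comp`) this average, taken at log Y_s, is the conditional expectation
given ℱ_s of `eulerOp` of w_r at log Y_r. That is the martingale property.

The main work is to find the law of the increments from the equation. It is done by L² computations
in place of Itô's formula. For a deterministic step function g put 𝓔(g) = exp(∫g dW - ½∫‖g‖²). For a
scalar solution, E Y_r² = y² exp ∫(2μ + ‖σ‖²) and E[Y_r 𝓔(g)] = y exp ∫(μ + ⟨σ, g⟩), because both
quantities solve linear integral equations; and E 𝓔(g)² = exp ∫‖g‖². Expanding the square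
(`IsScalarSolution.integral_sub_dexp_sq`) shows that y exp(∫μ) 𝓔(g) converges to Y_r in L² as g → σ.
The limit is positive by Fatou's lemma applied to exp(-∫g dW) (`pos_of_tendsto_dexp`), so logarithms
may be taken. The logarithmic increments are then limits of Wiener integrals of step functions,
whose characteristic functions on events of the past are explicit (`IsSolution.setIntegral_cexp`).

These computations need square integrability of Y, which is not assumed. Simple processes are
truncated when their energy reaches a level c, which localizes the Itô isometry. A Grönwall argument
for the expected capped energy of the solution then gives a bound that does not depend on c
(`IsScalarSolution.exists_capped_energy_bound`). -/

theorem absolutelyContinuousOnInterval_exp {f : ℝ → ℝ} {a b : ℝ}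
    (hf : AbsolutelyContinuousOnInterval f a b) :
    AbsolutelyContinuousOnInterval (fun x => Real.exp (f x)) a b := by
  obtain ⟨C, hC⟩ := hf.exists_bound
  -- The values of `f` lie in [-C, C], where `exp` is Lipschitz with constant e^C.
  have key : ∀ x ∈ uIcc a b, ∀ y ∈ uIcc a b,
      dist (Real.exp (f x)) (Real.exp (f y)) ≤ Real.exp C * dist (f x) (f y) := by
    intro x hx y hy
    have h := (convex_Icc (-C) C).norm_image_sub_le_of_norm_deriv_le (𝕜 := ℝ) (f := Real.exp)
      (C := Real.exp C) (fun z _ => Real.differentiableAt_exp)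
      (fun z hz => by
        rw [Real.deriv_exp, Real.norm_eq_abs, abs_of_pos (Real.exp_pos z)]
        exact Real.exp_le_exp.2 hz.2) (abs_le.1 (hC y hy)) (abs_le.1 (hC x hx))
    simpa [dist_eq_norm] using h
  unfold AbsolutelyContinuousOnInterval at hf ⊢
  have h2 := hf.const_mul (Real.exp C)
  rw [mul_zero] at h2
  refine squeeze_zero' (Eventually.of_forall fun E => Finset.sum_nonneg fun _ _ => dist_nonneg)
    ?_ h2
  filter_upwards [mem_inf_of_right (mem_principal_self _)] with E hE
  rw [Finset.mul_sum]
  refine Finset.sum_le_sum fun i hi => ?_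
  have := hE.1 i hi
  exact key _ this.1 _ this.2

/-- The coefficient is merely integrable, so its primitive is only absolutely continuous. The
fundamental theorem is used in that form, with the derivative known almost everywhere. -/
theorem integral_mul_exp_integral {κ : ℝ → ℝ} {a b : ℝ} (h : IntervalIntegrable κ volume a b) :
    ∫ u in a..b, κ u * Real.exp (∫ v in a..u, κ v) = Real.exp (∫ v in a..b, κ v) - 1 := by
  have h1 := absolutelyContinuousOnInterval_exp
    (h.absolutelyContinuousOnInterval_intervalIntegral left_mem_uIcc)
  have h2 := h1.integral_deriv_eq_sub
  simp only [intervalIntegral.integral_same, Real.exp_zero] at h2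
  rw [← h2]
  refine intervalIntegral.integral_congr_ae ?_
  filter_upwards [h.ae_hasDerivAt_integral] with x hx hx2
  rw [((hx (uIoc_subset_uIcc hx2) a left_mem_uIcc).exp).deriv, mul_comm]

/-- Same argument for the square of the primitive. It is used pathwise for the square of the drift
integral of a solution. -/
theorem sq_integral_eq {g : ℝ → ℝ} {a b : ℝ} (h : IntervalIntegrable g volume a b) :
    (∫ u in a..b, g u) ^ 2 = 2 * ∫ u in a..b, g u * ∫ v in a..u, g v := by
  have h1 := h.absolutelyContinuousOnInterval_intervalIntegral left_mem_uIcc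
  have h2 := h1.integral_deriv_mul_eq_sub h1
  simp only [intervalIntegral.integral_same, mul_zero, sub_zero] at h2
  rw [sq, ← h2, ← intervalIntegral.integral_const_mul]
  refine intervalIntegral.integral_congr_ae ?_
  filter_upwards [h.ae_hasDerivAt_integral] with x hx hx2
  rw [(hx (uIoc_subset_uIcc hx2) a left_mem_uIcc).deriv]
  ring

theorem integral_nonneg_of_nonneg {k : ℝ → ℝ} {a s b : ℝ} (hs : s ∈ Icc a b)
    (hk : ∀ u ∈ Icc a b, 0 ≤ k u) : 0 ≤ ∫ u in a..s, k u :=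
  intervalIntegral.integral_nonneg hs.1 fun u hu => hk u ⟨hu.1, hu.2.trans hs.2⟩

/-- A Grönwall inequality for bounded functions and integrable kernels. -/
theorem gronwall {k g : ℝ → ℝ} {a b A B : ℝ} (hk : IntegrableOn k (Icc a b))
    (hk0 : ∀ u ∈ Icc a b, 0 ≤ k u) (hg0 : ∀ u ∈ Icc a b, 0 ≤ g u) (hgB : ∀ u ∈ Icc a b, g u ≤ B)
    (h : ∀ s ∈ Icc a b, g s ≤ A + ∫ u in a..s, k u * g u) :
    ∀ s ∈ Icc a b, g s ≤ 2 * A * Real.exp (2 * ∫ u in a..s, k u) := by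
  have hK : ∀ s ∈ Icc a b, 0 ≤ ∫ u in a..s, k u := fun s hs => integral_nonneg_of_nonneg hs hk0
  -- The weight exp(-2∫k) makes the integral operator a contraction with factor 1/2: if G is the
  -- supremum of w, then ∫ k g ≤ G ∫ k exp(2∫k) ≤ (G/2) exp(2∫k). Hence G ≤ A + G/2, which explains
  -- both factors 2 in the bound.
  let w : ℝ → ℝ := fun s => g s * Real.exp (-(2 * ∫ u in a..s, k u))
  let G : ℝ := sSup (w '' Icc a b)
  intro s hs
  have hw : ∀ u ∈ Icc a b, w u ≤ B := by
    intro u hu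
    calc w u ≤ g u * 1 := by
          refine mul_le_mul_of_nonneg_left (Real.exp_le_one_iff.2 ?_) (hg0 u hu)
          have := hK u hu
          linarith
      _ ≤ B := by simpa using hgB u hu
  have hbdd : BddAbove (w '' Icc a b) := ⟨B, by rintro _ ⟨u, hu, rfl⟩; exact hw u hu⟩
  have hle : ∀ u ∈ Icc a b, w u ≤ G := fun u hu => le_csSup hbdd ⟨u, hu, rfl⟩
  have hgle : ∀ u ∈ Icc a b, g u ≤ G * Real.exp (2 * ∫ v in a..u, k v) := by
    intro u hu
    have h1 := mul_le_mul_of_nonneg_right (hle u hu) (Real.exp_pos (2 * ∫ v in a..u, k v)).le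
    simpa only [w, mul_assoc, ← Real.exp_add, neg_add_cancel, Real.exp_zero, mul_one] using h1
  have hG0 : 0 ≤ G := le_trans (mul_nonneg (hg0 s hs) (Real.exp_pos _).le) (hle s hs)
  have hmain : ∀ r ∈ Icc a b, w r ≤ A + G / 2 := by
    intro r hr
    have hsub : Icc a r ⊆ Icc a b := Icc_subset_Icc_right hr.2
    have hkr : IntervalIntegrable (fun u => 2 * k u) volume a r := by
      rw [intervalIntegrable_iff_integrableOn_Icc_of_le hr.1]
      exact (hk.mono_set hsub).const_mul 2
    have hexp := integral_mul_exp_integral hkr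
    simp only [intervalIntegral.integral_const_mul] at hexp
    have hci : IntervalIntegrable
        (fun u => 2 * k u * Real.exp (2 * ∫ v in a..u, k v)) volume a r := by
      have hc : ContinuousOn (fun u => Real.exp (2 * ∫ v in a..u, k v)) (uIcc a r) := by
        have := (hkr.absolutelyContinuousOnInterval_intervalIntegral
          (left_mem_uIcc (a := a) (b := r))).continuousOn
        simp only [intervalIntegral.integral_const_mul] at this
        exact this.rexp
      exact hkr.mul_continuousOn hc
    have hint : ∫ u in a..r, k u * g u
        ≤ ∫ u in a..r, G / 2 * (2 * k u * Real.exp (2 * ∫ v in a..u, k v)) := by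
      rw [intervalIntegral.integral_of_le hr.1, intervalIntegral.integral_of_le hr.1]
      -- Only the majorant has to be integrable, so `g` needs neither measurability nor continuity:
      -- the integral of a nonintegrable function is 0 by convention.
      refine integral_mono_of_nonneg ?_ ?_ ?_
      · filter_upwards [ae_restrict_mem measurableSet_Ioc] with u hu
        exact mul_nonneg (hk0 u (hsub ⟨hu.1.le, hu.2⟩)) (hg0 u (hsub ⟨hu.1.le, hu.2⟩))
      · exact ((intervalIntegrable_iff_integrableOn_Ioc_of_le hr.1).1 hci).const_mul _
      · filter_upwards [ae_restrict_mem measurableSet_Ioc] with u hu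
        have hu' := hsub ⟨hu.1.le, hu.2⟩
        calc k u * g u ≤ k u * (G * Real.exp (2 * ∫ v in a..u, k v)) :=
              mul_le_mul_of_nonneg_left (hgle u hu') (hk0 u hu')
          _ = _ := by ring
    rw [intervalIntegral.integral_const_mul, hexp] at hint
    have hg := h r hr
    have hE : 1 ≤ Real.exp (2 * ∫ u in a..r, k u) := by
      rw [Real.one_le_exp_iff]
      have := hK r hr
      linarith
    have hinv : Real.exp (-(2 * ∫ u in a..r, k u)) * Real.exp (2 * ∫ u in a..r, k u) = 1 := by
      rw [← Real.exp_add, neg_add_cancel, Real.exp_zero]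
    have hEi : 0 < Real.exp (-(2 * ∫ u in a..r, k u)) := Real.exp_pos _
    have hEi1 : Real.exp (-(2 * ∫ u in a..r, k u)) ≤ 1 := by
      rw [Real.exp_le_one_iff]
      have := hK r hr
      linarith
    have hA0 : 0 ≤ A := by
      have := h a ⟨le_rfl, hr.1.trans hr.2⟩
      rw [intervalIntegral.integral_same, add_zero] at this
      exact (hg0 a ⟨le_rfl, hr.1.trans hr.2⟩).trans this
    calc w r ≤ (A + G / 2 * (Real.exp (2 * ∫ u in a..r, k u) - 1))
          * Real.exp (-(2 * ∫ u in a..r, k u)) :=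
          mul_le_mul_of_nonneg_right (hg.trans (by linarith)) hEi.le
      _ = A * Real.exp (-(2 * ∫ u in a..r, k u))
          + G / 2 * (1 - Real.exp (-(2 * ∫ u in a..r, k u))) := by
          linear_combination (G / 2) * hinv
      _ ≤ A * 1 + G / 2 * 1 := by
          refine add_le_add (mul_le_mul_of_nonneg_left hEi1 hA0)
            (mul_le_mul_of_nonneg_left (by linarith) (by linarith))
      _ = _ := by ring
  have hG : G ≤ A + G / 2 := csSup_le ⟨_, ⟨s, hs, rfl⟩⟩ (by rintro _ ⟨u, hu, rfl⟩; exact hmain u hu)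
  refine (hgle s hs).trans (mul_le_mul_of_nonneg_right (by linarith) (Real.exp_pos _).le)

/-- Uniqueness for linear integral equations. -/
theorem eq_mul_exp_integral {κ x : ℝ → ℝ} {a b c B : ℝ} (hκ : IntegrableOn κ (Icc a b))
    (hxm : AEStronglyMeasurable x (volume.restrict (Icc a b))) (hxB : ∀ u ∈ Icc a b, |x u| ≤ B)
    (h : ∀ s ∈ Icc a b, x s = c + ∫ u in a..s, κ u * x u) :
    ∀ s ∈ Icc a b, x s = c * Real.exp (∫ u in a..s, κ u) := by
  intro s hs
  have hab : a ≤ b := hs.1.trans hs.2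
  have hκi : ∀ r ∈ Icc a b, IntervalIntegrable κ volume a r := fun r hr => by
    rw [intervalIntegrable_iff_integrableOn_Icc_of_le hr.1]
    exact hκ.mono_set (Icc_subset_Icc_right hr.2)
  have hcont : ContinuousOn (fun u => Real.exp (∫ v in a..u, κ v)) (Icc a b) := by
    have := ((hκi b ⟨hab, le_rfl⟩).absolutelyContinuousOnInterval_intervalIntegral
      (left_mem_uIcc (a := a) (b := b))).continuousOn
    rw [uIcc_of_le hab] at this
    exact this.rexp
  obtain ⟨E, hE⟩ := isCompact_Icc.exists_bound_of_continuousOn hcont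
  have hκx : IntegrableOn (fun u => κ u * x u) (Icc a b) := by
    refine hκ.mul_bdd (c := B) hxm ?_
    filter_upwards [ae_restrict_mem measurableSet_Icc] with u hu using hxB u hu
  have hκe : IntegrableOn (fun u => κ u * Real.exp (∫ v in a..u, κ v)) (Icc a b) := by
    refine hκ.mul_bdd (c := E) (hcont.aestronglyMeasurable measurableSet_Icc) ?_
    filter_upwards [ae_restrict_mem measurableSet_Icc] with u hu using hE u hu
  -- The difference between x and the exponential solves the homogeneous equation, and Grönwall's
  -- inequality with A = 0 makes it vanish.
  have hD : ∀ r ∈ Icc a b, |x r - c * Real.exp (∫ u in a..r, κ u)|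
      ≤ 0 + ∫ u in a..r, |κ u| * |x u - c * Real.exp (∫ v in a..u, κ v)| := by
    intro r hr
    have hsub : Icc a r ⊆ Icc a b := Icc_subset_Icc_right hr.2
    have i1 : IntervalIntegrable (fun u => κ u * x u) volume a r := by
      rw [intervalIntegrable_iff_integrableOn_Icc_of_le hr.1]; exact hκx.mono_set hsub
    have i2 : IntervalIntegrable (fun u => κ u * Real.exp (∫ v in a..u, κ v)) volume a r := by
      rw [intervalIntegrable_iff_integrableOn_Icc_of_le hr.1]; exact hκe.mono_set hsub
    have e : x r - c * Real.exp (∫ u in a..r, κ u)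
        = ∫ u in a..r, κ u * (x u - c * Real.exp (∫ v in a..u, κ v)) := by
      have e1 := integral_mul_exp_integral (hκi r hr)
      have e2 : (fun u => κ u * (x u - c * Real.exp (∫ v in a..u, κ v)))
        = fun u => κ u * x u - c * (κ u * Real.exp (∫ v in a..u, κ v)) := by
        ext u; ring
      rw [e2, intervalIntegral.integral_sub i1 (i2.const_mul c),
        intervalIntegral.integral_const_mul, e1, h r hr]
      ring
    rw [e, zero_add]
    refine (intervalIntegral.abs_integral_le_integral_abs hr.1).trans (le_of_eq ?_)
    simp only [abs_mul]
  have := gronwall (g := fun r => |x r - c * Real.exp (∫ u in a..r, κ u)|) (k := fun u => |κ u|)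
    (A := 0) (B := B + |c| * E) hκ.abs (fun _ _ => abs_nonneg _) (fun _ _ => abs_nonneg _)
    (fun u hu => by
      refine (abs_sub _ _).trans (add_le_add (hxB u hu) ?_)
      rw [abs_mul]
      exact mul_le_mul_of_nonneg_left (hE u hu) (abs_nonneg c)) hD s hs
  simp only [mul_zero, zero_mul] at this
  exact sub_eq_zero.1 (abs_eq_zero.1 (le_antisymm this (abs_nonneg _)))

/-- A pathwise bound for solutions of a linear integral equation with forcing term `c`. -/
theorem abs_le_of_linear_equation {κ x c : ℝ → ℝ} {a b : ℝ} (hκ : IntegrableOn κ (Icc a b))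
    (hx : ContinuousOn x (Icc a b)) (hc : ContinuousOn c (Icc a b))
    (h : ∀ s ∈ Icc a b, x s = c s + ∫ u in a..s, κ u * x u) :
    ∀ s ∈ Icc a b, |x s| ≤ |c s|
      + 2 * Real.exp (2 * ∫ u in a..b, |κ u|) * ∫ u in a..s, |κ u| * |c u| := by
  intro s hs
  have hsub : Icc a s ⊆ Icc a b := Icc_subset_Icc_right hs.2
  have ii : ∀ {g : ℝ → ℝ}, ContinuousOn g (Icc a b) →
      IntegrableOn (fun u => |κ u| * |g u|) (Icc a b) := by
    intro g hg
    obtain ⟨E, hE⟩ := isCompact_Icc.exists_bound_of_continuousOn hg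
    refine hκ.abs.mul_bdd (c := E) (hg.abs.aestronglyMeasurable measurableSet_Icc) ?_
    filter_upwards [ae_restrict_mem measurableSet_Icc] with u hu
    simpa using hE u hu
  have iI : ∀ {g : ℝ → ℝ}, ContinuousOn g (Icc a b) → ∀ r ∈ Icc a b,
      IntervalIntegrable (fun u => |κ u| * |g u|) volume a r := by
    intro g hg r hr
    rw [intervalIntegrable_iff_integrableOn_Icc_of_le hr.1]
    exact (ii hg).mono_set (Icc_subset_Icc_right hr.2)
  have hle : ∀ r ∈ Icc a b, |x r| ≤ |c r| + ∫ u in a..r, |κ u| * |x u| := by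
    intro r hr
    rw [h r hr]
    refine (abs_add_le _ _).trans (add_le_add le_rfl ?_)
    refine (intervalIntegral.abs_integral_le_integral_abs hr.1).trans (le_of_eq ?_)
    simp only [abs_mul]
  -- Grönwall's inequality is applied to U and not to |x|: U ≤ ∫|κ||c| + ∫|κ|U, where the forcing
  -- term increases and may be frozen at its value at `s`. The final bound contains c only at `s`
  -- and under an integral, so it can later be squared and averaged over ω.
  let U : ℝ → ℝ := fun r => ∫ u in a..r, |κ u| * |x u|
  have hUc : ContinuousOn U (Icc a b) := by
    have := ((iI hx b ⟨hs.1.trans hs.2, le_rfl⟩).absolutelyContinuousOnInterval_intervalIntegral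
      (left_mem_uIcc (a := a) (b := b))).continuousOn
    rwa [uIcc_of_le (hs.1.trans hs.2)] at this
  have hU0 : ∀ r ∈ Icc a b, 0 ≤ U r := fun r hr =>
    integral_nonneg_of_nonneg hr fun u _ => mul_nonneg (abs_nonneg _) (abs_nonneg _)
  obtain ⟨E, hE⟩ := isCompact_Icc.exists_bound_of_continuousOn hUc
  have key := gronwall (k := fun u => |κ u|) (g := U) (a := a) (b := s)
    (A := ∫ u in a..s, |κ u| * |c u|) (B := E) (hκ.mono_set hsub).abs
    (fun _ _ => abs_nonneg _) (fun u hu => hU0 u (hsub hu))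
    (fun u hu => (le_abs_self _).trans (hE u (hsub hu)))
    (by
      intro r hr
      have hr' := hsub hr
      calc U r ≤ ∫ u in a..r, (|κ u| * |c u| + |κ u| * |U u|) := by
            refine intervalIntegral.integral_mono_on hr.1 (iI hx r hr')
              ((iI hc r hr').add (iI hUc r hr')) fun u hu => ?_
            have hu' : u ∈ Icc a b := ⟨hu.1, hu.2.trans hr'.2⟩
            rw [← mul_add, abs_of_nonneg (hU0 u hu')]
            exact mul_le_mul_of_nonneg_left (hle u hu') (abs_nonneg _)
        _ = (∫ u in a..r, |κ u| * |c u|) + ∫ u in a..r, |κ u| * |U u| :=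
            intervalIntegral.integral_add (iI hc r hr') (iI hUc r hr')
        _ ≤ _ := by
            refine add_le_add ?_ (le_of_eq ?_)
            · refine intervalIntegral.integral_mono_interval le_rfl hr.1 hr.2 ?_ (iI hc s hs)
              exact Eventually.of_forall fun u => mul_nonneg (abs_nonneg _) (abs_nonneg _)
            · refine intervalIntegral.integral_congr fun u hu => ?_
              rw [uIcc_of_le hr.1] at hu
              simp only [abs_of_nonneg (hU0 u ⟨hu.1, hu.2.trans hr'.2⟩)])
    s ⟨hs.1, le_rfl⟩
  refine (hle s hs).trans (add_le_add le_rfl (key.trans ?_))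
  have hA : 0 ≤ ∫ u in a..s, |κ u| * |c u| :=
    integral_nonneg_of_nonneg hs fun u _ => mul_nonneg (abs_nonneg _) (abs_nonneg _)
  have hmono : ∫ u in a..s, |κ u| ≤ ∫ u in a..b, |κ u| := by
    refine intervalIntegral.integral_mono_interval le_rfl hs.1 hs.2
      (Eventually.of_forall fun u => abs_nonneg _) ?_
    rw [intervalIntegrable_iff_integrableOn_Icc_of_le (hs.1.trans hs.2)]
    exact hκ.abs
  calc 2 * (∫ u in a..s, |κ u| * |c u|) * Real.exp (2 * ∫ u in a..s, |κ u|)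
      ≤ 2 * (∫ u in a..s, |κ u| * |c u|) * Real.exp (2 * ∫ u in a..b, |κ u|) := by gcongr
    _ = _ := by ring

/-! ### Bounded smooth functions and convolution -/

/-- Smooth functions all of whose derivatives, of every order, are bounded. -/
def BddSmooth {E F : Type} [NormedAddCommGroup E] [NormedSpace ℝ E] [NormedAddCommGroup F]
    [NormedSpace ℝ F] (w : E → F) : Prop :=
  ContDiff ℝ ((⊤ : ℕ∞) : WithTop ℕ∞) w ∧ ∀ k : ℕ, ∃ C : ℝ, ∀ x, ‖iteratedFDeriv ℝ k w x‖ ≤ C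

section BddSmooth

variable {E F : Type} [NormedAddCommGroup E] [NormedSpace ℝ E] [NormedAddCommGroup F]
    [NormedSpace ℝ F]

theorem BddSmooth.differentiable {w : E → F} (hw : BddSmooth w) : Differentiable ℝ w :=
  hw.1.differentiable (by simp)

theorem BddSmooth.exists_bound {w : E → F} (hw : BddSmooth w) : ∃ C : ℝ, ∀ x, ‖w x‖ ≤ C := by
  obtain ⟨C, hC⟩ := hw.2 0
  exact ⟨C, fun x => by simpa using hC x⟩

theorem BddSmooth.fderiv {w : E → F} (hw : BddSmooth w) : BddSmooth (fderiv ℝ w) := by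
  refine ⟨(contDiff_infty_iff_fderiv.1 hw.1).2, fun k => ?_⟩
  obtain ⟨C, hC⟩ := hw.2 (k + 1)
  exact ⟨C, fun x => by rw [norm_iteratedFDeriv_fderiv]; exact hC x⟩

theorem BddSmooth.clm_comp {F' : Type} [NormedAddCommGroup F'] [NormedSpace ℝ F'] {w : E → F}
    (hw : BddSmooth w) (L : F →L[ℝ] F') : BddSmooth fun x => L (w x) := by
  refine ⟨L.contDiff.comp hw.1, fun k => ?_⟩
  obtain ⟨C, hC⟩ := hw.2 k
  refine ⟨‖L‖ * C, fun x => ?_⟩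
  refine (L.norm_iteratedFDeriv_comp_left (f := w) (hw.1.contDiffAt (x := x))
    (by exact_mod_cast le_top)).trans ?_
  exact mul_le_mul_of_nonneg_left (hC x) (norm_nonneg _)

theorem BddSmooth.fderiv_apply {w : E → F} (hw : BddSmooth w) (e : E) :
    BddSmooth fun x => _root_.fderiv ℝ w x e :=
  hw.fderiv.clm_comp (ContinuousLinearMap.apply ℝ F e)

theorem BddSmooth.const_smul {w : E → F} (hw : BddSmooth w) (c : ℝ) :
    BddSmooth fun x => c • w x :=
  hw.clm_comp (c • ContinuousLinearMap.id ℝ F)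

theorem BddSmooth.add {w v : E → F} (hw : BddSmooth w) (hv : BddSmooth v) :
    BddSmooth fun x => w x + v x := by
  refine ⟨hw.1.add hv.1, fun k => ?_⟩
  obtain ⟨C, hC⟩ := hw.2 k
  obtain ⟨D, hD⟩ := hv.2 k
  refine ⟨C + D, fun x => ?_⟩
  have h := fun_iteratedFDeriv_add_apply (𝕜 := ℝ) (i := k) (f := w) (g := v) (x := x)
    (hw.1.contDiffAt.of_le (by exact_mod_cast le_top))
    (hv.1.contDiffAt.of_le (by exact_mod_cast le_top))
  rw [h]
  exact (norm_add_le _ _).trans (add_le_add (hC x) (hD x))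

/-- A family of bounded differentiable functions that is stable under differentiation consists of
bounded smooth functions. -/
theorem BddSmooth.of_stable
    (S : ∀ (F : Type) [NormedAddCommGroup F] [NormedSpace ℝ F], (E → F) → Prop)
    (hS : ∀ (F : Type) [NormedAddCommGroup F] [NormedSpace ℝ F] (w : E → F), S F w →
      (∃ C : ℝ, ∀ x, ‖w x‖ ≤ C) ∧ Differentiable ℝ w ∧ S (E →L[ℝ] F) (_root_.fderiv ℝ w))
    {w : E → F} (hw : S F w) : BddSmooth w := by
  -- The target space varies in the induction, because differentiation replaces F by E →L[ℝ] F. This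
  -- is why `S` is a predicate over all targets.
  have key : ∀ (k : ℕ) (F : Type) [NormedAddCommGroup F] [NormedSpace ℝ F] (w : E → F), S F w →
      ContDiff ℝ k w ∧ ∃ C : ℝ, ∀ x, ‖iteratedFDeriv ℝ k w x‖ ≤ C := by
    intro k
    induction k with
    | zero =>
      intro F _ _ w hw
      refine ⟨?_, by simpa using (hS F w hw).1⟩
      exact_mod_cast contDiff_zero.2 (hS F w hw).2.1.continuous
    | succ k ih =>
      intro F _ _ w hw
      obtain ⟨h1, h2, h3⟩ := hS F w hw
      obtain ⟨h4, C, hC⟩ := ih _ _ h3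
      refine ⟨?_, C, fun x => by rw [← norm_iteratedFDeriv_fderiv]; exact hC x⟩
      rw [Nat.cast_add, Nat.cast_one, contDiff_succ_iff_fderiv]
      exact ⟨h2, by simp, h4⟩
  exact ⟨contDiff_infty.2 fun k => (key k F w hw).1, fun k => (key k F w hw).2⟩

variable [MeasurableSpace E] [BorelSpace E] [SecondCountableTopology E]

theorem BddSmooth.hasFDerivAt_integral {w : E → F} (hw : BddSmooth w) (γ : Measure E)
    [IsProbabilityMeasure γ] (x : E) :
    HasFDerivAt (fun x => ∫ z, w (x + z) ∂γ) (∫ z, _root_.fderiv ℝ w (x + z) ∂γ) x := by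
  obtain ⟨C, hC⟩ := hw.fderiv.exists_bound
  obtain ⟨D, hD⟩ := hw.exists_bound
  have hm : ∀ x : E, AEStronglyMeasurable (fun z => w (x + z)) γ := fun x =>
    (hw.1.continuous.comp (continuous_const.add continuous_id)).aestronglyMeasurable
  refine hasFDerivAt_integral_of_dominated_of_fderiv_le (s := univ) (bound := fun _ => C)
    (F' := fun x z => _root_.fderiv ℝ w (x + z)) univ_mem
    (Eventually.of_forall hm) ?_ ?_ ?_ ?_ ?_
  · exact Integrable.of_bound (hm x) D (Eventually.of_forall fun z => hD _)
  · exact (hw.fderiv.1.continuous.comp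
      (continuous_const.add continuous_id)).aestronglyMeasurable
  · exact Eventually.of_forall fun z x _ => hC _
  · exact integrable_const C
  · exact Eventually.of_forall fun z x _ =>
      (hasFDerivAt_comp_add_right z).2 (hw.differentiable (x + z)).hasFDerivAt

/-- The averages of translates of bounded smooth functions form a stable family: differentiation
passes under the integral and replaces `w` by its derivative. -/
theorem BddSmooth.integral {w : E → F} (hw : BddSmooth w) (γ : Measure E)
    [IsProbabilityMeasure γ] : BddSmooth fun x => ∫ z, w (x + z) ∂γ := by
  refine BddSmooth.of_stable
    (fun F _ _ v => ∃ w : E → F, BddSmooth w ∧ v = fun x => ∫ z, w (x + z) ∂γ) ?_ ⟨w, hw, rfl⟩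
  rintro F _ _ _ ⟨w, hw, rfl⟩
  refine ⟨?_, fun x => (hw.hasFDerivAt_integral γ x).differentiableAt,
    _root_.fderiv ℝ w, hw.fderiv, ?_⟩
  · obtain ⟨C, hC⟩ := hw.exists_bound
    refine ⟨C, fun x => ?_⟩
    have := norm_integral_le_of_norm_le_const (μ := γ) (f := fun z => w (x + z)) (C := C)
      (Eventually.of_forall fun z => hC _)
    simpa using this
  · ext1 x
    exact (hw.hasFDerivAt_integral γ x).fderiv

theorem BddSmooth.fderiv_integral_apply [FiniteDimensional ℝ F] {w : E → F} (hw : BddSmooth w)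
    (γ : Measure E) [IsProbabilityMeasure γ] (x e : E) :
    _root_.fderiv ℝ (fun x => ∫ z, w (x + z) ∂γ) x e = ∫ z, _root_.fderiv ℝ w (x + z) e ∂γ := by
  rw [(hw.hasFDerivAt_integral γ x).fderiv, ContinuousLinearMap.integral_apply]
  obtain ⟨C, hC⟩ := hw.fderiv.exists_bound
  exact Integrable.of_bound (hw.fderiv.1.continuous.comp
      (continuous_const.add continuous_id)).aestronglyMeasurable C
      (Eventually.of_forall fun z => hC _)

end BddSmooth

/-! ### Smoothing by Schwartz kernels -/

section Kernel

variable {E F : Type} [NormedAddCommGroup E] [NormedSpace ℝ E] [FiniteDimensional ℝ E]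
  [MeasureSpace E] [BorelSpace E] [(volume : Measure E).IsAddHaarMeasure]
  [NormedAddCommGroup F] [NormedSpace ℝ F]

/-- An integrable envelope for all translates by vectors of norm at most 1, needed to differentiate
under the integral. Decay of order dim E + 1 is integrable, and 1 + ‖z‖ ≤ 2(1 + ‖z - y‖) absorbs the
translation. -/
theorem exists_schwartz_dominating (ψ : SchwartzMap E F) :
    ∃ B : E → ℝ, Integrable B ∧ ∀ z y : E, ‖y‖ ≤ 1 → ‖ψ (z - y)‖ ≤ B z := by
  let N : ℕ := Module.finrank ℝ E + 1
  obtain ⟨C, hC0, hC⟩ : ∃ C : ℝ, 0 ≤ C ∧ ∀ x : E, (1 + ‖x‖) ^ N * ‖ψ x‖ ≤ C := by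
    refine ⟨2 ^ N * ((Finset.Iic (N, 0)).sup fun m => SchwartzMap.seminorm ℝ m.1 m.2) ψ,
      by positivity, fun x => ?_⟩
    simpa using SchwartzMap.one_add_le_sup_seminorm_apply (𝕜 := ℝ) (m := (N, 0)) (k := N) (n := 0)
      le_rfl le_rfl ψ x
  refine ⟨fun z => 2 ^ N * C * (1 + ‖z‖) ^ (-(N : ℝ)), ?_, fun z y hy => ?_⟩
  · refine (integrable_one_add_norm (μ := (volume : Measure E)) ?_).const_mul _
    simp [N]
  · have h1 : (1 + ‖z‖) ≤ 2 * (1 + ‖z - y‖) := by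
      have := norm_sub_norm_le z y
      have := norm_nonneg (z - y)
      linarith
    have h2 : (1 + ‖z‖) ^ N * ‖ψ (z - y)‖ ≤ 2 ^ N * C := by
      calc (1 + ‖z‖) ^ N * ‖ψ (z - y)‖ ≤ (2 * (1 + ‖z - y‖)) ^ N * ‖ψ (z - y)‖ := by gcongr
        _ = 2 ^ N * ((1 + ‖z - y‖) ^ N * ‖ψ (z - y)‖) := by rw [mul_pow, mul_assoc]
        _ ≤ _ := by gcongr; exact hC _
    beta_reduce
    rw [Real.rpow_neg (by positivity), Real.rpow_natCast, ← div_eq_mul_inv,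
      le_div_iff₀ (by positivity), mul_comm]
    exact h2

/-- The derivative falls on the kernel, so `g` needs no regularity. The sign comes from the argument
z - x. -/
theorem hasFDerivAt_integral_schwartz (ψ : SchwartzMap E F) {g : E → ℝ} (hg : Measurable g)
    {C : ℝ} (hC : ∀ x, |g x| ≤ C) (x : E) :
    HasFDerivAt (fun x => ∫ z, g z • ψ (z - x))
      (∫ z, g z • (-(SchwartzMap.fderivCLM ℝ E F ψ)) (z - x)) x := by
  obtain ⟨B, hB, hdom⟩ := exists_schwartz_dominating (-(SchwartzMap.fderivCLM ℝ E F ψ))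
  have hm : ∀ {F' : Type} [NormedAddCommGroup F'] [NormedSpace ℝ F'] (ψ : SchwartzMap E F')
      (x : E), AEStronglyMeasurable (fun z => g z • ψ (z - x)) (volume : Measure E) :=
    fun ψ x => hg.aestronglyMeasurable.smul
      (ψ.continuous.comp (continuous_id.sub continuous_const)).aestronglyMeasurable
  have hd : ∀ y : E, HasFDerivAt ψ (SchwartzMap.fderivCLM ℝ E F ψ y) y := fun y => by
    rw [SchwartzMap.fderivCLM_apply]
    exact ψ.differentiableAt.hasFDerivAt
  refine hasFDerivAt_integral_of_dominated_of_fderiv_le (s := Metric.closedBall x 1)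
    (bound := fun z => C * B (z - x))
    (F' := fun y z => g z • (-(SchwartzMap.fderivCLM ℝ E F ψ)) (z - y))
    (Metric.closedBall_mem_nhds x one_pos)
    (Eventually.of_forall fun y => hm ψ y) ?_ (hm _ x) ?_ ?_ ?_
  · refine ((ψ.integrable (μ := volume)).comp_sub_right x).bdd_smul C
      hg.aestronglyMeasurable (Eventually.of_forall hC)
  · refine Eventually.of_forall fun z y hy => ?_
    rw [norm_smul]
    have h0 : 0 ≤ C := (abs_nonneg _).trans (hC 0)
    refine mul_le_mul (hC z) ?_ (norm_nonneg _) h0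
    have := hdom (z - x) (y - x) (by simpa [dist_eq_norm] using hy)
    rwa [sub_sub_sub_cancel_right] at this
  · exact (hB.comp_sub_right x).const_mul C
  · refine Eventually.of_forall fun z y _ => ?_
    have h1 : HasFDerivAt (fun y => ψ (z - y))
        ((SchwartzMap.fderivCLM ℝ E F ψ (z - y)).comp (-(ContinuousLinearMap.id ℝ E))) y :=
      (hd (z - y)).comp y ((hasFDerivAt_id y).const_sub z)
    have h2 := h1.const_smul (g z)
    convert! h2 using 2
    ext v
    simp

/-- Integrals against Schwartz kernels are a stable family, since the derivative of a Schwartz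
kernel is a Schwartz kernel with values in another space. -/
theorem bddSmooth_integral_schwartz (ψ : SchwartzMap E F) {g : E → ℝ} (hg : Measurable g)
    {C : ℝ} (hC : ∀ x, |g x| ≤ C) : BddSmooth fun x => ∫ z, g z • ψ (z - x) := by
  refine BddSmooth.of_stable
    (fun F _ _ v => ∃ ψ : SchwartzMap E F, v = fun x => ∫ z, g z • ψ (z - x)) ?_ ⟨ψ, rfl⟩
  rintro F _ _ _ ⟨ψ, rfl⟩
  refine ⟨⟨C * ∫ z, ‖ψ z‖, fun x => ?_⟩,
    fun x => (hasFDerivAt_integral_schwartz ψ hg hC x).differentiableAt,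
    -(SchwartzMap.fderivCLM ℝ E F ψ), ?_⟩
  · rw [← integral_sub_right_eq_self (fun z => ‖ψ z‖) x, ← integral_const_mul]
    refine norm_integral_le_of_norm_le
      (((ψ.integrable (μ := volume)).norm.comp_sub_right x).const_mul C)
      (Eventually.of_forall fun z => ?_)
    rw [norm_smul]
    exact mul_le_mul_of_nonneg_right (hC z) (norm_nonneg _)
  · ext1 x
    exact (hasFDerivAt_integral_schwartz ψ hg hC x).fderiv

end Kernel

/-! ### The Gaussian kernel -/

section Gaussian

variable {V : Type} [NormedAddCommGroup V] [InnerProductSpace ℝ V]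

/-- The power is at most N! exp(1 + r) by the exponential series, and r - c r² ≤ 1/(4c) by
completing the square. -/
theorem one_add_pow_mul_exp_neg_sq_le (N : ℕ) {c : ℝ} (hc : 0 < c) {r : ℝ} (hr : 0 ≤ r) :
    (1 + r) ^ N * Real.exp (-c * r ^ 2) ≤ N.factorial * Real.exp (1 + 1 / (4 * c)) := by
  have h1 : (1 + r) ^ N ≤ N.factorial * Real.exp (1 + r) := by
    have := Real.pow_div_factorial_le_exp (1 + r) (by linarith) N
    rwa [div_le_iff₀' (by positivity)] at this
  calc (1 + r) ^ N * Real.exp (-c * r ^ 2)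
      ≤ N.factorial * Real.exp (1 + r) * Real.exp (-c * r ^ 2) := by gcongr
    _ = N.factorial * Real.exp (1 + r + -c * r ^ 2) := by rw [mul_assoc, Real.exp_add (1 + r)]
    _ ≤ _ := by
      refine mul_le_mul_of_nonneg_left (Real.exp_le_exp.2 ?_) (by positivity)
      have : 1 / (4 * c) - r + c * r ^ 2 = (2 * c * r - 1) ^ 2 / (4 * c) := by field_simp; ring
      have h2 : 0 ≤ (2 * c * r - 1) ^ 2 / (4 * c) := by positivity
      linarith

/-- Leibniz rule for the bilinear form ⟨y, y⟩. Every iterated derivative of the identity has norm at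
most 1 + ‖x‖, and the binomial coefficients sum to 2^i. -/
theorem norm_iteratedFDeriv_norm_sq_le (i : ℕ) (x : V) :
    ‖iteratedFDeriv ℝ i (fun y : V => ‖y‖ ^ 2) x‖ ≤ 2 ^ i * (1 + ‖x‖) ^ 2 := by
  have hd : fderiv ℝ (fun y : V => y) = fun _ => ContinuousLinearMap.id ℝ V := by
    ext1 y; exact fderiv_fun_id
  have hid : ∀ j : ℕ, ‖iteratedFDeriv ℝ j (fun y : V => y) x‖ ≤ 1 + ‖x‖ := by
    intro j
    rcases j with _ | _ | j
    · rw [norm_iteratedFDeriv_zero]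
      linarith
    · rw [← norm_iteratedFDeriv_fderiv, norm_iteratedFDeriv_zero, hd]
      exact ContinuousLinearMap.norm_id_le.trans (by linarith [norm_nonneg x])
    · rw [← norm_iteratedFDeriv_fderiv, hd, iteratedFDeriv_const_of_ne (by omega)]
      simp only [Pi.zero_apply, norm_zero]
      positivity
  have hB : ∀ x y : V, ‖innerₗ V x y‖ ≤ 1 * ‖x‖ * ‖y‖ := fun x y => by
    rw [one_mul]; exact norm_inner_le_norm x y
  have h := (LinearMap.mkContinuous₂ (innerₗ V) 1 hB).norm_iteratedFDeriv_le_of_bilinear (f := fun y : V => y)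
    (g := fun y : V => y) (N := (i : WithTop ℕ∞)) contDiff_id contDiff_id x (n := i) le_rfl
  have e : (fun y : V => LinearMap.mkContinuous₂ (innerₗ V) 1 hB y y) = fun y : V => ‖y‖ ^ 2 := by
    ext y; exact real_inner_self_eq_norm_sq y
  rw [e] at h
  refine h.trans ?_
  calc ‖LinearMap.mkContinuous₂ (innerₗ V) 1 hB‖ * ∑ j ∈ Finset.range (i + 1), (i.choose j : ℝ)
        * ‖iteratedFDeriv ℝ j (fun y : V => y) x‖ * ‖iteratedFDeriv ℝ (i - j) (fun y : V => y) x‖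
      ≤ 1 * ∑ j ∈ Finset.range (i + 1), (i.choose j : ℝ) * (1 + ‖x‖) * (1 + ‖x‖) := by
        refine mul_le_mul (LinearMap.mkContinuous₂_norm_le _ zero_le_one _) (Finset.sum_le_sum fun j _ => ?_)
          (Finset.sum_nonneg fun j _ => by positivity) zero_le_one
        exact mul_le_mul (mul_le_mul_of_nonneg_left (hid _) (by positivity)) (hid _)
          (norm_nonneg _) (by positivity)
    _ = _ := by
        simp_rw [mul_assoc]
        rw [← Finset.sum_mul, one_mul, ← Nat.cast_sum, Nat.sum_range_choose]
        push_cast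
        ring

/-- Faà di Bruno bound for exp composed with -c‖y‖²: all derivatives of exp equal exp, and for i ≥ 1
the i-th derivative of the exponent is at most (2(1 + c)(1 + ‖x‖)²)^i. A polynomial times a Gaussian
is bounded. -/
theorem gaussian_decay {c : ℝ} (hc : 0 < c) (k n : ℕ) :
    ∃ C : ℝ, ∀ x : V, ‖x‖ ^ k * ‖iteratedFDeriv ℝ n (fun y : V => Real.exp (-c * ‖y‖ ^ 2)) x‖
      ≤ C := by
  refine ⟨n.factorial * (2 * (1 + c)) ^ n *
    ((k + 2 * n).factorial * Real.exp (1 + 1 / (4 * c))), fun x => ?_⟩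
  have hq : ContDiff ℝ ((⊤ : ℕ∞) : WithTop ℕ∞) (fun y : V => -c * ‖y‖ ^ 2) :=
    contDiff_const.mul (contDiff_norm_sq ℝ)
  have h := norm_iteratedFDeriv_comp_le (𝕜 := ℝ) (g := Real.exp)
    (f := fun y : V => -c * ‖y‖ ^ 2) (n := n) (N := ((⊤ : ℕ∞) : WithTop ℕ∞))
    Real.contDiff_exp hq
    (by exact_mod_cast le_top) x (C := Real.exp (-c * ‖x‖ ^ 2))
    (D := 2 * (1 + c) * (1 + ‖x‖) ^ 2)
    (by
      intro i _
      rw [norm_iteratedFDeriv_eq_norm_iteratedDeriv, iteratedDeriv_eq_iterate, Real.iter_deriv_exp,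
        Real.norm_eq_abs, abs_of_pos (Real.exp_pos _)])
    (by
      intro i hi _
      have e : (fun y : V => -c * ‖y‖ ^ 2) = fun y : V => (-c) • (‖y‖ ^ 2) := rfl
      have e' := iteratedFDeriv_const_smul_apply' (𝕜 := ℝ) (i := i) (a := -c) (x := x)
        (f := fun y : V => ‖y‖ ^ 2) ((contDiff_norm_sq ℝ).contDiffAt)
      rw [e, e', norm_smul]
      calc ‖-c‖ * ‖iteratedFDeriv ℝ i (fun y : V => ‖y‖ ^ 2) x‖
          ≤ c * (2 ^ i * (1 + ‖x‖) ^ 2) := by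
            rw [norm_neg, Real.norm_eq_abs, abs_of_pos hc]
            gcongr
            exact norm_iteratedFDeriv_norm_sq_le i x
        _ ≤ (1 + c) ^ i * (2 ^ i * ((1 + ‖x‖) ^ 2) ^ i) := by
            gcongr
            · calc c ≤ 1 + c := by linarith
                _ ≤ (1 + c) ^ i := le_self_pow₀ (by linarith) (by omega)
            · refine le_self_pow₀ ?_ (by omega)
              exact one_le_pow₀ (by linarith [norm_nonneg x])
        _ = _ := by rw [mul_pow, mul_pow]; ring)
  have hf : (Real.exp ∘ fun y : V => -c * ‖y‖ ^ 2) = fun y : V => Real.exp (-c * ‖y‖ ^ 2) := rfl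
  rw [hf] at h
  calc ‖x‖ ^ k * ‖iteratedFDeriv ℝ n (fun y : V => Real.exp (-c * ‖y‖ ^ 2)) x‖
      ≤ (1 + ‖x‖) ^ k * (n.factorial * Real.exp (-c * ‖x‖ ^ 2)
        * (2 * (1 + c) * (1 + ‖x‖) ^ 2) ^ n) := by
        gcongr
        linarith
    _ = n.factorial * (2 * (1 + c)) ^ n
        * ((1 + ‖x‖) ^ (k + 2 * n) * Real.exp (-c * ‖x‖ ^ 2)) := by
        rw [mul_pow, pow_add, ← pow_mul]; ring
    _ ≤ _ := by
        refine mul_le_mul_of_nonneg_left ?_ (by positivity)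
        exact one_add_pow_mul_exp_neg_sq_le _ hc (norm_nonneg x)

/-- The Gaussian `x ↦ exp (-c ‖x‖ ^ 2)` as a Schwartz function. -/
noncomputable def gaussianSchwartz (V : Type) [NormedAddCommGroup V] [InnerProductSpace ℝ V]
    {c : ℝ} (hc : 0 < c) : SchwartzMap V ℝ where
  toFun y := Real.exp (-c * ‖y‖ ^ 2)
  smooth' := Real.contDiff_exp.comp (contDiff_const.mul (contDiff_norm_sq ℝ))
  decay' := gaussian_decay hc

theorem gaussianSchwartz_apply {c : ℝ} (hc : 0 < c) (y : V) :
    gaussianSchwartz V hc y = Real.exp (-c * ‖y‖ ^ 2) := rfl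

end Gaussian

/-! ### Smoothing by Gaussian measures -/

section GaussianMeasure

variable {n : ℕ}

theorem posSemidef_smul_one {δ : ℝ} (hδ : 0 ≤ δ) :
    (δ • (1 : Matrix (Fin n) (Fin n) ℝ)).PosSemidef :=
  Matrix.PosSemidef.one.smul hδ

/-- Both measures have the same characteristic function. The normalizing constant K, the inverse of
the Gaussian integral, stays implicit because its value is never used. -/
theorem multivariateGaussian_eq_withDensity {δ : ℝ} (hδ : 0 < δ) :
    ∃ K : ℝ, 0 ≤ K ∧ multivariateGaussian (0 : EuclideanSpace ℝ (Fin n)) (δ • 1)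
      = volume.withDensity fun z => ENNReal.ofReal (K * Real.exp (-(1 / (2 * δ)) * ‖z‖ ^ 2)) := by
  set V := EuclideanSpace ℝ (Fin n)
  have hc : 0 < 1 / (2 * δ) := by positivity
  set c := 1 / (2 * δ) with hcdef
  have hi : Integrable fun z : V => Real.exp (-c * ‖z‖ ^ 2) :=
    (gaussianSchwartz V hc).integrable
  set A := ∫ z : V, Real.exp (-c * ‖z‖ ^ 2) with hA
  have hformula : ∀ t : V, ∫ v : V, Complex.exp (-(c : ℂ) * ‖v‖ ^ 2 + Complex.I * ⟪t, v⟫)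
      = (A : ℂ) * Complex.exp (-(δ * ‖t‖ ^ 2 / 2 : ℝ)) := by
    intro t
    have hre : 0 < (c : ℂ).re := by simpa using hc
    have h0 := GaussianFourier.integral_cexp_neg_mul_sq_norm_add hre 0 (0 : V)
    have h1 := GaussianFourier.integral_cexp_neg_mul_sq_norm_add hre Complex.I t
    simp only [zero_mul, add_zero, ne_eq, OfNat.ofNat_ne_zero, not_false_eq_true, zero_pow,
      zero_div, Complex.exp_zero, mul_one] at h0
    rw [h1, ← h0, hA, ← integral_complex_ofReal]
    congr 1
    · refine integral_congr_ae (Eventually.of_forall fun v => ?_)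
      push_cast
      rfl
    · congr 1
      rw [Complex.I_sq]
      push_cast [hcdef]
      field_simp
      ring
  have hApos : 0 < A := by
    rw [hA, integral_pos_iff_support_of_nonneg (fun z => (Real.exp_pos _).le) hi]
    have : Function.support (fun z : V => Real.exp (-c * ‖z‖ ^ 2)) = univ := by
      ext z; simp [(Real.exp_pos _).ne']
    rw [this]
    exact isOpen_univ.measure_pos _ univ_nonempty
  refine ⟨A⁻¹, by positivity, ?_⟩
  have hfin : IsFiniteMeasure ((volume : Measure V).withDensity
      fun z => ENNReal.ofReal (A⁻¹ * Real.exp (-c * ‖z‖ ^ 2))) :=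
    isFiniteMeasure_withDensity_ofReal (hi.const_mul _).2
  refine Measure.ext_of_charFun ?_
  ext t
  rw [charFun_multivariateGaussian (posSemidef_smul_one hδ.le), charFun_apply,
    integral_withDensity_eq_integral_toReal_smul (by fun_prop) (by simp)]
  have e : ∀ v : V, (ENNReal.ofReal (A⁻¹ * Real.exp (-c * ‖v‖ ^ 2))).toReal
      • Complex.exp (⟪v, t⟫ * Complex.I)
      = (A : ℂ)⁻¹ * Complex.exp (-(c : ℂ) * ‖v‖ ^ 2 + Complex.I * ⟪t, v⟫) := by
    intro v
    rw [ENNReal.toReal_ofReal (by positivity), Complex.exp_add, Complex.real_smul,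
      real_inner_comm, mul_comm Complex.I]
    push_cast
    ring
  simp_rw [e]
  rw [integral_const_mul, hformula, ← mul_assoc, inv_mul_cancel₀ (by exact_mod_cast hApos.ne'),
    one_mul]
  congr 1
  have : (t : V).ofLp ⬝ᵥ ((δ • (1 : Matrix (Fin n) (Fin n) ℝ)).mulVec t.ofLp) = δ * ‖t‖ ^ 2 := by
    rw [Matrix.smul_mulVec, Matrix.one_mulVec, dotProduct_smul, EuclideanSpace.real_norm_sq_eq]
    simp [dotProduct, sq]
  rw [inner_zero_right, this]
  push_cast
  ring

theorem bddSmooth_integral_gaussian_isotropic {δ : ℝ} (hδ : 0 < δ)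
    {g : EuclideanSpace ℝ (Fin n) → ℝ} (hg : Measurable g) {C : ℝ} (hC : ∀ x, |g x| ≤ C) :
    BddSmooth fun x => ∫ z, g (x + z) ∂(multivariateGaussian 0 (δ • 1)) := by
  obtain ⟨K, hK, hd⟩ := multivariateGaussian_eq_withDensity (n := n) hδ
  have hc : 0 < 1 / (2 * δ) := by positivity
  have h := bddSmooth_integral_schwartz (K • gaussianSchwartz (EuclideanSpace ℝ (Fin n)) hc) hg hC
  refine (congrArg BddSmooth (funext fun x => ?_)).mpr h
  rw [hd, integral_withDensity_eq_integral_toReal_smul (by fun_prop) (by simp),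
    ← integral_sub_right_eq_self _ x]
  refine integral_congr_ae (Eventually.of_forall fun z => ?_)
  simp only [add_sub_cancel, smul_apply, gaussianSchwartz_apply]
  rw [ENNReal.toReal_ofReal (by positivity)]
  simp only [smul_eq_mul]
  ring

/-- Split off an isotropic part: the Gaussian with covariance S is the convolution of those with
covariances S - δ and δ. The isotropic factor smooths `g`, and averaging over the other factor
preserves bounded smoothness. No inverse of S is needed. -/
theorem bddSmooth_integral_gaussian {δ : ℝ} (hδ : 0 < δ) (m : EuclideanSpace ℝ (Fin n))
    {S : Matrix (Fin n) (Fin n) ℝ} (hS : (S - δ • 1).PosSemidef)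
    {g : EuclideanSpace ℝ (Fin n) → ℝ} (hg : Measurable g) {C : ℝ} (hC : ∀ x, |g x| ≤ C) :
    BddSmooth fun x => ∫ z, g (x + z) ∂(multivariateGaussian m S) := by
  have hS' : S.PosSemidef := by
    simpa using hS.add (posSemidef_smul_one (n := n) hδ.le)
  have hconv : multivariateGaussian m S
      = multivariateGaussian m (S - δ • 1) ∗ multivariateGaussian 0 (δ • 1) := by
    refine Measure.ext_of_charFun ?_
    ext t
    rw [charFun_conv, charFun_multivariateGaussian hS', charFun_multivariateGaussian hS,
      charFun_multivariateGaussian (posSemidef_smul_one hδ.le), ← Complex.exp_add,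
      Matrix.sub_mulVec, dotProduct_sub]
    congr 1
    simp only [inner_zero_right]
    push_cast
    ring
  have h := (bddSmooth_integral_gaussian_isotropic hδ hg hC).integral
    (multivariateGaussian m (S - δ • 1))
  refine (congrArg BddSmooth (funext fun x => ?_)).mpr h
  have hgx : Measurable fun z => g (x + z) := hg.comp (measurable_const_add x)
  rw [hconv, Measure.conv, integral_map (by fun_prop) hgx.aestronglyMeasurable, integral_prod]
  · simp only [add_assoc]
  · exact Integrable.of_bound (hg.comp (by fun_prop)).aestronglyMeasurable C
      (Eventually.of_forall fun _ => hC _)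

end GaussianMeasure

/-! ### Logarithmic coordinates -/

/-- The coordinatewise logarithm. -/
noncomputable def logE {n : ℕ} (y : EuclideanSpace ℝ (Fin n)) : EuclideanSpace ℝ (Fin n) :=
  WithLp.toLp 2 fun i => Real.log (y i)

/-- The coordinatewise exponential. -/
noncomputable def expE {n : ℕ} (x : EuclideanSpace ℝ (Fin n)) : EuclideanSpace ℝ (Fin n) :=
  WithLp.toLp 2 fun i => Real.exp (x i)

/-- The constant coefficient operator that corresponds to `y_{i_1} ⋯ y_{i_m} ∂_{i_1} ⋯ ∂_{i_m}` in
logarithmic coordinates. -/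
noncomputable def eulerOp {n : ℕ} : (m : ℕ) → (Fin m → Fin n) → (EuclideanSpace ℝ (Fin n) → ℝ) →
    EuclideanSpace ℝ (Fin n) → ℝ
  | 0, _, w => w
  -- Let c be the number of times y_j occurs in the monomial y^α. Then y_j ∂_j (y^α ∂^α v) = c y^α
  -- ∂^α v + y_j y^α ∂_j ∂^α v, and y_j ∂_j is the plain derivative ∂_j in logarithmic coordinates.
  -- Hence the correction -c.
  | m + 1, i, w => fun x =>
    fderiv ℝ (eulerOp m (Fin.tail i) w) x (EuclideanSpace.single (i 0) 1)
      + (-((Finset.univ.filter fun k => Fin.tail i k = i 0).card : ℝ))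
        • eulerOp m (Fin.tail i) w x

section

variable {n : ℕ}

theorem isOpen_orthant : IsOpen (orthant n) := by
  have : orthant n = ⋂ i : Fin n, {y : EuclideanSpace ℝ (Fin n) | 0 < y i} := by
    ext y; simp [orthant]
  rw [this]
  exact isOpen_iInter_of_finite fun i => isOpen_lt continuous_const (by fun_prop)

theorem measurable_logE : Measurable (logE (n := n)) := by
  unfold logE
  fun_prop

theorem continuous_expE : Continuous (expE (n := n)) := by
  unfold expE
  fun_prop

theorem expE_mem_orthant (x : EuclideanSpace ℝ (Fin n)) : expE x ∈ orthant n :=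
  fun i => Real.exp_pos (x i)

theorem expE_logE {y : EuclideanSpace ℝ (Fin n)} (hy : y ∈ orthant n) : expE (logE y) = y := by
  ext i
  exact Real.exp_log (hy i)

theorem logE_expE (x : EuclideanSpace ℝ (Fin n)) : logE (expE x) = x := by
  ext i
  exact Real.log_exp (x i)

theorem contDiffOn_logE : ContDiffOn ℝ ((⊤ : ℕ∞) : WithTop ℕ∞) (logE (n := n)) (orthant n) := by
  rw [contDiffOn_euclidean]
  intro i
  refine ContDiffOn.log ?_ fun y hy => (hy i).ne'
  exact (EuclideanSpace.proj (𝕜 := ℝ) i).contDiff.contDiffOn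

theorem BddSmooth.eulerOp {w : EuclideanSpace ℝ (Fin n) → ℝ} (hw : BddSmooth w) :
    ∀ (m : ℕ) (i : Fin m → Fin n), BddSmooth (LogNormal.eulerOp m i w) := by
  intro m
  induction m with
  | zero => exact fun _ => hw
  | succ m ih =>
    intro i
    exact ((ih (Fin.tail i)).fderiv_apply _).add ((ih (Fin.tail i)).const_smul _)

/-- An operator with constant coefficients commutes with averaging over translations. -/
theorem eulerOp_integral {w : EuclideanSpace ℝ (Fin n) → ℝ} (hw : BddSmooth w)
    (γ : Measure (EuclideanSpace ℝ (Fin n))) [IsProbabilityMeasure γ] :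
    ∀ (m : ℕ) (i : Fin m → Fin n), eulerOp m i (fun x => ∫ z, w (x + z) ∂γ)
      = fun x => ∫ z, eulerOp m i w (x + z) ∂γ := by
  intro m
  induction m with
  | zero => exact fun _ => rfl
  | succ m ih =>
    intro i
    ext x
    have hb := hw.eulerOp m (Fin.tail i)
    have int : ∀ {u : EuclideanSpace ℝ (Fin n) → ℝ}, BddSmooth u →
        Integrable (fun z => u (x + z)) γ := by
      intro u hu
      obtain ⟨C, hC⟩ := hu.exists_bound
      exact Integrable.of_bound (hu.1.continuous.comp
        (continuous_const.add continuous_id)).aestronglyMeasurable C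
        (Eventually.of_forall fun z => hC _)
    simp only [eulerOp]
    rw [ih (Fin.tail i), hb.fderiv_integral_apply γ]
    simp only [smul_eq_mul]
    rw [integral_add (int (hb.fderiv_apply _)) ((int hb).const_mul _), integral_const_mul]

/-- Induction on the order. The identity for the tail is differentiated at 0 along the curve s ↦ y +
s y_j e_j, which in logarithmic coordinates is log y + log(1 + s) e_j. The monomial scales by (1 +
s)^c along it, and the product rule yields exactly the recursion of `eulerOp`. -/
theorem prod_mul_mixedPartial {w v : EuclideanSpace ℝ (Fin n) → ℝ}
    (hw : BddSmooth w) (hv : ∀ y ∈ orthant n, v y = w (logE y)) :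
    ∀ (m : ℕ) (i : Fin m → Fin n), ∀ y ∈ orthant n,
      (∏ k, y (i k)) * mixedPartial i v y = eulerOp m i w (logE y) := by
  have hvs : ContDiffOn ℝ ((⊤ : ℕ∞) : WithTop ℕ∞) v (orthant n) :=
    (hw.1.comp_contDiffOn contDiffOn_logE).congr hv
  intro m
  induction m with
  | zero =>
    intro i y hy
    simp [mixedPartial, eulerOp, hv y hy]
  | succ m ih =>
    intro i y hy
    set j := i 0 with hj
    set e : EuclideanSpace ℝ (Fin n) := EuclideanSpace.single j 1 with he
    set c := (Finset.univ.filter fun k => Fin.tail i k = i 0).card with hc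
    have hcurve : ∀ (s : ℝ) (l : Fin n), (y + s • (y j • e)) l
        = y l * (if l = j then 1 + s else 1) := by
      intro s l
      by_cases h : l = j
      · subst h; simp [he]; ring
      · simp [he, h]
    have hdc : HasDerivAt (fun s : ℝ => y + s • (y j • e)) (y j • e) 0 := by
      simpa using ((hasDerivAt_id (0 : ℝ)).smul_const (y j • e)).const_add y
    have hev : ∀ᶠ s in 𝓝 (0 : ℝ), y + s • (y j • e) ∈ orthant n := by
      refine hdc.continuousAt.eventually_mem (isOpen_orthant.mem_nhds ?_)
      simpa using hy
    have hA : HasDerivAt (fun s : ℝ => (∏ k, y (Fin.tail i k)) * (1 + s) ^ c)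
        ((∏ k, y (Fin.tail i k)) * c) 0 := by
      have := (((hasDerivAt_id (0 : ℝ)).const_add 1).pow c).const_mul
        (∏ k, y (Fin.tail i k))
      simpa using this
    have hB : HasDerivAt (fun s : ℝ => mixedPartial (Fin.tail i) v (y + s • (y j • e)))
        (y j * mixedPartial i v y) 0 := by
      have hd : DifferentiableAt ℝ (iteratedFDeriv ℝ m v) y :=
        (hvs.contDiffAt (isOpen_orthant.mem_nhds hy)).differentiableAt_iteratedFDeriv
          (by exact_mod_cast WithTop.coe_lt_top m)
      have hd' : HasFDerivAt (fun z => mixedPartial (Fin.tail i) v z)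
          ((ContinuousMultilinearMap.apply ℝ (fun _ : Fin m => EuclideanSpace ℝ (Fin n)) ℝ
            (fun k => EuclideanSpace.single (Fin.tail i k) 1)).comp
              (fderiv ℝ (iteratedFDeriv ℝ m v) y)) y :=
        ((ContinuousMultilinearMap.apply ℝ (fun _ : Fin m => EuclideanSpace ℝ (Fin n)) ℝ
            (fun k => EuclideanSpace.single (Fin.tail i k) 1)).hasFDerivAt).comp y hd.hasFDerivAt
      have h3 := HasFDerivAt.comp_hasDerivAt (0 : ℝ)
        (l := fun z => mixedPartial (Fin.tail i) v z)
        (f := fun s : ℝ => y + s • (y j • e)) (by simpa using hd') hdc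
      -- True by definition: the iterated derivative of order m + 1 is the derivative of the one of
      -- order m, with the new direction in the first slot. This is why `eulerOp` peels off `i 0`.
      have h4 : ((ContinuousMultilinearMap.apply ℝ (fun _ : Fin m => EuclideanSpace ℝ (Fin n)) ℝ
            (fun k => EuclideanSpace.single (Fin.tail i k) 1)).comp
              (fderiv ℝ (iteratedFDeriv ℝ m v) y)) (y j • e) = y j * mixedPartial i v y := by
        rw [map_smul, smul_eq_mul]
        rfl
      rw [← h4]
      exact h3
    have hC : HasDerivAt (fun s : ℝ => eulerOp m (Fin.tail i) w (logE y + Real.log (1 + s) • e))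
        (fderiv ℝ (eulerOp m (Fin.tail i) w) (logE y) e) 0 := by
      have hd := ((hw.eulerOp m (Fin.tail i)).differentiable (logE y)).hasFDerivAt
      have hl : HasDerivAt (fun s : ℝ => logE y + Real.log (1 + s) • e) e 0 := by
        have h1 : HasDerivAt (fun s : ℝ => Real.log (1 + s)) 1 0 := by
          simpa using ((hasDerivAt_id (0 : ℝ)).const_add 1).log (by simp)
        simpa using (h1.smul_const e).const_add (logE y)
      exact HasFDerivAt.comp_hasDerivAt (0 : ℝ) (l := eulerOp m (Fin.tail i) w)
        (f := fun s : ℝ => logE y + Real.log (1 + s) • e) (by simpa using hd) hl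
    -- The induction hypothesis at the points of the curve near s = 0, which remain in the orthant.
    -- Uniqueness of derivatives then compares the two sides.
    have heq : (fun s : ℝ => eulerOp m (Fin.tail i) w (logE y + Real.log (1 + s) • e))
        =ᶠ[𝓝 0] fun s : ℝ => (∏ k, y (Fin.tail i k)) * (1 + s) ^ c
          * mixedPartial (Fin.tail i) v (y + s • (y j • e)) := by
      have h1 : ∀ᶠ s in 𝓝 (0 : ℝ), -1 < s := lt_mem_nhds (by norm_num)
      filter_upwards [hev, h1] with s hs hs1
      have h2 : logE (y + s • (y j • e)) = logE y + Real.log (1 + s) • e := by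
        ext l
        simp only [logE, PiLp.add_apply, PiLp.smul_apply]
        have := hcurve s l
        simp only [PiLp.add_apply, PiLp.smul_apply] at this
        rw [this, Real.log_mul (hy l).ne' (by split_ifs <;> linarith)]
        by_cases h : l = j
        · subst h; simp [he]
        · simp [he, h]
      rw [← h2, ← ih (Fin.tail i) _ hs]
      congr 1
      simp_rw [hcurve]
      rw [Finset.prod_mul_distrib]
      congr 1
      rw [Finset.prod_ite, Finset.prod_const, Finset.prod_const_one, mul_one, hc]
    have huniq := (hC.congr_of_eventuallyEq heq.symm).unique (hA.mul hB)
    simp only [zero_smul, add_zero] at huniq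
    simp only [eulerOp]
    rw [huniq, ← ih (Fin.tail i) y hy, Fin.prod_univ_succ]
    have ht : ∏ k : Fin m, y (i k.succ) = ∏ k, y (Fin.tail i k) := rfl
    rw [ht, ← hj, smul_eq_mul]
    ring

end

/-! ### Moments of isotropic Gaussian vectors -/

section GaussianMoments

variable {d : ℕ} {δ : ℝ}

theorem dotProduct_smul_one_mulVec (a b : EuclideanSpace ℝ (Fin d)) :
    a.ofLp ⬝ᵥ ((δ • (1 : Matrix (Fin d) (Fin d) ℝ)).mulVec b.ofLp) = ⟪a, b⟫ * δ := by
  rw [Matrix.smul_mulVec, Matrix.one_mulVec, dotProduct_smul, PiLp.inner_apply, smul_eq_mul,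
    mul_comm]
  simp [dotProduct, mul_comm]

theorem integral_inner_mul_inner_gaussian (hδ : 0 ≤ δ) (a b : EuclideanSpace ℝ (Fin d)) :
    ∫ x, ⟪a, x⟫ * ⟪b, x⟫ ∂(multivariateGaussian 0 (δ • 1)) = ⟪a, b⟫ * δ := by
  have h := covarianceBilin_apply
    (μ := multivariateGaussian (0 : EuclideanSpace ℝ (Fin d)) (δ • 1)) IsGaussian.memLp_two_id a b
  rw [covarianceBilin_multivariateGaussian (posSemidef_smul_one hδ),
    integral_id_multivariateGaussian', dotProduct_smul_one_mulVec] at h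
  simpa using h.symm

theorem memLp_inner_gaussian (a : EuclideanSpace ℝ (Fin d)) (p : ℝ≥0∞) (hp : p ≠ ∞) :
    MemLp (fun x => ⟪a, x⟫) p (multivariateGaussian (0 : EuclideanSpace ℝ (Fin d)) (δ • 1)) :=
  (innerSL ℝ a).comp_memLp' (IsGaussian.memLp_id _ p hp)

theorem integral_inner_gaussian (a : EuclideanSpace ℝ (Fin d)) :
    ∫ x, ⟪a, x⟫ ∂(multivariateGaussian (0 : EuclideanSpace ℝ (Fin d)) (δ • 1)) = 0 := by
  rw [integral_inner (f := fun x => x) IsGaussian.integrable_id, integral_id_multivariateGaussian,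
    inner_zero_right]

theorem map_inner_gaussian (hδ : 0 ≤ δ) (a : EuclideanSpace ℝ (Fin d)) :
    (multivariateGaussian (0 : EuclideanSpace ℝ (Fin d)) (δ • 1)).map (fun x => ⟪a, x⟫)
      = gaussianReal 0 (‖a‖ ^ 2 * δ).toNNReal := by
  have h := IsGaussian.map_eq_gaussianReal
    (μ := multivariateGaussian (0 : EuclideanSpace ℝ (Fin d)) (δ • 1)) (innerSL ℝ a)
  have h1 : ∫ x, innerSL ℝ a x ∂(multivariateGaussian (0 : EuclideanSpace ℝ (Fin d)) (δ • 1)) = 0 :=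
    integral_inner_gaussian a
  have h2 : Var[innerSL ℝ a; multivariateGaussian (0 : EuclideanSpace ℝ (Fin d)) (δ • 1)]
      = ‖a‖ ^ 2 * δ := by
    have := covarianceBilin_self
      (μ := multivariateGaussian (0 : EuclideanSpace ℝ (Fin d)) (δ • 1)) IsGaussian.memLp_two_id a
    rw [covarianceBilin_multivariateGaussian (posSemidef_smul_one hδ), dotProduct_smul_one_mulVec,
      real_inner_self_eq_norm_sq] at this
    exact this.symm
  rw [h1, h2] at h
  exact h

theorem integrable_exp_inner_gaussian (hδ : 0 ≤ δ) (a : EuclideanSpace ℝ (Fin d)) :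
    Integrable (fun x => Real.exp ⟪a, x⟫)
      (multivariateGaussian (0 : EuclideanSpace ℝ (Fin d)) (δ • 1)) := by
  have h := integrable_exp_mul_gaussianReal (μ := 0) (v := (‖a‖ ^ 2 * δ).toNNReal) 1
  rw [← map_inner_gaussian hδ, integrable_map_measure (by fun_prop) (by fun_prop)] at h
  simpa [Function.comp_def] using h

theorem integral_exp_inner_gaussian (hδ : 0 ≤ δ) (a : EuclideanSpace ℝ (Fin d)) :
    ∫ x, Real.exp ⟪a, x⟫ ∂(multivariateGaussian (0 : EuclideanSpace ℝ (Fin d)) (δ • 1))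
      = Real.exp (‖a‖ ^ 2 * δ / 2) := by
  have h := mgf_gaussianReal (map_inner_gaussian hδ a) 1
  simpa [mgf, Real.coe_toNNReal _ (mul_nonneg (sq_nonneg ‖a‖) hδ)] using h

theorem integral_cexp_inner_gaussian (hδ : 0 ≤ δ) (a : EuclideanSpace ℝ (Fin d)) :
    ∫ x, Complex.exp (⟪a, x⟫ * Complex.I)
      ∂(multivariateGaussian (0 : EuclideanSpace ℝ (Fin d)) (δ • 1))
      = Complex.exp (-(‖a‖ ^ 2 * δ / 2 : ℝ)) := by
  have h := charFun_multivariateGaussian (μ := (0 : EuclideanSpace ℝ (Fin d)))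
    (posSemidef_smul_one hδ) a
  rw [charFun_apply, dotProduct_smul_one_mulVec, real_inner_self_eq_norm_sq] at h
  simp only [real_inner_comm] at h
  rw [h]
  congr 1
  simp only [inner_zero_right]
  push_cast
  ring

theorem integrable_inner_mul_exp_inner_gaussian (hδ : 0 ≤ δ) (e a : EuclideanSpace ℝ (Fin d)) :
    Integrable (fun x => ⟪e, x⟫ * Real.exp ⟪a, x⟫)
      (multivariateGaussian (0 : EuclideanSpace ℝ (Fin d)) (δ • 1)) := by
  have h2 : MemLp (fun x => Real.exp ⟪a, x⟫) 2
      (multivariateGaussian (0 : EuclideanSpace ℝ (Fin d)) (δ • 1)) := by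
    rw [memLp_two_iff_integrable_sq (by fun_prop)]
    refine (integrable_exp_inner_gaussian hδ ((2 : ℝ) • a)).congr (Eventually.of_forall fun x => ?_)
    simp only [← Real.exp_nat_mul, real_inner_smul_left]
    norm_num
  exact (memLp_inner_gaussian e 2 (by simp)).integrable_mul h2

/-- Tilt the Gaussian by exp⟨a, x⟩. The left side is the first moment of ⟨e, x⟩ under the tilted
measure, hence the derivative at 0 of its moment generating function t ↦ exp(‖a + t e‖² δ / 2). -/
theorem integral_inner_mul_exp_inner_gaussian (hδ : 0 ≤ δ) (e a : EuclideanSpace ℝ (Fin d)) :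
    ∫ x, ⟪e, x⟫ * Real.exp ⟪a, x⟫
      ∂(multivariateGaussian (0 : EuclideanSpace ℝ (Fin d)) (δ • 1))
      = ⟪e, a⟫ * δ * Real.exp (‖a‖ ^ 2 * δ / 2) := by
  set G := multivariateGaussian (0 : EuclideanSpace ℝ (Fin d)) (δ • 1) with hG
  set ν := G.withDensity fun x => ENNReal.ofReal (Real.exp ⟪a, x⟫) with hν
  have hmeas : Measurable fun x : EuclideanSpace ℝ (Fin d) =>
      ENNReal.ofReal (Real.exp ⟪a, x⟫) := by fun_prop
  have hsm : ∀ (t : ℝ) (x : EuclideanSpace ℝ (Fin d)),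
      (ENNReal.ofReal (Real.exp ⟪a, x⟫)).toReal • Real.exp (t * ⟪e, x⟫)
        = Real.exp ⟪a + t • e, x⟫ := by
    intro t x
    rw [ENNReal.toReal_ofReal (Real.exp_pos _).le, smul_eq_mul, ← Real.exp_add, inner_add_left,
      real_inner_smul_left]
  have hint : ∀ t : ℝ, Integrable (fun x => Real.exp (t * ⟪e, x⟫)) ν := by
    intro t
    rw [hν, integrable_withDensity_iff_integrable_smul₀' hmeas.aemeasurable (by simp)]
    simp_rw [hsm]
    exact integrable_exp_inner_gaussian hδ _
  have hmgf : mgf (fun x => ⟪e, x⟫) ν = fun t => Real.exp (‖a + t • e‖ ^ 2 * δ / 2) := by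
    ext t
    rw [mgf, hν, integral_withDensity_eq_integral_toReal_smul hmeas (by simp)]
    simp_rw [hsm]
    exact integral_exp_inner_gaussian hδ _
  have hset : integrableExpSet (fun x => ⟪e, x⟫) ν = univ := by
    ext t; simpa [integrableExpSet] using hint t
  have hd := deriv_mgf_zero (X := fun x => ⟪e, x⟫) (μ := ν) (by simp [hset])
  rw [hmgf, hν, integral_withDensity_eq_integral_toReal_smul hmeas (by simp)] at hd
  have hd2 : HasDerivAt (fun t : ℝ => Real.exp (‖a + t • e‖ ^ 2 * δ / 2))
      (⟪e, a⟫ * δ * Real.exp (‖a‖ ^ 2 * δ / 2)) 0 := by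
    have h1 : HasDerivAt (fun t : ℝ => a + t • e) e 0 := by
      simpa using ((hasDerivAt_id (0 : ℝ)).smul_const e).const_add a
    have h2 := (((h1.norm_sq).mul_const δ).div_const 2).exp
    refine h2.congr_deriv ?_
    simp only [zero_smul, add_zero, real_inner_comm a e]
    ring
  rw [← hd2.deriv, hd]
  refine integral_congr_ae (Eventually.of_forall fun x => ?_)
  simp only [ENNReal.toReal_ofReal (Real.exp_pos _).le, smul_eq_mul]
  ring

end GaussianMoments

/-! ### Step functions -/

/-- A step function: the value is `val k` on `(time k, time (k + 1)]` for `k < N`. -/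
structure StepFn (E : Type) where
  N : ℕ
  time : ℕ → ℝ
  mono : Monotone time
  val : ℕ → E

/-- The truncation of a time to the interval `[p, q]`. -/
noncomputable def clamp (p q x : ℝ) : ℝ := max p (min x q)

theorem clamp_mono (p q : ℝ) : Monotone (clamp p q) := fun _ _ h =>
  max_le_max le_rfl (min_le_min h le_rfl)

theorem clamp_mem {p q : ℝ} (h : p ≤ q) (x : ℝ) : clamp p q x ∈ Icc p q :=
  ⟨le_max_left _ _, max_le h (min_le_right _ _)⟩

theorem clamp_of_le {p q x : ℝ} (h : x ≤ p) : clamp p q x = p :=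
  max_eq_left ((min_le_left _ _).trans h)

theorem clamp_of_ge {p q x : ℝ} (hpq : p ≤ q) (h : q ≤ x) : clamp p q x = q := by
  rw [clamp, min_eq_right h, max_eq_right hpq]

theorem clamp_of_mem {p q x : ℝ} (h : x ∈ Icc p q) : clamp p q x = x := by
  rw [clamp, min_eq_left h.2, max_eq_right h.1]

theorem Ioc_inter_Ioc_length {p q x y : ℝ} (hpq : p ≤ q) (hxy : x ≤ y) :
    volume.real (Ioc x y ∩ Ioc p q) = clamp p q y - clamp p q x := by
  rw [Ioc_inter_Ioc, Real.volume_real_Ioc]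
  unfold clamp
  grind

namespace StepFn

section

variable {E : Type} [NormedAddCommGroup E]

/-- The value of a step function. -/
noncomputable def eval (h : StepFn E) (u : ℝ) : E :=
  ∑ k ∈ Finset.range h.N, (Ioc (h.time k) (h.time (k + 1))).indicator (fun _ => h.val k) u

/-- The intervals of the partition are disjoint, so at most one term of the sum is nonzero at u, and
any map fixing 0 passes through the sum. -/
theorem map_eval {F : Type} [AddCommMonoid F] (h : StepFn E) (φ : ℝ → E → F)
    (hφ : ∀ u, φ u 0 = 0) (u : ℝ) :
    φ u (h.eval u) = ∑ k ∈ Finset.range h.N,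
      (Ioc (h.time k) (h.time (k + 1))).indicator (fun u => φ u (h.val k)) u := by
  have hdisj : ∀ k l, u ∈ Ioc (h.time k) (h.time (k + 1)) → u ∈ Ioc (h.time l) (h.time (l + 1)) →
      k = l := by
    intro k l hk hl
    by_contra hne
    exact Set.disjoint_left.1 (h.mono.pairwise_disjoint_on_Ioc_succ hne) hk hl
  by_cases hex : ∃ k ∈ Finset.range h.N, u ∈ Ioc (h.time k) (h.time (k + 1))
  · obtain ⟨k, hkN, hk⟩ := hex
    have hz : ∀ l ∈ Finset.range h.N, l ≠ k → u ∉ Ioc (h.time l) (h.time (l + 1)) :=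
      fun l _ hlk hl => hlk (hdisj l k hl hk)
    rw [eval, Finset.sum_eq_single_of_mem k hkN
      (fun l hl hlk => indicator_of_notMem (hz l hl hlk) _),
      Finset.sum_eq_single_of_mem k hkN (fun l hl hlk => indicator_of_notMem (hz l hl hlk) _),
      indicator_of_mem hk, indicator_of_mem hk]
  · push Not at hex
    rw [eval, Finset.sum_eq_zero (fun l hl => indicator_of_notMem (hex l hl) _),
      Finset.sum_eq_zero (fun l hl => indicator_of_notMem (hex l hl) _), hφ]

theorem measurable_eval [MeasurableSpace E] [BorelSpace E] [SecondCountableTopology E]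
    (h : StepFn E) : Measurable h.eval := by
  unfold eval
  exact Finset.measurable_sum _ fun k _ => measurable_const.indicator measurableSet_Ioc

theorem exists_bound_eval (h : StepFn E) : ∃ C : ℝ, ∀ u, ‖h.eval u‖ ≤ C := by
  refine ⟨∑ k ∈ Finset.range h.N, ‖h.val k‖, fun u => ?_⟩
  refine (norm_sum_le _ _).trans (Finset.sum_le_sum fun k _ => norm_indicator_le_norm_self _ _)

theorem setIntegral_map_eval (h : StepFn E) {φ : E → ℝ} (hφ : φ 0 = 0) {p q : ℝ} (hpq : p ≤ q) :
    ∫ u in Ioc p q, φ (h.eval u) = ∑ k ∈ Finset.range h.N,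
      φ (h.val k) * (clamp p q (h.time (k + 1)) - clamp p q (h.time k)) := by
  simp_rw [h.map_eval (fun _ => φ) (fun _ => hφ)]
  rw [integral_finsetSum]
  · refine Finset.sum_congr rfl fun k _ => ?_
    rw [integral_indicator_const _ measurableSet_Ioc, measureReal_restrict_apply measurableSet_Ioc,
      Ioc_inter_Ioc_length hpq (h.mono k.le_succ), smul_eq_mul, mul_comm]
  · intro k _
    exact (integrable_const _).indicator measurableSet_Ioc

theorem integral_map_eval (h : StepFn E) {φ : E → ℝ} (hφ : φ 0 = 0) {p q : ℝ} (hpq : p ≤ q) :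
    ∫ u in p..q, φ (h.eval u) = ∑ k ∈ Finset.range h.N,
      φ (h.val k) * (clamp p q (h.time (k + 1)) - clamp p q (h.time k)) := by
  rw [intervalIntegral.integral_of_le hpq, h.setIntegral_map_eval hφ hpq]

end

variable {E : Type} [NormedAddCommGroup E] [InnerProductSpace ℝ E]

/-- The integral of a step function over `(p, q]` with respect to a path. -/
noncomputable def incr (h : StepFn E) (w : ℝ → E) (p q : ℝ) : ℝ :=
  ∑ k ∈ Finset.range h.N, ⟪h.val k, w (clamp p q (h.time (k + 1))) - w (clamp p q (h.time k))⟫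

theorem incr_add (h : StepFn E) (w : ℝ → E) {p q r : ℝ} (hpq : p ≤ q) (hqr : q ≤ r) :
    h.incr w p q + h.incr w q r = h.incr w p r := by
  -- On either side of q one of the two clamped times equals q, and the other one is the time
  -- clamped to [p, r].
  have key : ∀ x, w (clamp p r x) = w (clamp p q x) + w (clamp q r x) - w q := by
    intro x
    rcases le_total x q with hx | hx
    · rw [clamp_of_le hx, add_sub_cancel_right]
      unfold clamp
      rw [min_eq_left hx, min_eq_left (hx.trans hqr)]
    · rw [clamp_of_ge hpq hx, add_sub_cancel_left]
      congr 1
      unfold clamp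
      grind
  unfold incr
  rw [← Finset.sum_add_distrib]
  refine Finset.sum_congr rfl fun k _ => ?_
  rw [← inner_add_right, key, key]
  congr 1
  abel

end StepFn

/-! ### Brownian increments -/

section Brownian

variable {Ω : Type*} {mΩ : MeasurableSpace Ω} {ℱ : Filtration ℝ mΩ} {P : Measure Ω}
  {d : ℕ} {T : ℝ} {W : ℝ → Ω → EuclideanSpace ℝ (Fin d)}

namespace IsBrownianMotion

theorem stronglyMeasurable_sub (hW : IsBrownianMotion ℱ P T W) {p q r : ℝ} (hp : 0 ≤ p)
    (hpq : p ≤ q) (hqr : q ≤ r) (hq : q ≤ T) :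
    StronglyMeasurable[ℱ r] fun ω => W q ω - W p ω :=
  ((hW.adapted q ⟨hp.trans hpq, hq⟩).mono (ℱ.mono hqr)).sub
    ((hW.adapted p ⟨hp, hpq.trans hq⟩).mono (ℱ.mono (hpq.trans hqr)))

theorem measurable_sub (hW : IsBrownianMotion ℱ P T W) {p q : ℝ} (hp : 0 ≤ p)
    (hpq : p ≤ q) (hq : q ≤ T) : Measurable fun ω => W q ω - W p ω :=
  ((hW.stronglyMeasurable_sub hp hpq le_rfl hq).mono (ℱ.le q)).measurable

variable {𝕜 : Type} [RCLike 𝕜]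

theorem integrable_comp (hW : IsBrownianMotion ℱ P T W) {p q : ℝ} (hp : 0 ≤ p)
    (hpq : p ≤ q) (hq : q ≤ T) {g : EuclideanSpace ℝ (Fin d) → 𝕜}
    (hg : Integrable g (multivariateGaussian 0 ((q - p) • 1))) :
    Integrable (fun ω => g (W q ω - W p ω)) P := by
  rw [← hW.law p q hp hpq hq] at hg
  exact hg.comp_measurable (hW.measurable_sub hp hpq hq)

theorem integral_comp (hW : IsBrownianMotion ℱ P T W) {p q : ℝ} (hp : 0 ≤ p)
    (hpq : p ≤ q) (hq : q ≤ T) {g : EuclideanSpace ℝ (Fin d) → 𝕜} (hg : Measurable g) :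
    ∫ ω, g (W q ω - W p ω) ∂P = ∫ x, g x ∂(multivariateGaussian 0 ((q - p) • 1)) := by
  rw [← hW.law p q hp hpq hq,
    integral_map (hW.measurable_sub hp hpq hq).aemeasurable hg.aestronglyMeasurable]

theorem indepFun (hW : IsBrownianMotion ℱ P T W) {p q : ℝ} (hp : 0 ≤ p)
    (hpq : p ≤ q) (hq : q ≤ T) {g : EuclideanSpace ℝ (Fin d) → 𝕜} (hg : Measurable g)
    {ξ : Ω → 𝕜} (hξ : StronglyMeasurable[ℱ p] ξ) :
    IndepFun ξ (fun ω => g (W q ω - W p ω)) P := by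
  rw [IndepFun_iff_Indep]
  refine Indep.symm (indep_of_indep_of_le_left
    (indep_of_indep_of_le_right (hW.indep p q hp hpq hq) hξ.measurable.comap_le) ?_)
  rw [show (fun ω => g (W q ω - W p ω)) = g ∘ fun ω => W q ω - W p ω from rfl,
    ← MeasurableSpace.comap_comp]
  exact MeasurableSpace.comap_mono hg.comap_le

theorem integrable_mul_comp (hW : IsBrownianMotion ℱ P T W) {p q : ℝ} (hp : 0 ≤ p)
    (hpq : p ≤ q) (hq : q ≤ T) {g : EuclideanSpace ℝ (Fin d) → 𝕜} (hg : Measurable g)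
    (hgi : Integrable g (multivariateGaussian 0 ((q - p) • 1)))
    {ξ : Ω → 𝕜} (hξ : StronglyMeasurable[ℱ p] ξ) (hξi : Integrable ξ P) :
    Integrable (fun ω => ξ ω * g (W q ω - W p ω)) P :=
  (hW.indepFun hp hpq hq hg hξ).integrable_mul hξi (hW.integrable_comp hp hpq hq hgi)

theorem integral_mul_comp (hW : IsBrownianMotion ℱ P T W) {p q : ℝ} (hp : 0 ≤ p)
    (hpq : p ≤ q) (hq : q ≤ T) {g : EuclideanSpace ℝ (Fin d) → 𝕜} (hg : Measurable g)
    {ξ : Ω → 𝕜} (hξ : StronglyMeasurable[ℱ p] ξ) :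
    ∫ ω, ξ ω * g (W q ω - W p ω) ∂P
      = (∫ ω, ξ ω ∂P) * ∫ x, g x ∂(multivariateGaussian 0 ((q - p) • 1)) := by
  rw [(hW.indepFun hp hpq hq hg hξ).integral_fun_mul_eq_mul_integral
    (hξ.mono (ℱ.le p)).aestronglyMeasurable
    (hg.comp (hW.measurable_sub hp hpq hq)).aestronglyMeasurable, hW.integral_comp hp hpq hq hg]

/-- Expectations of products of functions of successive increments factorize. -/
theorem prod_comp (hW : IsBrownianMotion ℱ P T W) {τ : ℕ → ℝ} (hτ : Monotone τ)
    (hτT : ∀ k, τ k ∈ Icc 0 T) {g : ℕ → EuclideanSpace ℝ (Fin d) → 𝕜} (hg : ∀ k, Measurable (g k))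
    (hgi : ∀ k, Integrable (g k) (multivariateGaussian 0 ((τ (k + 1) - τ k) • 1)))
    {ξ : Ω → 𝕜} (hξ : StronglyMeasurable[ℱ (τ 0)] ξ) (hξi : Integrable ξ P) (n : ℕ) :
    StronglyMeasurable[ℱ (τ n)]
      (fun ω => ξ ω * ∏ k ∈ Finset.range n, g k (W (τ (k + 1)) ω - W (τ k) ω)) ∧
    Integrable (fun ω => ξ ω * ∏ k ∈ Finset.range n, g k (W (τ (k + 1)) ω - W (τ k) ω)) P ∧
    ∫ ω, ξ ω * ∏ k ∈ Finset.range n, g k (W (τ (k + 1)) ω - W (τ k) ω) ∂P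
      = (∫ ω, ξ ω ∂P) * ∏ k ∈ Finset.range n,
        ∫ x, g k x ∂(multivariateGaussian 0 ((τ (k + 1) - τ k) • 1)) := by
  induction n with
  | zero => simpa using ⟨hξ, hξi⟩
  | succ n ih =>
    obtain ⟨h1, h2, h3⟩ := ih
    simp_rw [Finset.prod_range_succ, ← mul_assoc]
    have hle : τ n ≤ τ (n + 1) := hτ n.le_succ
    have hm : StronglyMeasurable[ℱ (τ (n + 1))]
        fun ω => g n (W (τ (n + 1)) ω - W (τ n) ω) :=
      ((hg n).comp (hW.stronglyMeasurable_sub (hτT n).1 hle le_rfl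
        (hτT (n + 1)).2).measurable).stronglyMeasurable
    refine ⟨(h1.mono (ℱ.mono hle)).mul hm, ?_, ?_⟩
    · exact hW.integrable_mul_comp (hτT n).1 hle (hτT (n + 1)).2 (hg n) (hgi n) h1 h2
    · rw [hW.integral_mul_comp (hτT n).1 hle (hτT (n + 1)).2 (hg n) h1, h3]

end IsBrownianMotion

/-! ### Exponential martingales of step functions -/

namespace StepFn

/-- The exponential `exp (∫ h dW - ½ ∫ ‖h‖²)` over `(p, q]`. -/
noncomputable def dexp {E : Type} [NormedAddCommGroup E] [InnerProductSpace ℝ E] (h : StepFn E)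
    (w : ℝ → E) (p q : ℝ) : ℝ :=
  Real.exp (h.incr w p q - (∫ u in p..q, ‖h.eval u‖ ^ 2) / 2)

theorem dexp_mul_dexp {E : Type} [NormedAddCommGroup E] [InnerProductSpace ℝ E] (h : StepFn E)
    (w : ℝ → E) {p q r : ℝ} (hpq : p ≤ q) (hqr : q ≤ r) :
    h.dexp w p q * h.dexp w q r = h.dexp w p r := by
  have e : ∀ {x y : ℝ}, x ≤ y → ∫ u in x..y, ‖h.eval u‖ ^ 2 = ∑ k ∈ Finset.range h.N,
      ‖h.val k‖ ^ 2 * (clamp x y (h.time (k + 1)) - clamp x y (h.time k)) := fun hxy =>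
    h.integral_map_eval (φ := fun v => ‖v‖ ^ 2) (by simp) hxy
  have key : ∀ x, clamp p r x = clamp p q x + clamp q r x - q := by
    intro x
    unfold clamp
    grind
  have hadd : (∫ u in p..q, ‖h.eval u‖ ^ 2) + ∫ u in q..r, ‖h.eval u‖ ^ 2
      = ∫ u in p..r, ‖h.eval u‖ ^ 2 := by
    rw [e hpq, e hqr, e (hpq.trans hqr), ← Finset.sum_add_distrib]
    refine Finset.sum_congr rfl fun k _ => ?_
    rw [key, key]
    ring
  unfold dexp
  rw [← Real.exp_add, ← h.incr_add w hpq hqr, ← hadd]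
  congr 1
  ring

variable (h : StepFn (EuclideanSpace ℝ (Fin d)))

theorem incr_exp_eq (w : ℝ → EuclideanSpace ℝ (Fin d)) {p q : ℝ} (hpq : p ≤ q) (a b : ℝ) :
    Real.exp (a * h.incr w p q + b * ∫ u in p..q, ‖h.eval u‖ ^ 2)
      = ∏ k ∈ Finset.range h.N, (Real.exp (b * (‖h.val k‖ ^ 2 *
          (clamp p q (h.time (k + 1)) - clamp p q (h.time k))))
        * Real.exp ⟪a • h.val k, w (clamp p q (h.time (k + 1))) - w (clamp p q (h.time k))⟫) := by
  rw [h.integral_map_eval (φ := fun v => ‖v‖ ^ 2) (by simp) hpq, incr, Finset.mul_sum,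
    Finset.mul_sum, ← Finset.sum_add_distrib, Real.exp_sum]
  refine Finset.prod_congr rfl fun k _ => ?_
  rw [← Real.exp_add, add_comm, real_inner_smul_left]

theorem clamp_time_mono (p q : ℝ) : Monotone fun k => clamp p q (h.time k) :=
  fun _ _ hkl => clamp_mono p q (h.mono hkl)

theorem clamp_time_mem {p q : ℝ} (hp : 0 ≤ p) (hpq : p ≤ q) (hq : q ≤ T) (k : ℕ) :
    clamp p q (h.time k) ∈ Icc 0 T :=
  ⟨hp.trans (clamp_mem hpq _).1, (clamp_mem hpq _).2.trans hq⟩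

/-- The increments over the clamped partition are independent of the past and of each other, so the
expectation is a product of Gaussian moment generating functions. The choices of (a, b) used later
are (1, -1/2) for the martingale property of `dexp`, (2, -1) for its second moment and (-1, 0) for
its positivity in the limit. -/
theorem exp_incr (hW : IsBrownianMotion ℱ P T W) {p q : ℝ} (hp : 0 ≤ p) (hpq : p ≤ q)
    (hq : q ≤ T) (a b : ℝ) {ξ : Ω → ℝ} (hξ : StronglyMeasurable[ℱ p] ξ) (hξi : Integrable ξ P) :
    StronglyMeasurable[ℱ q] (fun ω => ξ ω * Real.exp (a * h.incr (fun u => W u ω) p q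
      + b * ∫ u in p..q, ‖h.eval u‖ ^ 2)) ∧
    Integrable (fun ω => ξ ω * Real.exp (a * h.incr (fun u => W u ω) p q
      + b * ∫ u in p..q, ‖h.eval u‖ ^ 2)) P ∧
    ∫ ω, ξ ω * Real.exp (a * h.incr (fun u => W u ω) p q
      + b * ∫ u in p..q, ‖h.eval u‖ ^ 2) ∂P
      = (∫ ω, ξ ω ∂P) * Real.exp ((a ^ 2 / 2 + b) * ∫ u in p..q, ‖h.eval u‖ ^ 2) := by
  have hδ : ∀ k, 0 ≤ clamp p q (h.time (k + 1)) - clamp p q (h.time k) := fun k =>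
    sub_nonneg.2 (h.clamp_time_mono p q k.le_succ)
  have hmain := hW.prod_comp (𝕜 := ℝ) (τ := fun k => clamp p q (h.time k)) (h.clamp_time_mono p q)
    (h.clamp_time_mem hp hpq hq)
    (g := fun k x => Real.exp (b * (‖h.val k‖ ^ 2 *
          (clamp p q (h.time (k + 1)) - clamp p q (h.time k)))) * Real.exp ⟪a • h.val k, x⟫)
    (fun k => by fun_prop)
    (fun k => (integrable_exp_inner_gaussian (hδ k) _).const_mul _)
    (hξ.mono (ℱ.mono (clamp_mem hpq _).1)) hξi h.N
  simp_rw [h.incr_exp_eq _ hpq a b]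
  refine ⟨hmain.1.mono (ℱ.mono (clamp_mem hpq _).2), hmain.2.1, hmain.2.2.trans ?_⟩
  congr 1
  rw [h.integral_map_eval (φ := fun v => ‖v‖ ^ 2) (by simp) hpq, Finset.mul_sum, Real.exp_sum]
  refine Finset.prod_congr rfl fun k _ => ?_
  rw [integral_const_mul, integral_exp_inner_gaussian (hδ k), ← Real.exp_add, norm_smul, mul_pow,
    Real.norm_eq_abs, sq_abs]
  congr 1
  ring

theorem dexp_eq (w : ℝ → EuclideanSpace ℝ (Fin d)) (p q : ℝ) :
    h.dexp w p q = Real.exp (1 * h.incr w p q + (-1 / 2) * ∫ u in p..q, ‖h.eval u‖ ^ 2) := by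
  unfold dexp
  congr 1
  ring

theorem integrable_mul_dexp (hW : IsBrownianMotion ℱ P T W) {p q : ℝ} (hp : 0 ≤ p) (hpq : p ≤ q)
    (hq : q ≤ T) {ξ : Ω → ℝ} (hξ : StronglyMeasurable[ℱ p] ξ) (hξi : Integrable ξ P) :
    Integrable (fun ω => ξ ω * h.dexp (fun u => W u ω) p q) P := by
  simp_rw [dexp_eq]
  exact (h.exp_incr hW hp hpq hq 1 (-1 / 2) hξ hξi).2.1

theorem integral_mul_dexp (hW : IsBrownianMotion ℱ P T W) {p q : ℝ} (hp : 0 ≤ p) (hpq : p ≤ q)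
    (hq : q ≤ T) {ξ : Ω → ℝ} (hξ : StronglyMeasurable[ℱ p] ξ) (hξi : Integrable ξ P) :
    ∫ ω, ξ ω * h.dexp (fun u => W u ω) p q ∂P = ∫ ω, ξ ω ∂P := by
  simp_rw [dexp_eq]
  rw [(h.exp_incr hW hp hpq hq 1 (-1 / 2) hξ hξi).2.2]
  norm_num

/-- The characteristic function of the Wiener integral of a step function, jointly with the past. -/
theorem integral_mul_cexp_incr (hW : IsBrownianMotion ℱ P T W) {p q : ℝ} (hp : 0 ≤ p)
    (hpq : p ≤ q) (hq : q ≤ T) {ξ : Ω → ℂ} (hξ : StronglyMeasurable[ℱ p] ξ)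
    (hξi : Integrable ξ P) :
    ∫ ω, ξ ω * Complex.exp (h.incr (fun u => W u ω) p q * Complex.I) ∂P
      = (∫ ω, ξ ω ∂P) * Complex.exp (-((∫ u in p..q, ‖h.eval u‖ ^ 2) / 2 : ℝ)) := by
  have hδ : ∀ k, 0 ≤ clamp p q (h.time (k + 1)) - clamp p q (h.time k) := fun k =>
    sub_nonneg.2 (h.clamp_time_mono p q k.le_succ)
  have hmain := hW.prod_comp (𝕜 := ℂ) (τ := fun k => clamp p q (h.time k)) (h.clamp_time_mono p q)
    (h.clamp_time_mem hp hpq hq)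
    (g := fun k x => Complex.exp (⟪h.val k, x⟫ * Complex.I))
    (fun k => by fun_prop)
    (fun k => Integrable.of_bound (by fun_prop) 1
      (Eventually.of_forall fun x => by rw [Complex.norm_exp_ofReal_mul_I]))
    (hξ.mono (ℱ.mono (clamp_mem hpq _).1)) hξi h.N
  rw [h.integral_map_eval (φ := fun v => ‖v‖ ^ 2) (by simp) hpq]
  have e : ∀ ω, Complex.exp (h.incr (fun u => W u ω) p q * Complex.I)
      = ∏ k ∈ Finset.range h.N, Complex.exp (⟪h.val k, W (clamp p q (h.time (k + 1))) ω
        - W (clamp p q (h.time k)) ω⟫ * Complex.I) := by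
    intro ω
    rw [incr, Complex.ofReal_sum, Finset.sum_mul, Complex.exp_sum]
  simp_rw [e]
  refine hmain.2.2.trans ?_
  congr 1
  rw [Finset.sum_div, Complex.ofReal_sum, ← Finset.sum_neg_distrib, Complex.exp_sum]
  refine Finset.prod_congr rfl fun k _ => ?_
  rw [integral_cexp_inner_gaussian (hδ k)]

/-- The covariance of a Brownian increment and an exponential martingale. -/
theorem mul_inner_mul_dexp (hW : IsBrownianMotion ℱ P T W) {p q : ℝ} (hp : 0 ≤ p)
    (hpq : p ≤ q) (hq : q ≤ T) (h0 : h.time 0 ≤ p) (hN : q ≤ h.time h.N)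
    (e : EuclideanSpace ℝ (Fin d)) {ξ : Ω → ℝ} (hξ : StronglyMeasurable[ℱ p] ξ)
    (hξi : Integrable ξ P) :
    Integrable (fun ω => ξ ω * ⟪e, W q ω - W p ω⟫ * h.dexp (fun u => W u ω) p q) P ∧
    ∫ ω, ξ ω * ⟪e, W q ω - W p ω⟫ * h.dexp (fun u => W u ω) p q ∂P
      = (∫ ω, ξ ω ∂P) * ∫ u in p..q, ⟪e, h.eval u⟫ := by
  set τ : ℕ → ℝ := fun k => clamp p q (h.time k) with hτ
  have hτm : Monotone τ := h.clamp_time_mono p q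
  have hτT : ∀ k, τ k ∈ Icc 0 T := h.clamp_time_mem hp hpq hq
  -- The assumptions on the end points of the partition enter only here: the clamped partition has
  -- to exhaust [p, q].
  have hτ0 : τ 0 = p := clamp_of_le h0
  have hτN : τ h.N = q := clamp_of_ge hpq hN
  have hδ : ∀ k, 0 ≤ τ (k + 1) - τ k := fun k => sub_nonneg.2 (hτm k.le_succ)
  let g : ℕ → EuclideanSpace ℝ (Fin d) → ℝ := fun k x =>
    Real.exp ((-1 / 2) * (‖h.val k‖ ^ 2 * (τ (k + 1) - τ k))) * Real.exp ⟪(1 : ℝ) • h.val k, x⟫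
  have hgm : ∀ k, Measurable (g k) := fun k => by fun_prop
  have hgi : ∀ k, Integrable (g k) (multivariateGaussian 0 ((τ (k + 1) - τ k) • 1)) :=
    fun k => (integrable_exp_inner_gaussian (hδ k) _).const_mul _
  have hg1 : ∀ k, ∫ x, g k x ∂(multivariateGaussian 0 ((τ (k + 1) - τ k) • 1)) = 1 := by
    intro k
    rw [integral_const_mul, integral_exp_inner_gaussian (hδ k), ← Real.exp_add, one_smul,
      Real.exp_eq_one_iff]
    ring
  have hegm : ∀ k, Measurable fun x => ⟪e, x⟫ * g k x := fun k => by fun_prop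
  have hegi : ∀ k, Integrable (fun x => ⟪e, x⟫ * g k x)
      (multivariateGaussian 0 ((τ (k + 1) - τ k) • 1)) := by
    intro k
    refine ((integrable_inner_mul_exp_inner_gaussian (hδ k) e ((1 : ℝ) • h.val k)).const_mul
      (Real.exp ((-1 / 2) * (‖h.val k‖ ^ 2 * (τ (k + 1) - τ k))))).congr
      (Eventually.of_forall fun x => ?_)
    simp only [g]
    ring
  have heg1 : ∀ k, ∫ x, ⟪e, x⟫ * g k x ∂(multivariateGaussian 0 ((τ (k + 1) - τ k) • 1))
      = ⟪e, h.val k⟫ * (τ (k + 1) - τ k) := by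
    intro k
    have e1 : ∀ x, ⟪e, x⟫ * g k x = Real.exp ((-1 / 2) * (‖h.val k‖ ^ 2 * (τ (k + 1) - τ k)))
        * (⟪e, x⟫ * Real.exp ⟪(1 : ℝ) • h.val k, x⟫) := fun x => by simp only [g]; ring
    simp_rw [e1]
    rw [integral_const_mul, integral_inner_mul_exp_inner_gaussian (hδ k), one_smul,
      mul_left_comm, ← Real.exp_add]
    rw [show (-1 / 2) * (‖h.val k‖ ^ 2 * (τ (k + 1) - τ k))
      + ‖h.val k‖ ^ 2 * (τ (k + 1) - τ k) / 2 = 0 by ring, Real.exp_zero, mul_one]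
  have hξ0 : StronglyMeasurable[ℱ (τ 0)] ξ := by rwa [hτ0]
  -- In each step ⟨e, W - W_p⟩ splits into its value at τ n and a new increment. The old part meets
  -- a new factor of mean 1; the new part has tilted mean ⟨e, h_n⟩ times the length of the interval.
  have hind : ∀ n : ℕ,
      StronglyMeasurable[ℱ (τ n)] (fun ω => ξ ω * ⟪e, W (τ n) ω - W p ω⟫
        * ∏ k ∈ Finset.range n, g k (W (τ (k + 1)) ω - W (τ k) ω)) ∧
      Integrable (fun ω => ξ ω * ⟪e, W (τ n) ω - W p ω⟫
        * ∏ k ∈ Finset.range n, g k (W (τ (k + 1)) ω - W (τ k) ω)) P ∧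
      ∫ ω, ξ ω * ⟪e, W (τ n) ω - W p ω⟫
        * ∏ k ∈ Finset.range n, g k (W (τ (k + 1)) ω - W (τ k) ω) ∂P
        = (∫ ω, ξ ω ∂P) * ∑ k ∈ Finset.range n, ⟪e, h.val k⟫ * (τ (k + 1) - τ k) := by
    intro n
    induction n with
    | zero =>
      simp only [hτ0, sub_self, inner_zero_right, mul_zero, zero_mul, Finset.range_zero,
        Finset.sum_empty, integral_zero, and_true]
      exact ⟨stronglyMeasurable_const, integrable_zero _ _ _⟩
    | succ n ih =>
      obtain ⟨i1, i2, i3⟩ := ih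
      obtain ⟨j1, j2, j3⟩ := hW.prod_comp (𝕜 := ℝ) hτm hτT hgm hgi hξ0 hξi n
      have hle : τ n ≤ τ (n + 1) := hτm n.le_succ
      have hsplit : ∀ ω, ξ ω * ⟪e, W (τ (n + 1)) ω - W p ω⟫
          * ∏ k ∈ Finset.range (n + 1), g k (W (τ (k + 1)) ω - W (τ k) ω)
          = (ξ ω * ⟪e, W (τ n) ω - W p ω⟫
            * ∏ k ∈ Finset.range n, g k (W (τ (k + 1)) ω - W (τ k) ω))
              * g n (W (τ (n + 1)) ω - W (τ n) ω)
            + (ξ ω * ∏ k ∈ Finset.range n, g k (W (τ (k + 1)) ω - W (τ k) ω))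
              * (⟪e, W (τ (n + 1)) ω - W (τ n) ω⟫ * g n (W (τ (n + 1)) ω - W (τ n) ω)) := by
        intro ω
        rw [Finset.prod_range_succ, ← sub_add_sub_cancel (W (τ (n + 1)) ω) (W (τ n) ω) (W p ω),
          inner_add_right]
        ring
      have ia := hW.integrable_mul_comp (𝕜 := ℝ) (hτT n).1 hle (hτT (n + 1)).2 (hgm n) (hgi n) i1 i2
      have ib := hW.integrable_mul_comp (𝕜 := ℝ) (hτT n).1 hle (hτT (n + 1)).2 (hegm n) (hegi n)
        j1 j2
      refine ⟨?_, ?_, ?_⟩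
      · have hm : StronglyMeasurable[ℱ (τ (n + 1))] fun ω => ⟪e, W (τ (n + 1)) ω - W p ω⟫ := by
          have hpτ : p ≤ τ (n + 1) := (clamp_mem hpq _).1
          have := (hW.stronglyMeasurable_sub hp hpτ le_rfl (hτT (n + 1)).2)
          exact (innerSL ℝ e).continuous.comp_stronglyMeasurable this
        have h2 := (hW.prod_comp (𝕜 := ℝ) hτm hτT hgm hgi hξ0 hξi (n + 1)).1
        convert! hm.mul h2 using 1
        ext ω
        simp only [Pi.mul_apply]
        ring
      · simp_rw [hsplit]
        exact ia.add ib
      · simp_rw [hsplit]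
        rw [integral_add ia ib,
          hW.integral_mul_comp (𝕜 := ℝ) (hτT n).1 hle (hτT (n + 1)).2 (hgm n) i1,
          hW.integral_mul_comp (𝕜 := ℝ) (hτT n).1 hle (hτT (n + 1)).2 (hegm n) j1,
          i3, j3, hg1, heg1, Finset.sum_range_succ, Finset.prod_congr rfl (fun k _ => hg1 k)]
        simp only [Finset.prod_const_one]
        ring
  obtain ⟨-, i2, i3⟩ := hind h.N
  have hfin : ∀ ω, h.dexp (fun u => W u ω) p q
      = ∏ k ∈ Finset.range h.N, g k (W (τ (k + 1)) ω - W (τ k) ω) := by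
    intro ω
    rw [dexp_eq, h.incr_exp_eq _ hpq]
  simp_rw [hfin]
  rw [hτN] at i2 i3
  refine ⟨i2, i3.trans ?_⟩
  rw [h.integral_map_eval (φ := fun v => ⟪e, v⟫) (by simp) hpq]

variable [IsProbabilityMeasure P]

theorem stronglyMeasurable_dexp (hW : IsBrownianMotion ℱ P T W) {p q : ℝ} (hp : 0 ≤ p)
    (hpq : p ≤ q) (hq : q ≤ T) :
    StronglyMeasurable[ℱ q] fun ω => h.dexp (fun u => W u ω) p q := by
  simp_rw [dexp_eq]
  simpa using (h.exp_incr hW hp hpq hq 1 (-1 / 2) (ξ := fun _ => (1 : ℝ))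
    stronglyMeasurable_const (integrable_const _)).1

theorem stronglyMeasurable_incr (hW : IsBrownianMotion ℱ P T W) {p q : ℝ} (hp : 0 ≤ p)
    (hpq : p ≤ q) (hq : q ≤ T) :
    StronglyMeasurable[ℱ q] fun ω => h.incr (fun u => W u ω) p q := by
  have := (h.stronglyMeasurable_dexp hW hp hpq hq).measurable.log
  have e : ∀ ω, h.incr (fun u => W u ω) p q = Real.log (h.dexp (fun u => W u ω) p q)
      + (∫ u in p..q, ‖h.eval u‖ ^ 2) / 2 := fun ω => by
    rw [dexp, Real.log_exp]; ring
  simp_rw [e]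
  exact (this.add_const _).stronglyMeasurable

theorem dexp_sq (hW : IsBrownianMotion ℱ P T W) {p q : ℝ} (hp : 0 ≤ p) (hpq : p ≤ q)
    (hq : q ≤ T) :
    MemLp (fun ω => h.dexp (fun u => W u ω) p q) 2 P ∧
    ∫ ω, h.dexp (fun u => W u ω) p q ^ 2 ∂P = Real.exp (∫ u in p..q, ‖h.eval u‖ ^ 2) := by
  have hm := (h.exp_incr hW hp hpq hq 2 (-1) (ξ := fun _ => (1 : ℝ))
    stronglyMeasurable_const (integrable_const _)).2
  have e : ∀ ω, 1 * Real.exp (2 * h.incr (fun u => W u ω) p q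
      + -1 * ∫ u in p..q, ‖h.eval u‖ ^ 2) = h.dexp (fun u => W u ω) p q ^ 2 := by
    intro ω
    rw [dexp, one_mul, ← Real.exp_nat_mul]
    congr 1
    push_cast
    ring
  simp_rw [e] at hm
  refine ⟨?_, hm.2.trans ?_⟩
  · rw [memLp_two_iff_integrable_sq
      ((h.stronglyMeasurable_dexp hW hp hpq hq).mono (ℱ.le q)).aestronglyMeasurable]
    exact hm.1
  · norm_num

end StepFn

end Brownian

/-! ### Elementary stochastic integrals -/

section Simple

variable {Ω : Type*} {mΩ : MeasurableSpace Ω} {ℱ : Filtration ℝ mΩ} {P : Measure Ω}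
  {d : ℕ} {T : ℝ} {W : ℝ → Ω → EuclideanSpace ℝ (Fin d)}

theorem inner_eq_sum (a b : EuclideanSpace ℝ (Fin d)) : ⟪a, b⟫ = ∑ i, a i * b i := by
  simp [PiLp.inner_apply, mul_comm]

theorem measurable_eval_apply (i : Fin d) :
    Measurable fun x : EuclideanSpace ℝ (Fin d) => x i := by fun_prop

theorem stronglyMeasurable_eval_apply {m : MeasurableSpace Ω}
    {v : Ω → EuclideanSpace ℝ (Fin d)} (hv : StronglyMeasurable[m] v) (i : Fin d) :
    StronglyMeasurable[m] fun ω => v ω i :=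
  (EuclideanSpace.proj (𝕜 := ℝ) i).continuous.comp_stronglyMeasurable hv

namespace IsBrownianMotion

theorem memLp_norm_sub (hW : IsBrownianMotion ℱ P T W) {p q : ℝ} (hp : 0 ≤ p)
    (hpq : p ≤ q) (hq : q ≤ T) : MemLp (fun ω => W q ω - W p ω) 2 P := by
  have h := IsGaussian.memLp_two_id
    (μ := multivariateGaussian (0 : EuclideanSpace ℝ (Fin d)) ((q - p) • 1))
  rw [← hW.law p q hp hpq hq] at h
  exact h.comp_of_map (hW.measurable_sub hp hpq hq).aemeasurable

theorem memLp_inner (hW : IsBrownianMotion ℱ P T W) {p q : ℝ} (hp : 0 ≤ p)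
    (hpq : p ≤ q) (hq : q ≤ T) {v : Ω → EuclideanSpace ℝ (Fin d)}
    (hv : StronglyMeasurable[ℱ p] v) {C : ℝ} (hC : ∀ ω, ‖v ω‖ ≤ C) :
    MemLp (fun ω => ⟪v ω, W q ω - W p ω⟫) 2 P := by
  refine (hW.memLp_norm_sub hp hpq hq).of_le_mul (c := C) ?_ (Eventually.of_forall fun ω => ?_)
  · exact ((hv.mono (ℱ.le p)).inner
      ((hW.stronglyMeasurable_sub hp hpq le_rfl hq).mono (ℱ.le q))).aestronglyMeasurable
  · exact (norm_inner_le_norm _ _).trans (mul_le_mul_of_nonneg_right (hC ω) (norm_nonneg _))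

theorem integral_apply_gaussian {δ : ℝ} (i : Fin d) :
    ∫ x, x i ∂(multivariateGaussian (0 : EuclideanSpace ℝ (Fin d)) (δ • 1)) = 0 := by
  have := integral_inner_gaussian (δ := δ) (EuclideanSpace.single i (1 : ℝ))
  simpa [EuclideanSpace.inner_single_left] using this

theorem integral_apply_mul_apply_gaussian {δ : ℝ} (hδ : 0 ≤ δ) (i j : Fin d) :
    ∫ x, x i * x j ∂(multivariateGaussian (0 : EuclideanSpace ℝ (Fin d)) (δ • 1))
      = if i = j then δ else 0 := by
  have := integral_inner_mul_inner_gaussian hδ (EuclideanSpace.single i (1 : ℝ))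
    (EuclideanSpace.single j (1 : ℝ))
  simpa [EuclideanSpace.inner_single_left, Pi.single_apply] using this

theorem integrable_apply_gaussian {δ : ℝ} (i : Fin d) :
    Integrable (fun x => x i) (multivariateGaussian (0 : EuclideanSpace ℝ (Fin d)) (δ • 1)) := by
  have := (memLp_inner_gaussian (δ := δ) (EuclideanSpace.single i (1 : ℝ)) 1 (by simp))
  rw [memLp_one_iff_integrable] at this
  simpa [EuclideanSpace.inner_single_left] using this

theorem integrable_apply_mul_apply_gaussian {δ : ℝ} (i j : Fin d) :
    Integrable (fun x => x i * x j)
      (multivariateGaussian (0 : EuclideanSpace ℝ (Fin d)) (δ • 1)) := by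
  have := (memLp_inner_gaussian (δ := δ) (EuclideanSpace.single i (1 : ℝ)) 2 (by simp)).integrable_mul
    (memLp_inner_gaussian (δ := δ) (EuclideanSpace.single j (1 : ℝ)) 2 (by simp))
  refine this.congr (Eventually.of_forall fun x => ?_)
  simp [EuclideanSpace.inner_single_left]

theorem integral_mul_inner (hW : IsBrownianMotion ℱ P T W) {p q : ℝ} (hp : 0 ≤ p)
    (hpq : p ≤ q) (hq : q ≤ T) {v : Ω → EuclideanSpace ℝ (Fin d)}
    (hv : StronglyMeasurable[ℱ p] v) {C : ℝ} (hC : ∀ ω, ‖v ω‖ ≤ C)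
    {ξ : Ω → ℝ} (hξ : StronglyMeasurable[ℱ p] ξ) (hξi : Integrable ξ P) :
    ∫ ω, ξ ω * ⟪v ω, W q ω - W p ω⟫ ∂P = 0 := by
  have e : ∀ ω, ξ ω * ⟪v ω, W q ω - W p ω⟫
      = ∑ i, (ξ ω * v ω i) * (W q ω - W p ω) i := by
    intro ω
    rw [inner_eq_sum, Finset.mul_sum]
    exact Finset.sum_congr rfl fun i _ => by ring
  have hm : ∀ i, StronglyMeasurable[ℱ p] fun ω => ξ ω * v ω i := fun i =>
    hξ.mul (stronglyMeasurable_eval_apply hv i)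
  have hi : ∀ i, Integrable (fun ω => ξ ω * v ω i) P := fun i =>
    hξi.mul_bdd (c := C) ((stronglyMeasurable_eval_apply hv i).mono (ℱ.le p)).aestronglyMeasurable
      (Eventually.of_forall fun ω => (PiLp.norm_apply_le (v ω) i).trans (hC ω))
  simp_rw [e]
  rw [integral_finsetSum _ fun i _ => hW.integrable_mul_comp (𝕜 := ℝ) hp hpq hq
    (measurable_eval_apply i) (integrable_apply_gaussian i) (hm i) (hi i)]
  refine Finset.sum_eq_zero fun i _ => ?_
  rw [hW.integral_mul_comp (𝕜 := ℝ) hp hpq hq (measurable_eval_apply i) (hm i),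
    integral_apply_gaussian, mul_zero]

/-- The Itô isometry for a single step. Independence separates the products of coordinates of `v`
from those of the increment, whose covariance is q - p times the identity. -/
theorem integral_inner_sq [IsProbabilityMeasure P] (hW : IsBrownianMotion ℱ P T W) {p q : ℝ} (hp : 0 ≤ p)
    (hpq : p ≤ q) (hq : q ≤ T) {v : Ω → EuclideanSpace ℝ (Fin d)}
    (hv : StronglyMeasurable[ℱ p] v) {C : ℝ} (hC : ∀ ω, ‖v ω‖ ≤ C) :
    ∫ ω, ⟪v ω, W q ω - W p ω⟫ ^ 2 ∂P = ∫ ω, ‖v ω‖ ^ 2 * (q - p) ∂P := by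
  have hC0 : 0 ≤ C := by
    obtain ⟨ω⟩ := nonempty_of_isProbabilityMeasure P
    exact (norm_nonneg _).trans (hC ω)
  have e : ∀ ω, ⟪v ω, W q ω - W p ω⟫ ^ 2
      = ∑ i, ∑ j, (v ω i * v ω j) * ((W q ω - W p ω) i * (W q ω - W p ω) j) := by
    intro ω
    rw [inner_eq_sum, sq, Finset.sum_mul_sum]
    exact Finset.sum_congr rfl fun i _ => Finset.sum_congr rfl fun j _ => by ring
  have hm : ∀ i j, StronglyMeasurable[ℱ p] fun ω => v ω i * v ω j := fun i j =>
    (stronglyMeasurable_eval_apply hv i).mul (stronglyMeasurable_eval_apply hv j)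
  have hi : ∀ i j, Integrable (fun ω => v ω i * v ω j) P := fun i j =>
    Integrable.of_bound ((hm i j).mono (ℱ.le p)).aestronglyMeasurable (C * C)
      (Eventually.of_forall fun ω => by
        rw [norm_mul]
        exact mul_le_mul ((PiLp.norm_apply_le (v ω) i).trans (hC ω))
          ((PiLp.norm_apply_le (v ω) j).trans (hC ω)) (norm_nonneg _) hC0)
  have hgm : ∀ i j : Fin d, Measurable fun x : EuclideanSpace ℝ (Fin d) => x i * x j :=
    fun i j => by fun_prop
  have hint : ∀ i j, Integrable
      (fun ω => (v ω i * v ω j) * ((W q ω - W p ω) i * (W q ω - W p ω) j)) P := fun i j =>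
    hW.integrable_mul_comp (𝕜 := ℝ) hp hpq hq (hgm i j) (integrable_apply_mul_apply_gaussian i j)
      (hm i j) (hi i j)
  simp_rw [e]
  rw [integral_finsetSum _ fun i _ => integrable_finsetSum _ fun j _ => hint i j]
  have h2 : ∀ i, ∫ ω, ∑ j, (v ω i * v ω j) * ((W q ω - W p ω) i * (W q ω - W p ω) j) ∂P
      = ∫ ω, v ω i * v ω i * (q - p) ∂P := by
    intro i
    rw [integral_finsetSum _ fun j _ => hint i j]
    simp_rw [fun j => hW.integral_mul_comp (𝕜 := ℝ) hp hpq hq (hgm i j) (hm i j),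
      integral_apply_mul_apply_gaussian (sub_nonneg.2 hpq), mul_ite, mul_zero]
    rw [Finset.sum_ite_eq, if_pos (Finset.mem_univ i), integral_mul_const]
  simp_rw [h2]
  rw [← integral_finsetSum _ fun i _ => (hi i i).mul_const _]
  refine integral_congr_ae (Eventually.of_forall fun ω => ?_)
  beta_reduce
  rw [EuclideanSpace.real_norm_sq_eq, Finset.sum_mul]
  simp only [sq]

end IsBrownianMotion

namespace SimpleProcess

variable {a b : ℝ}

/-- The path of a simple process. -/
def path (S : SimpleProcess ℱ a b d) (ω : Ω) : StepFn (EuclideanSpace ℝ (Fin d)) where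
  N := S.N
  time := S.time
  mono := S.time_mono
  val k := S.val k ω

/-- The elementary integral over the whole interval. -/
noncomputable def total (S : SimpleProcess ℱ a b d) (W : ℝ → Ω → EuclideanSpace ℝ (Fin d))
    (ω : Ω) : ℝ :=
  ∑ k ∈ Finset.range S.N, ⟪S.val k ω, W (S.time (k + 1)) ω - W (S.time k) ω⟫

/-- The energy of a simple process up to a time of the partition. -/
noncomputable def energy (S : SimpleProcess ℱ a b d) (n : ℕ) (ω : Ω) : ℝ :=
  ∑ k ∈ Finset.range n, ‖S.val k ω‖ ^ 2 * (S.time (k + 1) - S.time k)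

theorem le_of_simple (S : SimpleProcess ℱ a b d) : a ≤ b :=
  S.time_zero.symm.trans_le ((S.time_mono (Nat.zero_le _)).trans_eq S.time_last)

theorem time_mem (S : SimpleProcess ℱ a b d) {k : ℕ} (hk : k ≤ S.N) : S.time k ∈ Icc a b :=
  ⟨S.time_zero.symm.trans_le (S.time_mono (Nat.zero_le _)),
    (S.time_mono hk).trans_eq S.time_last⟩

theorem eval_path (S : SimpleProcess ℱ a b d) (u : ℝ) (ω : Ω) : S.eval u ω = (S.path ω).eval u :=
  rfl

theorem setIntegral_map_eval (S : SimpleProcess ℱ a b d) {φ : EuclideanSpace ℝ (Fin d) → ℝ}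
    (hφ : φ 0 = 0) (ω : Ω) : ∫ u in Icc a b, φ (S.eval u ω)
      = ∑ k ∈ Finset.range S.N, φ (S.val k ω) * (S.time (k + 1) - S.time k) := by
  simp_rw [eval_path]
  rw [integral_Icc_eq_integral_Ioc, (S.path ω).setIntegral_map_eval hφ S.le_of_simple]
  refine Finset.sum_congr rfl fun k hk => ?_
  have hk' : k < S.N := Finset.mem_range.1 hk
  simp only [path]
  rw [clamp_of_mem (S.time_mem hk'), clamp_of_mem (S.time_mem hk'.le)]

theorem measurable_eval (S : SimpleProcess ℱ a b d) :
    Measurable fun z : ℝ × Ω => S.eval z.1 z.2 := by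
  unfold eval
  refine Finset.measurable_sum _ fun k hk => ?_
  have h1 : Measurable fun z : ℝ × Ω => S.val k z.2 :=
    ((S.measurable_val k (Finset.mem_range.1 hk)).mono (ℱ.le _)).measurable.comp measurable_snd
  have h2 : MeasurableSet {z : ℝ × Ω | z.1 ∈ Ioc (S.time k) (S.time (k + 1))} :=
    measurable_fst measurableSet_Ioc
  exact h1.indicator h2

theorem exists_bound_eval (S : SimpleProcess ℱ a b d) : ∃ C : ℝ, ∀ u ω, ‖S.eval u ω‖ ≤ C := by
  obtain ⟨C, hC⟩ := S.bounded_val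
  refine ⟨∑ k ∈ Finset.range S.N, C, fun u ω => (norm_sum_le _ _).trans
    (Finset.sum_le_sum fun k hk => (norm_indicator_le_norm_self _ _).trans
      (hC k (Finset.mem_range.1 hk) ω))⟩

theorem energy_eq (S : SimpleProcess ℱ a b d) (ω : Ω) :
    S.energy S.N ω = ∫ u in Icc a b, ‖S.eval u ω‖ ^ 2 := by
  rw [S.setIntegral_map_eval (φ := fun v => ‖v‖ ^ 2) (by simp), energy]

theorem ofReal_energy (S : SimpleProcess ℱ a b d) (ω : Ω) :
    ENNReal.ofReal (S.energy S.N ω) = ∫⁻ u in Icc a b, ‖S.eval u ω‖ₑ ^ 2 := by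
  obtain ⟨C, hC⟩ := S.exists_bound_eval
  have hm : Measurable fun u => S.eval u ω :=
    S.measurable_eval.comp (measurable_id.prodMk measurable_const)
  rw [energy_eq, ofReal_integral_eq_lintegral_ofReal]
  · refine lintegral_congr fun u => ?_
    rw [ENNReal.ofReal_pow (norm_nonneg _), ofReal_norm]
  · refine Integrable.of_bound (hm.norm.pow_const 2).aestronglyMeasurable (C ^ 2)
      (Eventually.of_forall fun u => ?_)
    rw [norm_pow, norm_norm]
    exact pow_le_pow_left₀ (norm_nonneg _) (hC u ω) 2
  · exact Eventually.of_forall fun u => sq_nonneg _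

theorem energy_nonneg (S : SimpleProcess ℱ a b d) (n : ℕ) (ω : Ω) : 0 ≤ S.energy n ω :=
  Finset.sum_nonneg fun k _ => mul_nonneg (sq_nonneg _) (sub_nonneg.2 (S.time_mono k.le_succ))

theorem measurable_energy (S : SimpleProcess ℱ a b d) {n : ℕ} (hn : n < S.N) :
    StronglyMeasurable[ℱ (S.time n)] (S.energy (n + 1)) := by
  unfold energy
  refine Finset.stronglyMeasurable_fun_sum _ fun k hk => ?_
  have hk' : k ≤ n := by have := Finset.mem_range.1 hk; omega
  have := (S.measurable_val k (by omega)).mono (ℱ.mono (S.time_mono hk'))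
  exact (this.norm.pow 2).mul_const _

variable [IsProbabilityMeasure P]

/-- The four facts are proved in one induction because they feed each other: the cross term in the
square of the sum vanishes since the partial sum is adapted and integrable. The last fact says that
the integral is orthogonal to everything known at time a. -/
theorem total_partial (S : SimpleProcess ℱ a b d) (hW : IsBrownianMotion ℱ P T W) (ha : 0 ≤ a)
    (hb : b ≤ T) (n : ℕ) (hn : n ≤ S.N) :
    StronglyMeasurable[ℱ (S.time n)] (fun ω => ∑ k ∈ Finset.range n,
      ⟪S.val k ω, W (S.time (k + 1)) ω - W (S.time k) ω⟫) ∧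
    MemLp (fun ω => ∑ k ∈ Finset.range n,
      ⟪S.val k ω, W (S.time (k + 1)) ω - W (S.time k) ω⟫) 2 P ∧
    ∫ ω, (∑ k ∈ Finset.range n,
      ⟪S.val k ω, W (S.time (k + 1)) ω - W (S.time k) ω⟫) ^ 2 ∂P = ∫ ω, S.energy n ω ∂P ∧
    ∀ ξ : Ω → ℝ, StronglyMeasurable[ℱ a] ξ → MemLp ξ 2 P → ∫ ω, ξ ω * ∑ k ∈ Finset.range n,
      ⟪S.val k ω, W (S.time (k + 1)) ω - W (S.time k) ω⟫ ∂P = 0 := by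
  obtain ⟨C, hC⟩ := S.bounded_val
  induction n with
  | zero =>
    simp only [Finset.range_zero, Finset.sum_empty, energy]
    exact ⟨stronglyMeasurable_const, MemLp.zero', by simp, by simp⟩
  | succ n ih =>
    obtain ⟨h1, h2, h3, h4⟩ := ih (by omega)
    have hnN : n < S.N := hn
    have ht0 : 0 ≤ S.time n := ha.trans (S.time_mem hnN.le).1
    have htT : S.time (n + 1) ≤ T := (S.time_mem hn).2.trans hb
    have hle : S.time n ≤ S.time (n + 1) := S.time_mono n.le_succ
    have hv := S.measurable_val n hnN
    have hvC := hC n hnN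
    have hi2 := hW.memLp_inner ht0 hle htT hv hvC
    have hmeas : StronglyMeasurable[ℱ (S.time (n + 1))]
        fun ω => ⟪S.val n ω, W (S.time (n + 1)) ω - W (S.time n) ω⟫ :=
      StronglyMeasurable.inner (hv.mono (ℱ.mono hle))
        (hW.stronglyMeasurable_sub ht0 hle le_rfl htT)
    simp_rw [Finset.sum_range_succ]
    have hen : ∀ k ∈ Finset.range (n + 1), Integrable
        (fun ω => ‖S.val k ω‖ ^ 2 * (S.time (k + 1) - S.time k)) P := by
      intro k hk
      have hkN : k < S.N := by have := Finset.mem_range.1 hk; omega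
      refine Integrable.mul_const (Integrable.of_bound
        (((S.measurable_val k hkN).mono (ℱ.le _)).norm.pow 2).aestronglyMeasurable (C ^ 2)
        (Eventually.of_forall fun ω => ?_)) _
      rw [Pi.pow_apply, norm_pow, norm_norm]
      exact pow_le_pow_left₀ (norm_nonneg _) (hC k hkN ω) 2
    refine ⟨(h1.mono (ℱ.mono hle)).add hmeas, h2.add hi2, ?_, ?_⟩
    · have e : ∀ ω, (∑ k ∈ Finset.range n, ⟪S.val k ω, W (S.time (k + 1)) ω - W (S.time k) ω⟫
          + ⟪S.val n ω, W (S.time (n + 1)) ω - W (S.time n) ω⟫) ^ 2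
          = (∑ k ∈ Finset.range n, ⟪S.val k ω, W (S.time (k + 1)) ω - W (S.time k) ω⟫) ^ 2
            + 2 * ((∑ k ∈ Finset.range n, ⟪S.val k ω, W (S.time (k + 1)) ω - W (S.time k) ω⟫)
              * ⟪S.val n ω, W (S.time (n + 1)) ω - W (S.time n) ω⟫)
            + ⟪S.val n ω, W (S.time (n + 1)) ω - W (S.time n) ω⟫ ^ 2 := fun ω => by ring
      have i12 : Integrable (fun ω =>
          2 * ((∑ k ∈ Finset.range n, ⟪S.val k ω, W (S.time (k + 1)) ω - W (S.time k) ω⟫)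
            * ⟪S.val n ω, W (S.time (n + 1)) ω - W (S.time n) ω⟫)) P :=
        (h2.integrable_mul hi2).const_mul 2
      simp_rw [e]
      rw [integral_add (by exact h2.integrable_sq.add i12) hi2.integrable_sq,
        integral_add h2.integrable_sq i12, h3,
        integral_const_mul, hW.integral_mul_inner ht0 hle htT hv hvC h1
          (h2.integrable (by norm_num)), hW.integral_inner_sq ht0 hle htT hv hvC]
      simp only [energy]
      rw [integral_finsetSum _ hen, integral_finsetSum _ fun k hk => hen k (by
        have := Finset.mem_range.1 hk
        exact Finset.mem_range.2 (by omega)), Finset.sum_range_succ]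
      ring
    · intro ξ hξ hξ2
      simp_rw [mul_add]
      rw [integral_add (by exact hξ2.integrable_mul h2) (by exact hξ2.integrable_mul hi2), h4 ξ hξ hξ2, zero_add]
      exact hW.integral_mul_inner ht0 hle htT hv hvC
        (hξ.mono (ℱ.mono (S.time_mem hnN.le).1)) (hξ2.integrable (by norm_num))

theorem memLp_total (S : SimpleProcess ℱ a b d) (hW : IsBrownianMotion ℱ P T W)
    (ha : 0 ≤ a) (hb : b ≤ T) : MemLp (S.total W) 2 P :=
  (S.total_partial hW ha hb S.N le_rfl).2.1

theorem integral_total_sq (S : SimpleProcess ℱ a b d) (hW : IsBrownianMotion ℱ P T W)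
    (ha : 0 ≤ a) (hb : b ≤ T) : ∫ ω, S.total W ω ^ 2 ∂P = ∫ ω, S.energy S.N ω ∂P :=
  (S.total_partial hW ha hb S.N le_rfl).2.2.1

theorem integral_mul_total (S : SimpleProcess ℱ a b d) (hW : IsBrownianMotion ℱ P T W)
    (ha : 0 ≤ a) (hb : b ≤ T) {ξ : Ω → ℝ} (hξ : StronglyMeasurable[ℱ a] ξ) (hξ2 : MemLp ξ 2 P) :
    ∫ ω, ξ ω * S.total W ω ∂P = 0 :=
  (S.total_partial hW ha hb S.N le_rfl).2.2.2 ξ hξ hξ2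

theorem lintegral_total_sq (S : SimpleProcess ℱ a b d) (hW : IsBrownianMotion ℱ P T W)
    (ha : 0 ≤ a) (hb : b ≤ T) :
    ∫⁻ ω, ‖S.total W ω‖ₑ ^ 2 ∂P = ∫⁻ ω, (∫⁻ u in Icc a b, ‖S.eval u ω‖ₑ ^ 2) ∂P := by
  have h1 := (S.memLp_total hW ha hb).integrable_sq
  have hen : Integrable (fun ω => S.energy S.N ω) P := by
    obtain ⟨C, hC⟩ := S.bounded_val
    unfold energy
    refine integrable_finsetSum _ fun k hk => Integrable.mul_const (Integrable.of_bound
        (((S.measurable_val k (Finset.mem_range.1 hk)).mono (ℱ.le _)).norm.pow 2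
          ).aestronglyMeasurable (C ^ 2) (Eventually.of_forall fun ω => ?_)) _
    rw [Pi.pow_apply, norm_pow, norm_norm]
    exact pow_le_pow_left₀ (norm_nonneg _) (hC k (Finset.mem_range.1 hk) ω) 2
  simp_rw [← ofReal_energy]
  rw [← ofReal_integral_eq_lintegral_ofReal hen
    (Eventually.of_forall fun ω => S.energy_nonneg _ ω), ← S.integral_total_sq hW ha hb,
    ofReal_integral_eq_lintegral_ofReal h1 (Eventually.of_forall fun ω => sq_nonneg _)]
  refine lintegral_congr fun ω => ?_
  rw [← ofReal_norm, ← ENNReal.ofReal_pow (norm_nonneg _), Real.norm_eq_abs, sq_abs]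

end SimpleProcess

end Simple

/-! ### Operations on simple processes -/

section SimpleOps

variable {Ω : Type*} {mΩ : MeasurableSpace Ω} {ℱ : Filtration ℝ mΩ} {d : ℕ}
  {W : ℝ → Ω → EuclideanSpace ℝ (Fin d)} {a b : ℝ}

theorem mem_Ioc_clamp_iff {x y s t u : ℝ} (hst : s ≤ t) (hxy : x ≤ y) :
    u ∈ Ioc (clamp s t x) (clamp s t y) ↔ u ∈ Ioc s t ∧ u ∈ Ioc x y := by
  unfold clamp
  simp only [mem_Ioc]
  grind

namespace StepFn

variable {E : Type} [NormedAddCommGroup E]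

theorem eval_of_mem (h : StepFn E) {k : ℕ} (hk : k < h.N) {u : ℝ}
    (hu : u ∈ Ioc (h.time k) (h.time (k + 1))) : h.eval u = h.val k := by
  rw [eval, Finset.sum_eq_single_of_mem k (Finset.mem_range.2 hk), indicator_of_mem hu]
  intro l _ hlk
  refine indicator_of_notMem (fun hl => ?_) _
  exact Set.disjoint_left.1 (h.mono.pairwise_disjoint_on_Ioc_succ hlk) hl hu

theorem exists_mem_Ioc {F : Type} (h : StepFn F) {u : ℝ} (hu : u ∈ Ioc (h.time 0) (h.time h.N)) :
    ∃ k < h.N, u ∈ Ioc (h.time k) (h.time (k + 1)) := by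
  have key : ∀ n : ℕ, u ∈ Ioc (h.time 0) (h.time n) →
      ∃ k < n, u ∈ Ioc (h.time k) (h.time (k + 1)) := by
    intro n
    induction n with
    | zero => intro hu; exact absurd (hu.1.trans_le hu.2) (lt_irrefl _)
    | succ n ih =>
      intro hu
      by_cases hn : u ≤ h.time n
      · obtain ⟨k, hk, hk'⟩ := ih ⟨hu.1, hn⟩
        exact ⟨k, by omega, hk'⟩
      · exact ⟨n, by omega, not_le.1 hn, hu.2⟩
  exact key h.N hu

/-- Telescoping along a partition. -/
theorem sum_clamp_sub {E : Type} [AddCommGroup E] {t : ℕ → ℝ} (ht : Monotone t) (w : ℝ → E)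
    (n : ℕ) (x : ℝ) : ∑ k ∈ Finset.range n, (w (clamp (t k) (t (k + 1)) x) - w (t k))
      = w (clamp (t 0) (t n) x) - w (t 0) := by
  induction n with
  | zero =>
    have : clamp (t 0) (t 0) x = t 0 := by unfold clamp; grind
    simp [this]
  | succ n ih =>
    rw [Finset.sum_range_succ, ih]
    have h1 : t 0 ≤ t n := ht (Nat.zero_le _)
    have h2 : t n ≤ t (n + 1) := ht n.le_succ
    rcases le_total x (t n) with hx | hx
    · have e1 : clamp (t n) (t (n + 1)) x = t n := clamp_of_le hx
      have e2 : clamp (t 0) (t (n + 1)) x = clamp (t 0) (t n) x := by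
        unfold clamp
        rw [min_eq_left hx, min_eq_left (hx.trans h2)]
      rw [e1, e2, sub_self, add_zero]
    · have e1 : clamp (t 0) (t n) x = t n := clamp_of_ge h1 hx
      have e2 : clamp (t 0) (t (n + 1)) x = clamp (t n) (t (n + 1)) x := by
        unfold clamp; grind
      rw [e1, e2]
      abel

end StepFn

theorem sum_range_mul_eq {M : Type*} [AddCommMonoid M] (f : ℕ → M) (n m : ℕ) :
    ∑ i ∈ Finset.range (n * m), f i
      = ∑ k ∈ Finset.range n, ∑ l ∈ Finset.range m, f (k * m + l) := by
  induction n with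
  | zero => simp
  | succ n ih => rw [Nat.succ_mul, Finset.sum_range_add, ih, Finset.sum_range_succ]

namespace SimpleProcess

/-- The restriction of a simple process to a smaller interval. -/
noncomputable def restrict (S : SimpleProcess ℱ a b d) {p q : ℝ} (hap : a ≤ p) (hpq : p ≤ q)
    (hqb : q ≤ b) : SimpleProcess ℱ p q d where
  N := S.N
  time k := clamp p q (S.time k)
  time_mono _ _ h := clamp_mono p q (S.time_mono h)
  time_zero := by rw [S.time_zero, clamp_of_le hap]
  time_last := by rw [S.time_last, clamp_of_ge hpq hqb]
  -- Beyond q all clamped times equal q, while the original value need not be ℱ q-measurable. These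
  -- intervals are empty, so the value 0 changes nothing.
  val k := if S.time k ≤ q then S.val k else 0
  measurable_val k hk := by
    split_ifs with h
    · refine (S.measurable_val k hk).mono (ℱ.mono ?_)
      rw [clamp, min_eq_left h]
      exact le_max_right _ _
    · exact stronglyMeasurable_zero
  bounded_val := by
    obtain ⟨C, hC⟩ := S.bounded_val
    refine ⟨max C 0, fun k hk ω => ?_⟩
    split_ifs with h
    · exact (hC k hk ω).trans (le_max_left _ _)
    · simp

theorem integral_eq_incr (S : SimpleProcess ℱ a b d) {s : ℝ} (hs : a ≤ s) (ω : Ω) :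
    S.integral W s ω = (S.path ω).incr (fun u => W u ω) a s := by
  unfold SimpleProcess.integral StepFn.incr
  refine Finset.sum_congr rfl fun k _ => ?_
  have h : ∀ k, clamp a s (S.time k) = min (S.time k) s := fun k =>
    max_eq_right (le_min (S.time_zero.symm.trans_le (S.time_mono (Nat.zero_le _))) hs)
  simp only [path, h]

theorem total_restrict (S : SimpleProcess ℱ a b d) {p q : ℝ} (hap : a ≤ p) (hpq : p ≤ q)
    (hqb : q ≤ b) (ω : Ω) :
    (S.restrict hap hpq hqb).total W ω = S.integral W q ω - S.integral W p ω := by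
  rw [S.integral_eq_incr hap, S.integral_eq_incr (hap.trans hpq),
    ← (S.path ω).incr_add (fun u => W u ω) hap hpq, add_sub_cancel_left]
  unfold total StepFn.incr
  refine Finset.sum_congr rfl fun k _ => ?_
  simp only [restrict, path]
  split_ifs with h
  · rfl
  · rw [clamp_of_ge hpq (le_of_not_ge h),
      clamp_of_ge hpq ((le_of_not_ge h).trans (S.time_mono k.le_succ))]
    simp

theorem eval_restrict (S : SimpleProcess ℱ a b d) {p q : ℝ} (hap : a ≤ p) (hpq : p ≤ q)
    (hqb : q ≤ b) {u : ℝ} (hu : u ∈ Ioc p q) (ω : Ω) :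
    (S.restrict hap hpq hqb).eval u ω = S.eval u ω := by
  unfold SimpleProcess.eval
  refine Finset.sum_congr rfl fun k _ => ?_
  have hiff := mem_Ioc_clamp_iff (u := u) hpq (S.time_mono k.le_succ)
  by_cases hk : u ∈ Ioc (S.time k) (S.time (k + 1))
  · rw [indicator_of_mem hk]
    have h' : u ∈ Ioc ((S.restrict hap hpq hqb).time k) ((S.restrict hap hpq hqb).time (k + 1)) :=
      hiff.2 ⟨hu, hk⟩
    rw [indicator_of_mem h']
    simp only [restrict]
    rw [if_pos (hk.1.le.trans hu.2)]
  · rw [indicator_of_notMem hk]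
    refine indicator_of_notMem (fun h => hk (hiff.1 h).2) _

open Classical in
/-- A simple process, stopped just before its energy exceeds `c`. -/
noncomputable def truncate (S : SimpleProcess ℱ a b d) (c : ℝ) : SimpleProcess ℱ a b d where
  N := S.N
  time := S.time
  time_mono := S.time_mono
  time_zero := S.time_zero
  time_last := S.time_last
  -- The energy through the k-th interval is already known at its left end, because `val k` is. So
  -- the cut-off is predictable and the truncated energy never exceeds c.
  val k ω := if S.energy (k + 1) ω ≤ c then S.val k ω else 0
  measurable_val k hk :=
    StronglyMeasurable.ite ((S.measurable_energy hk).measurableSet_le stronglyMeasurable_const)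
      (S.measurable_val k hk) stronglyMeasurable_zero
  bounded_val := by
    obtain ⟨C, hC⟩ := S.bounded_val
    refine ⟨max C 0, fun k hk ω => ?_⟩
    split_ifs with h
    · exact (hC k hk ω).trans (le_max_left _ _)
    · simp

theorem energy_mono (S : SimpleProcess ℱ a b d) (ω : Ω) : Monotone fun n => S.energy n ω := by
  refine monotone_nat_of_le_succ fun n => ?_
  unfold energy
  rw [Finset.sum_range_succ]
  exact le_add_of_nonneg_right
    (mul_nonneg (sq_nonneg _) (sub_nonneg.2 (S.time_mono n.le_succ)))

theorem truncate_val (S : SimpleProcess ℱ a b d) {c : ℝ} {ω : Ω} (h : S.energy S.N ω ≤ c)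
    {k : ℕ} (hk : k < S.N) : (S.truncate c).val k ω = S.val k ω :=
  if_pos ((S.energy_mono ω hk).trans h)

theorem eval_truncate (S : SimpleProcess ℱ a b d) {c : ℝ} {ω : Ω} (h : S.energy S.N ω ≤ c)
    (u : ℝ) : (S.truncate c).eval u ω = S.eval u ω := by
  unfold SimpleProcess.eval
  refine Finset.sum_congr rfl fun k hk => ?_
  rw [S.truncate_val h (Finset.mem_range.1 hk)]
  rfl

theorem total_truncate (S : SimpleProcess ℱ a b d) {c : ℝ} {ω : Ω} (h : S.energy S.N ω ≤ c) :
    (S.truncate c).total W ω = S.total W ω := by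
  unfold total
  refine Finset.sum_congr rfl fun k hk => ?_
  rw [S.truncate_val h (Finset.mem_range.1 hk)]
  rfl

theorem energy_truncate_le (S : SimpleProcess ℱ a b d) {c : ℝ} (hc : 0 ≤ c) (ω : Ω) :
    (S.truncate c).energy S.N ω ≤ min (S.energy S.N ω) c := by
  have key : ∀ n : ℕ, (S.truncate c).energy n ω ≤ S.energy n ω ∧
      (S.truncate c).energy n ω ≤ c := by
    intro n
    induction n with
    | zero => simp [energy, hc]
    | succ n ih =>
      have hδ : 0 ≤ S.time (n + 1) - S.time n := sub_nonneg.2 (S.time_mono n.le_succ)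
      have e : (S.truncate c).energy (n + 1) ω = (S.truncate c).energy n ω
          + ‖(S.truncate c).val n ω‖ ^ 2 * (S.time (n + 1) - S.time n) := by
        unfold energy
        rw [Finset.sum_range_succ]
        rfl
      have e' : S.energy (n + 1) ω = S.energy n ω
          + ‖S.val n ω‖ ^ 2 * (S.time (n + 1) - S.time n) := by
        unfold energy
        rw [Finset.sum_range_succ]
      by_cases h : S.energy (n + 1) ω ≤ c
      · have hv : (S.truncate c).val n ω = S.val n ω := if_pos h
        have : (S.truncate c).energy (n + 1) ω ≤ S.energy (n + 1) ω := by
          rw [e, e', hv]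
          linarith [ih.1]
        exact ⟨this, this.trans h⟩
      · have hv : (S.truncate c).val n ω = 0 := if_neg h
        rw [e, hv]
        simp only [norm_zero, ne_eq, OfNat.ofNat_ne_zero, not_false_eq_true, zero_pow, zero_mul,
          add_zero]
        exact ⟨ih.1.trans (S.energy_mono ω n.le_succ), ih.2⟩
  exact le_min (key _).1 (key _).2

/-- The common refinement of two partitions. -/
noncomputable def refineTime (S S' : SimpleProcess ℱ a b d) (m : ℕ) : ℝ :=
  -- The index is m = k(N' + 1) + l, with k an interval of `S` and l a time of `S'`. The block
  -- length N' + 1 is positive even if N' = 0; in return the last interval of each block is empty.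
  clamp (S.time (m / (S'.N + 1))) (S.time (m / (S'.N + 1) + 1)) (S'.time (m % (S'.N + 1)))

theorem refineTime_eq (S S' : SimpleProcess ℱ a b d) (k : ℕ) {l : ℕ} (hl : l < S'.N + 1) :
    S.refineTime S' (k * (S'.N + 1) + l) = clamp (S.time k) (S.time (k + 1)) (S'.time l) := by
  have h1 : (k * (S'.N + 1) + l) / (S'.N + 1) = k := by
    rw [mul_comm, Nat.mul_add_div (Nat.succ_pos _), Nat.div_eq_of_lt hl, add_zero]
  have h2 : (k * (S'.N + 1) + l) % (S'.N + 1) = l := by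
    rw [mul_comm, Nat.mul_add_mod, Nat.mod_eq_of_lt hl]
  rw [refineTime, h1, h2]

theorem clamp_time_last (S S' : SimpleProcess ℱ a b d) {k : ℕ} (hk : k < S.N) {l : ℕ}
    (hl : S'.N ≤ l) : clamp (S.time k) (S.time (k + 1)) (S'.time l) = S.time (k + 1) :=
  clamp_of_ge (S.time_mono k.le_succ)
    ((S.time_mem hk).2.trans (S'.time_last.symm.trans_le (S'.time_mono hl)))

theorem refineTime_zero (S S' : SimpleProcess ℱ a b d) (k : ℕ) :
    S.refineTime S' (k * (S'.N + 1)) = S.time k := by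
  have := S.refineTime_eq S' k (Nat.succ_pos S'.N)
  rw [add_zero] at this
  rw [this, S'.time_zero]
  exact clamp_of_le (S.time_zero.symm.trans_le (S.time_mono (Nat.zero_le _)))

theorem refineTime_succ (S S' : SimpleProcess ℱ a b d) {k : ℕ} (hk : k < S.N) {l : ℕ}
    (hl : l < S'.N + 1) : S.refineTime S' (k * (S'.N + 1) + l + 1)
      = clamp (S.time k) (S.time (k + 1)) (S'.time (l + 1)) := by
  rcases Nat.lt_or_ge (l + 1) (S'.N + 1) with h | h
  · exact S.refineTime_eq S' k h
  · have hl' : l = S'.N := by omega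
    subst hl'
    rw [S.clamp_time_last S' hk (Nat.le_succ _), ← S.refineTime_zero S' (k + 1)]
    congr 1
    ring

theorem refineTime_mono (S S' : SimpleProcess ℱ a b d) : Monotone (S.refineTime S') := by
  refine monotone_nat_of_le_succ fun m => ?_
  obtain ⟨k, l, hl, rfl⟩ : ∃ k l, l < S'.N + 1 ∧ m = k * (S'.N + 1) + l :=
    ⟨m / (S'.N + 1), m % (S'.N + 1), Nat.mod_lt _ (Nat.succ_pos _), by
      rw [mul_comm]; exact (Nat.div_add_mod _ _).symm⟩
  rcases Nat.lt_or_ge (l + 1) (S'.N + 1) with h | h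
  · rw [S.refineTime_eq S' k hl, show k * (S'.N + 1) + l + 1 = k * (S'.N + 1) + (l + 1) from rfl,
      S.refineTime_eq S' k h]
    exact clamp_mono _ _ (S'.time_mono l.le_succ)
  · have e : k * (S'.N + 1) + l + 1 = (k + 1) * (S'.N + 1) := by
      have : l = S'.N := by omega
      rw [this]; ring
    rw [e, S.refineTime_zero, S.refineTime_eq S' k hl]
    exact (clamp_mem (S.time_mono k.le_succ) _).2

/-- The values of the difference of two simple processes on the common refinement. -/
noncomputable def subVal (S S' : SimpleProcess ℱ a b d) (m : ℕ) :
    Ω → EuclideanSpace ℝ (Fin d) :=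
  -- On an empty interval the value of `S'` may be unconstrained (l = N') or belong to a later time,
  -- so that measurability could fail. There the value is set to 0.
  if S.refineTime S' m < S.refineTime S' (m + 1) then
    fun ω => S.val (m / (S'.N + 1)) ω - S'.val (m % (S'.N + 1)) ω
  else 0

theorem subVal_eq (S S' : SimpleProcess ℱ a b d) (k : ℕ) {l : ℕ} (hl : l < S'.N + 1)
    (h : S.refineTime S' (k * (S'.N + 1) + l) < S.refineTime S' (k * (S'.N + 1) + l + 1)) :
    S.subVal S' (k * (S'.N + 1) + l) = fun ω => S.val k ω - S'.val l ω := by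
  have h1 : (k * (S'.N + 1) + l) / (S'.N + 1) = k := by
    rw [mul_comm, Nat.mul_add_div (Nat.succ_pos _), Nat.div_eq_of_lt hl, add_zero]
  have h2 : (k * (S'.N + 1) + l) % (S'.N + 1) = l := by
    rw [mul_comm, Nat.mul_add_mod, Nat.mod_eq_of_lt hl]
  rw [subVal, if_pos h, h1, h2]

theorem exists_index (S S' : SimpleProcess ℱ a b d) {m : ℕ} (hm : m < S.N * (S'.N + 1)) :
    ∃ k l, k < S.N ∧ l < S'.N + 1 ∧ m = k * (S'.N + 1) + l :=
  ⟨m / (S'.N + 1), m % (S'.N + 1), (Nat.div_lt_iff_lt_mul (Nat.succ_pos _)).2 hm,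
    Nat.mod_lt _ (Nat.succ_pos _), by rw [mul_comm]; exact (Nat.div_add_mod _ _).symm⟩

theorem lt_of_refineTime_lt (S S' : SimpleProcess ℱ a b d) {k l : ℕ} (hk : k < S.N)
    (hl : l < S'.N + 1)
    (h : S.refineTime S' (k * (S'.N + 1) + l) < S.refineTime S' (k * (S'.N + 1) + l + 1)) :
    l < S'.N := by
  by_contra hne
  have hl' : l = S'.N := by omega
  rw [S.refineTime_eq S' k hl, S.refineTime_succ S' hk hl, S.clamp_time_last S' hk hl'.ge,
    S.clamp_time_last S' hk (hl'.ge.trans l.le_succ)] at h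
  exact lt_irrefl _ h

/-- The difference of two simple processes. -/
noncomputable def sub (S S' : SimpleProcess ℱ a b d) : SimpleProcess ℱ a b d where
  N := S.N * (S'.N + 1)
  time := S.refineTime S'
  time_mono := S.refineTime_mono S'
  time_zero := by
    have := S.refineTime_zero S' 0
    rw [zero_mul] at this
    rw [this, S.time_zero]
  time_last := by rw [S.refineTime_zero, S.time_last]
  val := S.subVal S'
  measurable_val m hm := by
    obtain ⟨k, l, hk, hl, rfl⟩ := S.exists_index S' hm
    by_cases h : S.refineTime S' (k * (S'.N + 1) + l) < S.refineTime S' (k * (S'.N + 1) + l + 1)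
    · have hl' := S.lt_of_refineTime_lt S' hk hl h
      rw [S.subVal_eq S' k hl h]
      rw [S.refineTime_eq S' k hl, S.refineTime_succ S' hk hl] at h
      rw [S.refineTime_eq S' k hl]
      have h1 : S.time k ≤ clamp (S.time k) (S.time (k + 1)) (S'.time l) := le_max_left _ _
      have h2 : S'.time l ≤ clamp (S.time k) (S.time (k + 1)) (S'.time l) := by
        have hlt : S'.time l < S.time (k + 1) := by
          by_contra hge
          rw [clamp_of_ge (S.time_mono k.le_succ) (not_lt.1 hge)] at h
          exact absurd h (not_lt.2 (clamp_mem (S.time_mono k.le_succ) _).2)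
        rw [clamp, min_eq_left hlt.le]
        exact le_max_right _ _
      exact ((S.measurable_val k hk).mono (ℱ.mono h1)).sub
        ((S'.measurable_val l hl').mono (ℱ.mono h2))
    · rw [subVal, if_neg h]
      exact stronglyMeasurable_zero
  bounded_val := by
    obtain ⟨C, hC⟩ := S.bounded_val
    obtain ⟨C', hC'⟩ := S'.bounded_val
    refine ⟨max (C + C') 0, fun m hm ω => ?_⟩
    obtain ⟨k, l, hk, hl, rfl⟩ := S.exists_index S' hm
    by_cases h : S.refineTime S' (k * (S'.N + 1) + l) < S.refineTime S' (k * (S'.N + 1) + l + 1)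
    · have hl' := S.lt_of_refineTime_lt S' hk hl h
      rw [S.subVal_eq S' k hl h]
      exact ((norm_sub_le _ _).trans (add_le_add (hC k hk ω) (hC' l hl' ω))).trans
        (le_max_left _ _)
    · rw [subVal, if_neg h]
      simp

theorem eval_sub (S S' : SimpleProcess ℱ a b d) {u : ℝ} (hu : u ∈ Ioc a b) (ω : Ω) :
    (S.sub S').eval u ω = S.eval u ω - S'.eval u ω := by
  obtain ⟨k, hk, hku⟩ := (S.path ω).exists_mem_Ioc (u := u)
    (by simpa only [path, S.time_zero, S.time_last] using hu)
  obtain ⟨l, hl, hlu⟩ := (S'.path ω).exists_mem_Ioc (u := u)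
    (by simpa only [path, S'.time_zero, S'.time_last] using hu)
  rw [S.eval_path, S'.eval_path, (S.sub S').eval_path, (S.path ω).eval_of_mem hk hku,
    (S'.path ω).eval_of_mem hl hlu]
  have hk' : k < S.N := hk
  have hl' : l < S'.N := hl
  have hl1 : l < S'.N + 1 := by omega
  have hm : k * (S'.N + 1) + l < S.N * (S'.N + 1) := by
    calc k * (S'.N + 1) + l < k * (S'.N + 1) + (S'.N + 1) := by omega
      _ = (k + 1) * (S'.N + 1) := by ring
      _ ≤ S.N * (S'.N + 1) := Nat.mul_le_mul_right _ hk'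
  have hmem : u ∈ Ioc (S.refineTime S' (k * (S'.N + 1) + l))
      (S.refineTime S' (k * (S'.N + 1) + l + 1)) := by
    rw [S.refineTime_eq S' k hl1, S.refineTime_succ S' hk' hl1]
    exact (mem_Ioc_clamp_iff (S.time_mono k.le_succ) (S'.time_mono l.le_succ)).2 ⟨hku, hlu⟩
  rw [((S.sub S').path ω).eval_of_mem (k := k * (S'.N + 1) + l) hm hmem]
  have := S.subVal_eq S' k hl1 (hmem.1.trans_le hmem.2)
  exact congrFun this ω

/-- The double sum over the refinement is split. In the part with values of `S` the increments
telescope over l; in the part with values of `S'`, after exchanging the sums, they telescope over k.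
Empty intervals contribute nothing. -/
theorem total_sub (S S' : SimpleProcess ℱ a b d) (ω : Ω) :
    (S.sub S').total W ω = S.total W ω - S'.total W ω := by
  have hterm : ∀ k ∈ Finset.range S.N, ∀ l ∈ Finset.range (S'.N + 1),
      ⟪(S.sub S').val (k * (S'.N + 1) + l) ω, W ((S.sub S').time (k * (S'.N + 1) + l + 1)) ω
        - W ((S.sub S').time (k * (S'.N + 1) + l)) ω⟫
      = ⟪S.val k ω - S'.val l ω, W (clamp (S.time k) (S.time (k + 1)) (S'.time (l + 1))) ω
        - W (clamp (S.time k) (S.time (k + 1)) (S'.time l)) ω⟫ := by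
    intro k hk l hl
    have hk' := Finset.mem_range.1 hk
    have hl' := Finset.mem_range.1 hl
    have e1 : (S.sub S').time (k * (S'.N + 1) + l + 1)
        = clamp (S.time k) (S.time (k + 1)) (S'.time (l + 1)) := S.refineTime_succ S' hk' hl'
    have e2 : (S.sub S').time (k * (S'.N + 1) + l)
        = clamp (S.time k) (S.time (k + 1)) (S'.time l) := S.refineTime_eq S' k hl'
    rcases ((S.sub S').time_mono (k * (S'.N + 1) + l).le_succ).lt_or_eq with h | h
    · have h3 : (S.sub S').val (k * (S'.N + 1) + l) ω = S.val k ω - S'.val l ω :=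
        congrFun (S.subVal_eq S' k hl' h) ω
      rw [e1, e2, h3]
    · rw [Nat.succ_eq_add_one, e1, e2] at h
      rw [e1, e2, h, sub_self, inner_zero_right, inner_zero_right]
  have hN : (S.sub S').N = S.N * (S'.N + 1) := rfl
  rw [total, hN, sum_range_mul_eq, Finset.sum_congr rfl fun k hk => Finset.sum_congr rfl (hterm k hk)]
  simp_rw [inner_sub_left, Finset.sum_sub_distrib]
  congr 1
  · refine Finset.sum_congr rfl fun k hk => ?_
    rw [← inner_sum, Finset.sum_range_sub
      (fun l => W (clamp (S.time k) (S.time (k + 1)) (S'.time l)) ω),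
      S.clamp_time_last S' (Finset.mem_range.1 hk) (Nat.le_succ _), S'.time_zero,
      clamp_of_le (S.time_zero.symm.trans_le (S.time_mono (Nat.zero_le k)))]
  · rw [Finset.sum_comm, Finset.sum_range_succ]
    have hlast : ∑ k ∈ Finset.range S.N, ⟪S'.val S'.N ω,
        W (clamp (S.time k) (S.time (k + 1)) (S'.time (S'.N + 1))) ω
          - W (clamp (S.time k) (S.time (k + 1)) (S'.time S'.N)) ω⟫ = 0 := by
      refine Finset.sum_eq_zero fun k hk => ?_
      rw [S.clamp_time_last S' (Finset.mem_range.1 hk) (Nat.le_succ _),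
        S.clamp_time_last S' (Finset.mem_range.1 hk) le_rfl, sub_self, inner_zero_right]
    rw [hlast, add_zero, total]
    refine Finset.sum_congr rfl fun l hl => ?_
    have hl' := Finset.mem_range.1 hl
    rw [← inner_sum]
    congr 1
    have h1 := StepFn.sum_clamp_sub S.time_mono (fun u => W u ω) S.N (S'.time (l + 1))
    have h2 := StepFn.sum_clamp_sub S.time_mono (fun u => W u ω) S.N (S'.time l)
    rw [S.time_zero, S.time_last, clamp_of_mem (S'.time_mem hl')] at h1
    rw [S.time_zero, S.time_last, clamp_of_mem (S'.time_mem hl'.le)] at h2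
    have h3 := congrArg₂ (· - ·) h1 h2
    simp only [← Finset.sum_sub_distrib, sub_sub_sub_cancel_right] at h3
    exact h3

end SimpleProcess

end SimpleOps

/-! ### The `L²` theory of the Itô integral over a fixed interval -/

section L2

variable {α : Type*} {mα : MeasurableSpace α} {m : Measure α}

theorem eLpNorm_two_sq {E : Type*} [NormedAddCommGroup E] (f : α → E) :
    eLpNorm f 2 m ^ 2 = ∫⁻ x, ‖f x‖ₑ ^ 2 ∂m := by
  have := eLpNorm_nnreal_pow_eq_lintegral (f := f) (μ := m) (p := 2) (by simp)
  simpa using this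

theorem sq_rpow_half (x : ℝ≥0∞) : (x ^ 2) ^ (1 / 2 : ℝ) = x := by
  rw [← ENNReal.rpow_natCast, ← ENNReal.rpow_mul]
  norm_num

theorem tendsto_eLpNorm_two_iff {E : Type*} [NormedAddCommGroup E] {f : ℕ → α → E} :
    Tendsto (fun k => eLpNorm (f k) 2 m) atTop (𝓝 0)
      ↔ Tendsto (fun k => ∫⁻ x, ‖f k x‖ₑ ^ 2 ∂m) atTop (𝓝 0) := by
  simp_rw [← eLpNorm_two_sq]
  constructor
  · intro h
    have := ENNReal.Tendsto.pow (n := 2) h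
    simpa using this
  · intro h
    have := h.ennrpow_const (1 / 2 : ℝ)
    simp only [sq_rpow_half] at this
    simpa using this

theorem memLp_two_of_lintegral {E : Type*} [NormedAddCommGroup E] {f : α → E}
    (hf : AEStronglyMeasurable f m) (h : ∫⁻ x, ‖f x‖ₑ ^ 2 ∂m ≠ ∞) : MemLp f 2 m := by
  refine ⟨hf, ?_⟩
  rw [← eLpNorm_two_sq] at h
  exact lt_top_iff_ne_top.2 fun h' => h (by simp [h'])

theorem ofReal_integral_norm_sq {E : Type*} [NormedAddCommGroup E] {f : α → E}
    (hf : MemLp f 2 m) : ENNReal.ofReal (∫ x, ‖f x‖ ^ 2 ∂m) = ∫⁻ x, ‖f x‖ₑ ^ 2 ∂m := by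
  rw [ofReal_integral_eq_lintegral_ofReal hf.norm.integrable_sq
    (Eventually.of_forall fun x => sq_nonneg _)]
  refine lintegral_congr fun x => ?_
  rw [ENNReal.ofReal_pow (norm_nonneg _), ofReal_norm]

theorem tendsto_integral_inner {E : Type*} [NormedAddCommGroup E] [InnerProductSpace ℝ E]
    {f g : ℕ → α → E} {f' g' : α → E} (hf : ∀ k, MemLp (f k) 2 m) (hf' : MemLp f' 2 m)
    (hg : ∀ k, MemLp (g k) 2 m) (hg' : MemLp g' 2 m)
    (hff : Tendsto (fun k => eLpNorm (f k - f') 2 m) atTop (𝓝 0))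
    (hgg : Tendsto (fun k => eLpNorm (g k - g') 2 m) atTop (𝓝 0)) :
    Tendsto (fun k => ∫ x, ⟪f k x, g k x⟫ ∂m) atTop (𝓝 (∫ x, ⟪f' x, g' x⟫ ∂m)) := by
  have h1 := (Lp.tendsto_Lp_iff_tendsto_eLpNorm'' f hf f' hf').2 hff
  have h2 := (Lp.tendsto_Lp_iff_tendsto_eLpNorm'' g hg g' hg').2 hgg
  have h3 := h1.inner (𝕜 := ℝ) h2
  have e : ∀ {a b : α → E} (ha : MemLp a 2 m) (hb : MemLp b 2 m),
      ⟪ha.toLp a, hb.toLp b⟫ = ∫ x, ⟪a x, b x⟫ ∂m := by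
    intro a b ha hb
    rw [L2.inner_def]
    refine integral_congr_ae ?_
    filter_upwards [ha.coeFn_toLp, hb.coeFn_toLp] with x hx hx'
    rw [hx, hx']
  simpa only [e] using h3

/-- Capping at 1 makes the functions real valued and does not affect convergence to 0. No
measurability is required, so `A` may contain a supremum over uncountably many times. -/
theorem exists_seq_tendsto_zero {A : ℕ → α → ℝ≥0∞}
    (h : ∀ ε : ℝ≥0∞, 0 < ε → Tendsto (fun k => m {x | ε ≤ A k x}) atTop (𝓝 0)) :
    ∃ ns : ℕ → ℕ, StrictMono ns ∧ ∀ᵐ x ∂m, Tendsto (fun k => A (ns k) x) atTop (𝓝 0) := by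
  have hd : ∀ k x, edist (min (A k x) 1).toReal 0 = min (A k x) 1 := by
    intro k x
    rw [edist_dist, Real.dist_eq, sub_zero, abs_of_nonneg ENNReal.toReal_nonneg,
      ENNReal.ofReal_toReal (ne_top_of_le_ne_top ENNReal.one_ne_top (min_le_right _ _))]
  have hm : TendstoInMeasure m (fun k x => (min (A k x) 1).toReal) atTop (fun _ => (0 : ℝ)) := by
    intro ε hε
    refine tendsto_of_tendsto_of_tendsto_of_le_of_le tendsto_const_nhds (h ε hε)
      (fun _ => zero_le) (fun k => measure_mono fun x hx => ?_)
    simp only [mem_ofPred_eq, hd] at hx ⊢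
    exact hx.trans (min_le_left _ _)
  obtain ⟨ns, hns, hlim⟩ := hm.exists_seq_tendsto_ae
  refine ⟨ns, hns, hlim.mono fun x hx => ?_⟩
  have h1 : Tendsto (fun k => min (A (ns k) x) 1) atTop (𝓝 0) := by
    have := (tendsto_iff_edist_tendsto_0.1 hx)
    simpa only [hd] using this
  have h2 : ∀ᶠ k in atTop, min (A (ns k) x) 1 < 1 := h1.eventually_lt_const zero_lt_one
  refine h1.congr' (h2.mono fun k hk => ?_)
  rcases min_lt_iff.1 hk with h | h
  · exact min_eq_left h.le
  · exact absurd h (lt_irrefl _)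

end L2

/-! ### Itô integrals over a fixed interval as almost sure limits -/

variable {Ω : Type*} {mΩ : MeasurableSpace Ω} {ℱ : Filtration ℝ mΩ} {P : Measure Ω}
  {d : ℕ} {T : ℝ} {W : ℝ → Ω → EuclideanSpace ℝ (Fin d)} {p q : ℝ}
  {H : ℝ → Ω → EuclideanSpace ℝ (Fin d)} {X : Ω → ℝ}

/-- `X` is the Itô integral of `H` over `[p, q]`, as an almost sure limit of elementary integrals
of simple processes which almost surely approximate `H` in `L²(p, q)`. -/
def HasItoIntegral (ℱ : Filtration ℝ mΩ) (P : Measure Ω) (W : ℝ → Ω → EuclideanSpace ℝ (Fin d))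
    (p q : ℝ) (H : ℝ → Ω → EuclideanSpace ℝ (Fin d)) (X : Ω → ℝ) : Prop :=
  ∃ S : ℕ → SimpleProcess ℱ p q d, ∀ᵐ ω ∂P,
    Tendsto (fun k => ∫⁻ u in Icc p q, ‖(S k).eval u ω - H u ω‖ₑ ^ 2) atTop (𝓝 0) ∧
    Tendsto (fun k => (S k).total W ω) atTop (𝓝 (X ω))

theorem setLIntegral_Icc_congr {f g : ℝ → ℝ≥0∞} (h : ∀ u ∈ Ioc p q, f u = g u) :
    ∫⁻ u in Icc p q, f u = ∫⁻ u in Icc p q, g u := by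
  rw [setLIntegral_congr Ioc_ae_eq_Icc.symm, setLIntegral_congr (f := g) Ioc_ae_eq_Icc.symm]
  exact setLIntegral_congr_fun measurableSet_Ioc h

/-- The energy error and the uniform error of the integrals are added into one quantity, so that a
single subsequence makes both converge almost surely. Restricting the simple processes to [p, q]
does not increase the energy error. -/
theorem IsItoIntegral.hasItoIntegral {a b : ℝ} {I : ℝ → Ω → ℝ}
    (hI : IsItoIntegral ℱ P W a b H I) (hap : a ≤ p) (hpq : p ≤ q) (hqb : q ≤ b) :
    HasItoIntegral ℱ P W p q H (fun ω => I q ω - I p ω) := by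
  obtain ⟨-, -, S, h1, h2⟩ := hI
  have h3 : ∀ ε : ℝ≥0∞, 0 < ε → Tendsto (fun k => P {ω | ε ≤
      (∫⁻ u in Icc a b, ‖(S k).eval u ω - H u ω‖ₑ ^ 2)
        + (⨆ s ∈ Icc a b, ENNReal.ofReal |(S k).integral W s ω - I s ω|)}) atTop (𝓝 0) := by
    intro ε hε
    obtain ⟨δ, hδ, hδε⟩ : ∃ δ : ℝ, 0 < δ ∧ 2 * ENNReal.ofReal δ < ε := by
      obtain ⟨r, hr, hrε⟩ := ENNReal.lt_iff_exists_nnreal_btwn.1 hε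
      refine ⟨r / 2, by simpa using hr, ?_⟩
      rw [show (2 : ℝ≥0∞) = ENNReal.ofReal 2 by simp, ← ENNReal.ofReal_mul (by norm_num),
        mul_div_cancel₀ _ (by norm_num)]
      simpa using hrε
    have hδ' : 0 < ENNReal.ofReal δ := ENNReal.ofReal_pos.2 hδ
    have hsum := (h1 _ hδ').add (h2 δ hδ)
    rw [add_zero] at hsum
    refine tendsto_of_tendsto_of_tendsto_of_le_of_le tendsto_const_nhds hsum
      (fun _ => zero_le) (fun k => ?_)
    refine (measure_mono fun ω hω => ?_).trans (measure_union_le _ _)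
    by_contra hcon
    simp only [mem_union, mem_ofPred_eq, not_or, not_le, not_exists, not_and] at hcon hω
    have hsup : (⨆ s ∈ Icc a b, ENNReal.ofReal |(S k).integral W s ω - I s ω|)
        ≤ ENNReal.ofReal δ :=
      iSup₂_le fun s hs => ENNReal.ofReal_le_ofReal (hcon.2 s hs).le
    exact absurd (hω.trans (add_le_add hcon.1.le hsup)) (not_le.2 (by rwa [← two_mul]))
  obtain ⟨ns, -, hlim⟩ := exists_seq_tendsto_zero h3
  refine ⟨fun k => (S (ns k)).restrict hap hpq hqb, hlim.mono fun ω hω => ⟨?_, ?_⟩⟩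
  · refine tendsto_of_tendsto_of_tendsto_of_le_of_le tendsto_const_nhds hω
      (fun _ => zero_le) (fun k => ?_)
    refine le_trans ?_ le_self_add
    rw [setLIntegral_Icc_congr (g := fun u => ‖(S (ns k)).eval u ω - H u ω‖ₑ ^ 2)
      (fun u hu => by rw [SimpleProcess.eval_restrict _ hap hpq hqb hu])]
    exact lintegral_mono_set (Icc_subset_Icc hap hqb)
  · have key : ∀ s ∈ Icc a b, Tendsto (fun k => (S (ns k)).integral W s ω) atTop (𝓝 (I s ω)) := by
      intro s hs
      refine tendsto_iff_edist_tendsto_0.2 (tendsto_of_tendsto_of_tendsto_of_le_of_le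
        tendsto_const_nhds hω (fun _ => zero_le) (fun k => ?_))
      refine le_trans ?_ le_add_self
      rw [edist_dist, Real.dist_eq]
      exact le_iSup₂ (f := fun s (_ : s ∈ Icc a b) =>
        ENNReal.ofReal |(S (ns k)).integral W s ω - I s ω|) s hs
    simp_rw [SimpleProcess.total_restrict]
    exact (key q ⟨hap.trans hpq, hqb⟩).sub (key p ⟨hap, hpq.trans hqb⟩)

namespace HasItoIntegral

theorem congr {H' : ℝ → Ω → EuclideanSpace ℝ (Fin d)} {X' : Ω → ℝ}
    (h : HasItoIntegral ℱ P W p q H X) (hH : ∀ᵐ ω ∂P, ∀ u ∈ Icc p q, H u ω = H' u ω)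
    (hX : X =ᵐ[P] X') : HasItoIntegral ℱ P W p q H' X' := by
  obtain ⟨S, hS⟩ := h
  refine ⟨S, ?_⟩
  filter_upwards [hS, hH, hX] with ω h1 h2 h3
  refine ⟨h1.1.congr fun k => ?_, h3 ▸ h1.2⟩
  exact setLIntegral_Icc_congr fun u hu => by rw [h2 u (Ioc_subset_Icc_self hu)]

/-- Lets second moment bounds be applied to the error S - H, so that approximation of integrands
gives approximation of integrals. -/
theorem simple_sub (h : HasItoIntegral ℱ P W p q H X) (S : SimpleProcess ℱ p q d) :
    HasItoIntegral ℱ P W p q (fun u ω => S.eval u ω - H u ω) (fun ω => S.total W ω - X ω) := by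
  obtain ⟨S', hS⟩ := h
  refine ⟨fun k => S.sub (S' k), hS.mono fun ω h1 => ⟨h1.1.congr fun k => ?_, ?_⟩⟩
  · refine setLIntegral_Icc_congr fun u hu => ?_
    rw [S.eval_sub _ hu, sub_sub_sub_cancel_left, ← enorm_neg, neg_sub]
  · simp_rw [S.total_sub]
    exact tendsto_const_nhds.sub h1.2

variable [IsProbabilityMeasure P]

theorem aestronglyMeasurable (h : HasItoIntegral ℱ P W p q H X) (hW : IsBrownianMotion ℱ P T W)
    (hp : 0 ≤ p) (hq : q ≤ T) : AEStronglyMeasurable X P := by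
  obtain ⟨S, hS⟩ := h
  exact aestronglyMeasurable_of_tendsto_ae atTop
    (fun k => ((S k).memLp_total hW hp hq).aestronglyMeasurable) (hS.mono fun ω h => h.2)

end HasItoIntegral

theorem measurable_energy_of_measurable (hH : Measurable fun z : ℝ × Ω => H z.1 z.2) (s : Set ℝ) :
    Measurable fun ω => ∫⁻ u in s, ‖H u ω‖ₑ ^ 2 := by
  have : Measurable fun z : Ω × ℝ => ‖H z.2 z.1‖ₑ ^ 2 :=
    ((hH.comp measurable_swap).enorm).pow_const 2
  exact this.lintegral_prod_right'

theorem SimpleProcess.lintegral_eval_le (S : SimpleProcess ℱ p q d)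
    (hH : Measurable fun z : ℝ × Ω => H z.1 z.2) (ω : Ω) :
    ∫⁻ u in Icc p q, ‖S.eval u ω‖ₑ ^ 2 ≤ (eLpNorm (fun u => H u ω) 2 (volume.restrict (Icc p q))
      + eLpNorm (fun u => S.eval u ω - H u ω) 2 (volume.restrict (Icc p q))) ^ 2 := by
  have m1 : Measurable fun u => H u ω := hH.comp (measurable_id.prodMk measurable_const)
  have m2 : Measurable fun u => S.eval u ω :=
    S.measurable_eval.comp (measurable_id.prodMk measurable_const)
  rw [← eLpNorm_two_sq]
  gcongr
  have := eLpNorm_add_le (p := 2) (μ := volume.restrict (Icc p q)) m1.aestronglyMeasurable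
    (m2.sub m1).aestronglyMeasurable (by norm_num)
  refine le_trans (le_of_eq ?_) this
  congr 1
  ext1 u
  simp

theorem tendsto_eLpNorm_add_sq {S : ℕ → SimpleProcess ℱ p q d} {ω : Ω}
    (h : Tendsto (fun k => ∫⁻ u in Icc p q, ‖(S k).eval u ω - H u ω‖ₑ ^ 2) atTop (𝓝 0)) :
    Tendsto (fun k => (eLpNorm (fun u => H u ω) 2 (volume.restrict (Icc p q))
      + eLpNorm (fun u => (S k).eval u ω - H u ω) 2 (volume.restrict (Icc p q))) ^ 2) atTop
      (𝓝 (∫⁻ u in Icc p q, ‖H u ω‖ₑ ^ 2)) := by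
  rw [← eLpNorm_two_sq]
  have h1 := (tendsto_eLpNorm_two_iff (f := fun k u => (S k).eval u ω - H u ω)).2 h
  have h2 := (tendsto_const_nhds (x := eLpNorm (fun u => H u ω) 2
    (volume.restrict (Icc p q)))).add h1
  rw [add_zero] at h2
  exact ENNReal.Tendsto.pow h2

theorem eventually_energy_le {S : ℕ → SimpleProcess ℱ p q d} {ω : Ω}
    (hH : Measurable fun z : ℝ × Ω => H z.1 z.2)
    (h : Tendsto (fun k => ∫⁻ u in Icc p q, ‖(S k).eval u ω - H u ω‖ₑ ^ 2) atTop (𝓝 0))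
    {c : ℝ} (hc : ∫⁻ u in Icc p q, ‖H u ω‖ₑ ^ 2 < ENNReal.ofReal c) :
    ∀ᶠ k in atTop, (S k).energy (S k).N ω ≤ c := by
  filter_upwards [(tendsto_eLpNorm_add_sq h).eventually_lt_const hc] with k hk
  have := ((S k).lintegral_eval_le hH ω).trans_lt hk
  rw [← (S k).ofReal_energy] at this
  exact ((ENNReal.ofReal_lt_ofReal_iff_of_nonneg ((S k).energy_nonneg _ _)).1 this).le

theorem SimpleProcess.lintegral_truncate_le (S : SimpleProcess ℱ p q d) {c : ℝ} (hc : 0 ≤ c)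
    (ω : Ω) : ∫⁻ u in Icc p q, ‖(S.truncate c).eval u ω‖ₑ ^ 2
      ≤ min (∫⁻ u in Icc p q, ‖S.eval u ω‖ₑ ^ 2) (ENNReal.ofReal c) := by
  rw [← ofReal_energy, ← ofReal_energy]
  have := S.energy_truncate_le hc ω
  exact le_min (ENNReal.ofReal_le_ofReal (this.trans (min_le_left _ _)))
    (ENNReal.ofReal_le_ofReal (this.trans (min_le_right _ _)))

namespace HasItoIntegral

variable [IsProbabilityMeasure P]

/-- The localized second moment bound for Itô integrals. -/
theorem lintegral_indicator_sq_le (h : HasItoIntegral ℱ P W p q H X)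
    (hW : IsBrownianMotion ℱ P T W) (hp : 0 ≤ p) (hq : q ≤ T)
    (hH : Measurable fun z : ℝ × Ω => H z.1 z.2) {c : ℝ} (hc : 0 ≤ c) :
    ∫⁻ ω, {ω | ∫⁻ u in Icc p q, ‖H u ω‖ₑ ^ 2 < ENNReal.ofReal c}.indicator
        (fun ω => ‖X ω‖ₑ ^ 2) ω ∂P
      ≤ ∫⁻ ω, min (∫⁻ u in Icc p q, ‖H u ω‖ₑ ^ 2) (ENNReal.ofReal c) ∂P := by
  obtain ⟨S, hS⟩ := h
  have hmeas : ∀ k, AEMeasurable (fun ω => ‖((S k).truncate c).total W ω‖ₑ ^ 2) P := fun k =>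
    ((((S k).truncate c).memLp_total hW hp hq).aestronglyMeasurable.enorm).pow_const 2
  -- A majorant of the truncated energies. It is bounded by c and converges, so its expectations
  -- converge, although the energies of the `S k` themselves need not be dominated.
  set B : ℕ → Ω → ℝ≥0∞ := fun k ω => min ((eLpNorm (fun u => H u ω) 2 (volume.restrict (Icc p q))
      + eLpNorm (fun u => (S k).eval u ω - H u ω) 2 (volume.restrict (Icc p q))) ^ 2)
        (ENNReal.ofReal c) with hB
  have hnm : ∀ G : ℝ → Ω → EuclideanSpace ℝ (Fin d), (Measurable fun z : ℝ × Ω => G z.1 z.2) →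
      Measurable fun ω => eLpNorm (fun u => G u ω) 2 (volume.restrict (Icc p q)) := by
    intro G hG
    have := (measurable_energy_of_measurable hG (Icc p q)).pow_const (1 / 2 : ℝ)
    simpa only [← eLpNorm_two_sq, sq_rpow_half] using this
  have hBm : ∀ k, Measurable (B k) := fun k =>
    (((hnm H hH).add (hnm _ ((S k).measurable_eval.sub hH))).pow_const 2).min measurable_const
  have hBlim : Tendsto (fun k => ∫⁻ ω, B k ω ∂P) atTop
      (𝓝 (∫⁻ ω, min (∫⁻ u in Icc p q, ‖H u ω‖ₑ ^ 2) (ENNReal.ofReal c) ∂P)) := by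
    refine tendsto_lintegral_of_dominated_convergence (fun _ => ENNReal.ofReal c) hBm
      (fun k => Eventually.of_forall fun ω => min_le_right _ _) (by simp) ?_
    filter_upwards [hS] with ω h1
    exact (tendsto_eLpNorm_add_sq h1.1).min tendsto_const_nhds
  -- Where the energy of H is below c, the energies of the `S k` are eventually at most c, and
  -- truncation no longer changes the integrals. Fatou's lemma and the isometry for the truncated
  -- processes give the bound.
  calc ∫⁻ ω, {ω | ∫⁻ u in Icc p q, ‖H u ω‖ₑ ^ 2 < ENNReal.ofReal c}.indicator
        (fun ω => ‖X ω‖ₑ ^ 2) ω ∂P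
      ≤ ∫⁻ ω, liminf (fun k => ‖((S k).truncate c).total W ω‖ₑ ^ 2) atTop ∂P := by
        refine lintegral_mono_ae ?_
        filter_upwards [hS] with ω h1
        by_cases hω : ω ∈ {ω | ∫⁻ u in Icc p q, ‖H u ω‖ₑ ^ 2 < ENNReal.ofReal c}
        · rw [indicator_of_mem hω]
          have : Tendsto (fun k => ‖((S k).truncate c).total W ω‖ₑ ^ 2) atTop
              (𝓝 (‖X ω‖ₑ ^ 2)) := by
            refine ENNReal.Tendsto.pow (Tendsto.enorm ?_)
            refine h1.2.congr' ((eventually_energy_le hH h1.1 hω).mono fun k hk => ?_)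
            exact ((S k).total_truncate hk).symm
          rw [this.liminf_eq]
        · rw [indicator_of_notMem hω]
          exact zero_le
    _ ≤ liminf (fun k => ∫⁻ ω, ‖((S k).truncate c).total W ω‖ₑ ^ 2 ∂P) atTop :=
        lintegral_liminf_le' hmeas
    _ ≤ liminf (fun k => ∫⁻ ω, B k ω ∂P) atTop := by
        refine liminf_le_liminf (Eventually.of_forall fun k => ?_)
        rw [SimpleProcess.lintegral_total_sq _ hW hp hq]
        refine lintegral_mono fun ω => ((S k).lintegral_truncate_le hc ω).trans ?_
        exact min_le_min_right _ ((S k).lintegral_eval_le hH ω)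
    _ = _ := hBlim.liminf_eq

/-- Let the level c tend to infinity in the localized bound, by Fatou's lemma. -/
theorem lintegral_sq_le (h : HasItoIntegral ℱ P W p q H X)
    (hW : IsBrownianMotion ℱ P T W) (hp : 0 ≤ p) (hq : q ≤ T)
    (hH : Measurable fun z : ℝ × Ω => H z.1 z.2)
    (hfin : ∀ᵐ ω ∂P, ∫⁻ u in Icc p q, ‖H u ω‖ₑ ^ 2 ≠ ∞) :
    ∫⁻ ω, ‖X ω‖ₑ ^ 2 ∂P ≤ ∫⁻ ω, (∫⁻ u in Icc p q, ‖H u ω‖ₑ ^ 2) ∂P := by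
  have hX := (h.aestronglyMeasurable hW hp hq).enorm.pow_const 2
  have hQ := measurable_energy_of_measurable hH (Icc p q)
  calc ∫⁻ ω, ‖X ω‖ₑ ^ 2 ∂P
      ≤ ∫⁻ ω, liminf (fun k : ℕ => {ω | ∫⁻ u in Icc p q, ‖H u ω‖ₑ ^ 2
          < ENNReal.ofReal k}.indicator (fun ω => ‖X ω‖ₑ ^ 2) ω) atTop ∂P := by
        refine lintegral_mono_ae ?_
        filter_upwards [hfin] with ω hω
        have : Tendsto (fun k : ℕ => {ω | ∫⁻ u in Icc p q, ‖H u ω‖ₑ ^ 2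
          < ENNReal.ofReal k}.indicator (fun ω => ‖X ω‖ₑ ^ 2) ω) atTop (𝓝 (‖X ω‖ₑ ^ 2)) := by
          obtain ⟨N, hN⟩ := ENNReal.exists_nat_gt hω
          refine tendsto_const_nhds.congr' (eventually_atTop.2 ⟨N, fun k hk => ?_⟩)
          dsimp only
          rw [indicator_of_mem]
          simp only [mem_ofPred_eq, ENNReal.ofReal_natCast]
          exact hN.trans_le (by exact_mod_cast hk)
        rw [this.liminf_eq]
    _ ≤ liminf (fun k : ℕ => ∫⁻ ω, {ω | ∫⁻ u in Icc p q, ‖H u ω‖ₑ ^ 2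
          < ENNReal.ofReal k}.indicator (fun ω => ‖X ω‖ₑ ^ 2) ω ∂P) atTop :=
        lintegral_liminf_le' fun k => hX.indicator (measurableSet_lt hQ measurable_const)
    _ ≤ liminf (fun _ : ℕ => ∫⁻ ω, (∫⁻ u in Icc p q, ‖H u ω‖ₑ ^ 2) ∂P) atTop := by
        refine liminf_le_liminf (Eventually.of_forall fun k => ?_)
        refine (h.lintegral_indicator_sq_le hW hp hq hH (Nat.cast_nonneg k)).trans ?_
        exact lintegral_mono fun ω => min_le_left _ _
    _ = _ := by simp

theorem enorm_sub_sq_le {E : Type*} [NormedAddCommGroup E] (x y : E) :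
    ‖x - y‖ₑ ^ 2 ≤ 2 * ‖x‖ₑ ^ 2 + 2 * ‖y‖ₑ ^ 2 := by
  have h : ‖x - y‖ ^ 2 ≤ 2 * ‖x‖ ^ 2 + 2 * ‖y‖ ^ 2 := by
    have := norm_sub_le x y
    nlinarith [norm_nonneg x, norm_nonneg y, norm_nonneg (x - y), sq_nonneg (‖x‖ - ‖y‖)]
  have e : ∀ z : E, ‖z‖ₑ ^ 2 = ENNReal.ofReal (‖z‖ ^ 2) := fun z => by
    rw [ENNReal.ofReal_pow (norm_nonneg _), ofReal_norm]
  rw [e, e, e, show (2 : ℝ≥0∞) = ENNReal.ofReal 2 by simp, ← ENNReal.ofReal_mul (by norm_num),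
    ← ENNReal.ofReal_mul (by norm_num), ← ENNReal.ofReal_add (by positivity) (by positivity)]
  exact ENNReal.ofReal_le_ofReal h

/-- An integrand of finite energy is approximated by simple processes in mean square. -/
theorem exists_simple (h : HasItoIntegral ℱ P W p q H X)
    (hH : Measurable fun z : ℝ × Ω => H z.1 z.2)
    (hfin : ∫⁻ ω, (∫⁻ u in Icc p q, ‖H u ω‖ₑ ^ 2) ∂P ≠ ∞) {ε : ℝ≥0∞} (hε : 0 < ε) :
    ∃ S : SimpleProcess ℱ p q d,
      ∫⁻ ω, (∫⁻ u in Icc p q, ‖S.eval u ω - H u ω‖ₑ ^ 2) ∂P ≤ ε := by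
  obtain ⟨S, hS⟩ := h
  set Q : Ω → ℝ≥0∞ := fun ω => ∫⁻ u in Icc p q, ‖H u ω‖ₑ ^ 2 with hQdef
  have hQ : Measurable Q := measurable_energy_of_measurable hH (Icc p q)
  have hQfin : ∀ᵐ ω ∂P, Q ω < ∞ := ae_lt_top hQ hfin
  -- The truncation error is at most 2c + 2Q, which is at most 4Q where Q ≥ c. For large c this
  -- event contributes less than ε/2. Where Q < c, dominated convergence in k handles the rest.
  obtain ⟨c, hc⟩ : ∃ c : ℕ, ∫⁻ ω, {ω | Q ω < c}ᶜ.indicator (fun ω => 4 * Q ω) ω ∂P < ε / 2 := by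
    have : Tendsto (fun c : ℕ => ∫⁻ ω, {ω | Q ω < c}ᶜ.indicator (fun ω => 4 * Q ω) ω ∂P) atTop
        (𝓝 (∫⁻ _, 0 ∂P)) := by
      refine tendsto_lintegral_of_dominated_convergence (fun ω => 4 * Q ω)
        (fun c => (hQ.const_mul 4).indicator (measurableSet_lt hQ measurable_const).compl)
        (fun c => Eventually.of_forall fun ω => indicator_le_self _ _ _) ?_ ?_
      · rw [lintegral_const_mul _ hQ]
        exact ENNReal.mul_ne_top (by norm_num) hfin
      · filter_upwards [hQfin] with ω hω
        obtain ⟨N, hN⟩ := ENNReal.exists_nat_gt hω.ne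
        refine tendsto_const_nhds.congr' (eventually_atTop.2 ⟨N, fun k hk => ?_⟩)
        dsimp only
        rw [indicator_of_notMem]
        simp only [mem_compl_iff, mem_ofPred_eq, not_not]
        exact hN.trans_le (by exact_mod_cast hk)
    rw [lintegral_zero] at this
    exact (this.eventually_lt_const (ENNReal.half_pos hε.ne')).exists
  set g : ℕ → Ω → ℝ≥0∞ := fun k ω =>
    ∫⁻ u in Icc p q, ‖((S k).truncate c).eval u ω - H u ω‖ₑ ^ 2 with hg
  have hgm : ∀ k, Measurable (g k) := fun k =>
    measurable_energy_of_measurable (((S k).truncate c).measurable_eval.sub hH) (Icc p q)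
  have hgle : ∀ k ω, g k ω ≤ 2 * c + 2 * Q ω := by
    intro k ω
    have m1 : Measurable fun u => ‖((S k).truncate c).eval u ω‖ₑ ^ 2 :=
      (((S k).truncate c).measurable_eval.comp
        (measurable_id.prodMk measurable_const)).enorm.pow_const 2
    have m2 : Measurable fun u => ‖H u ω‖ₑ ^ 2 :=
      (hH.comp (measurable_id.prodMk measurable_const)).enorm.pow_const 2
    calc g k ω ≤ ∫⁻ u in Icc p q, (2 * ‖((S k).truncate c).eval u ω‖ₑ ^ 2 + 2 * ‖H u ω‖ₑ ^ 2) :=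
          lintegral_mono fun u => enorm_sub_sq_le _ _
      _ = 2 * (∫⁻ u in Icc p q, ‖((S k).truncate c).eval u ω‖ₑ ^ 2) + 2 * Q ω := by
          rw [lintegral_add_left (m1.const_mul 2), lintegral_const_mul _ m1,
            lintegral_const_mul _ m2]
      _ ≤ 2 * c + 2 * Q ω := by
          gcongr
          have := ((S k).lintegral_truncate_le (Nat.cast_nonneg c) ω).trans (min_le_right _ _)
          simpa using this
  have hlim : Tendsto (fun k => ∫⁻ ω, {ω | Q ω < c}.indicator (g k) ω ∂P) atTop
      (𝓝 (∫⁻ _, 0 ∂P)) := by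
    refine tendsto_lintegral_of_dominated_convergence (fun ω => 2 * c + 2 * Q ω)
      (fun k => (hgm k).indicator (measurableSet_lt hQ measurable_const))
      (fun k => Eventually.of_forall fun ω => (indicator_le_self _ _ _).trans (hgle k ω)) ?_ ?_
    · rw [lintegral_add_left measurable_const, lintegral_const_mul _ hQ]
      refine ENNReal.add_ne_top.2 ⟨?_, ENNReal.mul_ne_top (by norm_num) hfin⟩
      simp [ENNReal.mul_eq_top]
    · filter_upwards [hS] with ω h1
      by_cases hω : ω ∈ {ω | Q ω < c}
      · simp_rw [indicator_of_mem hω]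
        refine h1.1.congr' ((eventually_energy_le hH h1.1 (c := c) (by simpa using hω)).mono
          fun k hk => ?_)
        refine lintegral_congr fun u => ?_
        rw [(S k).eval_truncate hk]
      · simp_rw [indicator_of_notMem hω]
        exact tendsto_const_nhds
  rw [lintegral_zero] at hlim
  obtain ⟨k, hk⟩ := (hlim.eventually_lt_const (ENNReal.half_pos hε.ne')).exists
  refine ⟨(S k).truncate c, ?_⟩
  calc ∫⁻ ω, g k ω ∂P
      ≤ ∫⁻ ω, ({ω | Q ω < c}.indicator (g k) ω
          + {ω | Q ω < c}ᶜ.indicator (fun ω => 4 * Q ω) ω) ∂P := by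
        refine lintegral_mono fun ω => ?_
        by_cases hω : ω ∈ {ω | Q ω < c}
        · rw [indicator_of_mem hω]
          exact le_self_add
        · rw [indicator_of_notMem hω, indicator_of_mem (by exact hω), zero_add]
          refine (hgle k ω).trans ?_
          have : (c : ℝ≥0∞) ≤ Q ω := not_lt.1 hω
          calc 2 * (c : ℝ≥0∞) + 2 * Q ω ≤ 2 * Q ω + 2 * Q ω := by gcongr
            _ = 4 * Q ω := by rw [← add_mul]; norm_num
    _ = ∫⁻ ω, {ω | Q ω < c}.indicator (g k) ω ∂P
          + ∫⁻ ω, {ω | Q ω < c}ᶜ.indicator (fun ω => 4 * Q ω) ω ∂P :=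
        lintegral_add_left ((hgm k).indicator (measurableSet_lt hQ measurable_const)) _
    _ ≤ ε / 2 + ε / 2 := add_le_add hk.le hc.le
    _ = ε := ENNReal.add_halves ε

end HasItoIntegral

/-! ### Isometry, orthogonality and duality with exponential martingales -/

section Duality

variable {Ω : Type*} {mΩ : MeasurableSpace Ω} {ℱ : Filtration ℝ mΩ} {P : Measure Ω}
  {d : ℕ} {T : ℝ} {W : ℝ → Ω → EuclideanSpace ℝ (Fin d)} {p q : ℝ}
  {H : ℝ → Ω → EuclideanSpace ℝ (Fin d)} {X : Ω → ℝ} [IsProbabilityMeasure P]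

theorem lintegral_prod_energy (hH : Measurable fun z : ℝ × Ω => H z.1 z.2) :
    ∫⁻ z, ‖H z.1 z.2‖ₑ ^ 2 ∂((volume.restrict (Icc p q)).prod P)
      = ∫⁻ ω, (∫⁻ u in Icc p q, ‖H u ω‖ₑ ^ 2) ∂P :=
  lintegral_prod_symm' _ (hH.enorm.pow_const 2)

namespace SimpleProcess

theorem memLp_eval (S : SimpleProcess ℱ p q d) :
    MemLp (fun z : ℝ × Ω => S.eval z.1 z.2) 2 ((volume.restrict (Icc p q)).prod P) := by
  obtain ⟨C, hC⟩ := S.exists_bound_eval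
  exact MemLp.of_bound S.measurable_eval.aestronglyMeasurable C
    (Eventually.of_forall fun z => hC _ _)

theorem integral_total_sq_eq (S : SimpleProcess ℱ p q d) (hW : IsBrownianMotion ℱ P T W)
    (hp : 0 ≤ p) (hq : q ≤ T) : ∫ ω, ‖S.total W ω‖ ^ 2 ∂P
      = ∫ z, ‖S.eval z.1 z.2‖ ^ 2 ∂((volume.restrict (Icc p q)).prod P) := by
  have h1 := ofReal_integral_norm_sq (S.memLp_total hW hp hq)
  have h2 := ofReal_integral_norm_sq (S.memLp_eval (P := P))
  rw [S.lintegral_total_sq hW hp hq, ← lintegral_prod_energy S.measurable_eval, ← h2] at h1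
  exact (ENNReal.ofReal_eq_ofReal_iff (integral_nonneg fun _ => sq_nonneg _)
    (integral_nonneg fun _ => sq_nonneg _)).1 h1

theorem setIntegral_inner (S : SimpleProcess ℱ p q d) (h : StepFn (EuclideanSpace ℝ (Fin d)))
    (ω : Ω) : ∫ u in Icc p q, ⟪S.eval u ω, h.eval u⟫
      = ∑ k ∈ Finset.range S.N, ∑ j, S.val k ω j *
        ∫ u in S.time k..S.time (k + 1), h.eval u j := by
  obtain ⟨C, hC⟩ := h.exists_bound_eval
  have hb : ∀ (v : EuclideanSpace ℝ (Fin d)) (s : Set ℝ), volume s ≠ ∞ →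
      IntegrableOn (fun u => ⟪v, h.eval u⟫) s := by
    intro v s hs
    have : IsFiniteMeasure (volume.restrict s) := isFiniteMeasure_restrict.2 hs
    refine Integrable.of_bound (h.measurable_eval.const_inner).aestronglyMeasurable (‖v‖ * C)
      (Eventually.of_forall fun u => ?_)
    exact (norm_inner_le_norm _ _).trans (mul_le_mul_of_nonneg_left (hC u) (norm_nonneg _))
  have e : ∀ u, ⟪S.eval u ω, h.eval u⟫ = ∑ k ∈ Finset.range S.N,
      (Ioc (S.time k) (S.time (k + 1))).indicator (fun u => ⟪S.val k ω, h.eval u⟫) u := fun u =>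
    (S.path ω).map_eval (fun u v => ⟪v, h.eval u⟫) (fun u => inner_zero_left _) u
  simp_rw [e]
  rw [integral_finsetSum _ fun k _ => (hb _ _ (by simp)).indicator measurableSet_Ioc]
  refine Finset.sum_congr rfl fun k hk => ?_
  have hk' := Finset.mem_range.1 hk
  have hsub : Ioc (S.time k) (S.time (k + 1)) ⊆ Icc p q := fun u hu =>
    ⟨(S.time_mem hk'.le).1.trans hu.1.le, hu.2.trans (S.time_mem hk').2⟩
  rw [setIntegral_indicator measurableSet_Ioc, inter_eq_right.2 hsub,
    ← intervalIntegral.integral_of_le (S.time_mono k.le_succ)]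
  simp_rw [inner_eq_sum]
  rw [intervalIntegral.integral_finsetSum]
  · simp_rw [intervalIntegral.integral_const_mul]
  · intro j _
    refine IntervalIntegrable.const_mul ?_ _
    have := hb (EuclideanSpace.single j 1) (Ioc (S.time k) (S.time (k + 1))) (by simp)
    simp only [EuclideanSpace.inner_single_left, map_one, one_mul] at this
    exact (intervalIntegrable_iff_integrableOn_Ioc_of_le (S.time_mono k.le_succ)).2 this

/-- Integration by parts for Brownian motion. For the k-th term the exponential is factored at the
ends of the k-th interval: the factor after it has conditional mean 1, the factor on it is treated
by `mul_inner_mul_dexp`, and the martingale property then restores the exponential over all of (p,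
q]. -/
theorem integral_total_mul_dexp (S : SimpleProcess ℱ p q d) (hW : IsBrownianMotion ℱ P T W)
    (hp : 0 ≤ p) (hq : q ≤ T) (h : StepFn (EuclideanSpace ℝ (Fin d))) (h0 : h.time 0 ≤ p)
    (hN : q ≤ h.time h.N) : ∫ ω, S.total W ω * h.dexp (fun u => W u ω) p q ∂P
      = ∫ z, ⟪S.eval z.1 z.2, h.dexp (fun u => W u z.2) p q • h.eval z.1⟫
        ∂((volume.restrict (Icc p q)).prod P) := by
  have hpq := S.le_of_simple
  obtain ⟨C, hC⟩ := S.bounded_val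
  have key : ∀ k ∈ Finset.range S.N, ∀ j,
      Integrable (fun ω => S.val k ω j * h.dexp (fun u => W u ω) p q) P ∧
      Integrable (fun ω => S.val k ω j * (W (S.time (k + 1)) ω - W (S.time k) ω) j
        * h.dexp (fun u => W u ω) p q) P ∧
      ∫ ω, S.val k ω j * (W (S.time (k + 1)) ω - W (S.time k) ω) j
        * h.dexp (fun u => W u ω) p q ∂P
        = (∫ ω, S.val k ω j * h.dexp (fun u => W u ω) p q ∂P)
          * ∫ u in S.time k..S.time (k + 1), h.eval u j := by
    intro k hk j
    have hk' := Finset.mem_range.1 hk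
    obtain ⟨a1, a2⟩ := S.time_mem hk'.le
    obtain ⟨b1, b2⟩ := S.time_mem hk'
    have hab := S.time_mono k.le_succ
    have hv := stronglyMeasurable_eval_apply (S.measurable_val k hk') j
    have hvb : ∀ ω, ‖S.val k ω j‖ ≤ C := fun ω =>
      (PiLp.norm_apply_le (S.val k ω) j).trans (hC k hk' ω)
    have hd := h.stronglyMeasurable_dexp hW hp a1 (a2.trans hq)
    have hdi : Integrable (fun ω => h.dexp (fun u => W u ω) p (S.time k)) P :=
      (h.dexp_sq hW hp a1 (a2.trans hq)).1.integrable (by norm_num)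
    have hξ := hv.mul hd
    have hξi : Integrable (fun ω => S.val k ω j * h.dexp (fun u => W u ω) p (S.time k)) P :=
      hdi.bdd_mul ((hv.mono (ℱ.le _)).aestronglyMeasurable) (Eventually.of_forall hvb)
    have hin := h.mul_inner_mul_dexp hW (hp.trans a1) hab (b2.trans hq) (h0.trans a1)
      (b2.trans hN) (EuclideanSpace.single j 1) hξ hξi
    simp only [EuclideanSpace.inner_single_left, map_one, one_mul, Pi.mul_apply] at hin
    have hζ : StronglyMeasurable[ℱ (S.time (k + 1))] (fun ω =>
        S.val k ω j * h.dexp (fun u => W u ω) p (S.time k)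
          * (W (S.time (k + 1)) ω - W (S.time k) ω) j
          * h.dexp (fun u => W u ω) (S.time k) (S.time (k + 1))) :=
      ((hξ.mono (ℱ.mono hab)).mul (stronglyMeasurable_eval_apply
        (hW.stronglyMeasurable_sub (hp.trans a1) hab le_rfl (b2.trans hq)) j)).mul
        (h.stronglyMeasurable_dexp hW (hp.trans a1) hab (b2.trans hq))
    have e1 : ∀ ω, S.val k ω j * (W (S.time (k + 1)) ω - W (S.time k) ω) j
        * h.dexp (fun u => W u ω) p q
        = S.val k ω j * h.dexp (fun u => W u ω) p (S.time k)
          * (W (S.time (k + 1)) ω - W (S.time k) ω) j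
          * h.dexp (fun u => W u ω) (S.time k) (S.time (k + 1))
          * h.dexp (fun u => W u ω) (S.time (k + 1)) q := by
      intro ω
      rw [← h.dexp_mul_dexp (fun u => W u ω) b1 b2, ← h.dexp_mul_dexp (fun u => W u ω) a1 hab]
      ring
    have e2 : ∀ ω, S.val k ω j * h.dexp (fun u => W u ω) p q
        = S.val k ω j * h.dexp (fun u => W u ω) p (S.time k)
          * h.dexp (fun u => W u ω) (S.time k) q := by
      intro ω
      rw [← h.dexp_mul_dexp (fun u => W u ω) a1 a2]
      ring
    simp_rw [e1, e2]
    refine ⟨h.integrable_mul_dexp hW (hp.trans a1) a2 hq hξ hξi,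
      h.integrable_mul_dexp hW (hp.trans b1) b2 hq hζ hin.1, ?_⟩
    rw [h.integral_mul_dexp hW (hp.trans b1) b2 hq hζ hin.1, hin.2]
    congr 1
    exact (h.integral_mul_dexp hW (hp.trans a1) a2 hq hξ hξi).symm
  have hdi : MemLp (fun ω => h.dexp (fun u => W u ω) p q) 2 P := (h.dexp_sq hW hp hpq hq).1
  obtain ⟨D, hD⟩ := h.exists_bound_eval
  have hint : Integrable (fun z : ℝ × Ω => ⟪S.eval z.1 z.2,
      h.dexp (fun u => W u z.2) p q • h.eval z.1⟫) ((volume.restrict (Icc p q)).prod P) := by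
    obtain ⟨B, hB⟩ := S.exists_bound_eval
    simp_rw [inner_smul_right, mul_comm (h.dexp _ _ _)]
    refine ((hdi.integrable (by norm_num)).comp_snd _).bdd_mul (c := B * D)
      (S.measurable_eval.inner (h.measurable_eval.comp measurable_fst)).aestronglyMeasurable
      (Eventually.of_forall fun z => ?_)
    exact (norm_inner_le_norm _ _).trans (mul_le_mul (hB _ _) (hD _) (norm_nonneg _)
      ((norm_nonneg _).trans (hB z.1 z.2)))
  have hL : ∀ ω, S.total W ω * h.dexp (fun u => W u ω) p q = ∑ k ∈ Finset.range S.N, ∑ j,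
      S.val k ω j * (W (S.time (k + 1)) ω - W (S.time k) ω) j
        * h.dexp (fun u => W u ω) p q := by
    intro ω
    simp_rw [total, inner_eq_sum, Finset.sum_mul]
  have hR : ∀ ω, ∫ u in Icc p q, ⟪S.eval u ω, h.dexp (fun u => W u ω) p q • h.eval u⟫
      = ∑ k ∈ Finset.range S.N, ∑ j, S.val k ω j * h.dexp (fun u => W u ω) p q
        * ∫ u in S.time k..S.time (k + 1), h.eval u j := by
    intro ω
    simp_rw [inner_smul_right]
    rw [integral_const_mul, S.setIntegral_inner, Finset.mul_sum]
    refine Finset.sum_congr rfl fun k _ => ?_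
    rw [Finset.mul_sum]
    exact Finset.sum_congr rfl fun j _ => by ring
  rw [integral_prod_symm _ hint]
  simp_rw [hL, hR]
  rw [integral_finsetSum _ fun k hk => integrable_finsetSum _ fun j _ => (key k hk j).2.1,
    integral_finsetSum _ fun k hk => integrable_finsetSum _ fun j _ =>
      ((key k hk j).1.mul_const _)]
  refine Finset.sum_congr rfl fun k hk => ?_
  rw [integral_finsetSum _ fun j _ => (key k hk j).2.1,
    integral_finsetSum _ fun j _ => ((key k hk j).1.mul_const _)]
  refine Finset.sum_congr rfl fun j _ => ?_
  rw [(key k hk j).2.2, integral_mul_const]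

end SimpleProcess

namespace HasItoIntegral

theorem memLp_integrand (hH : Measurable fun z : ℝ × Ω => H z.1 z.2)
    (hfin : ∫⁻ ω, (∫⁻ u in Icc p q, ‖H u ω‖ₑ ^ 2) ∂P ≠ ∞) :
    MemLp (fun z : ℝ × Ω => H z.1 z.2) 2 ((volume.restrict (Icc p q)).prod P) :=
  memLp_two_of_lintegral hH.aestronglyMeasurable (by rwa [lintegral_prod_energy hH])

theorem memLp (h : HasItoIntegral ℱ P W p q H X) (hW : IsBrownianMotion ℱ P T W) (hp : 0 ≤ p)
    (hq : q ≤ T) (hH : Measurable fun z : ℝ × Ω => H z.1 z.2)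
    (hfin : ∫⁻ ω, (∫⁻ u in Icc p q, ‖H u ω‖ₑ ^ 2) ∂P ≠ ∞) : MemLp X 2 P := by
  refine memLp_two_of_lintegral (h.aestronglyMeasurable hW hp hq) (ne_top_of_le_ne_top hfin
    (h.lintegral_sq_le hW hp hq hH ?_))
  exact (ae_lt_top (measurable_energy_of_measurable hH _) hfin).mono fun ω hω => hω.ne

/-- One sequence of simple processes that approximates the integrand and the integral in mean
square. Identities for simple processes thereby extend to `H` by continuity. -/
theorem exists_seq (h : HasItoIntegral ℱ P W p q H X) (hW : IsBrownianMotion ℱ P T W) (hp : 0 ≤ p)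
    (hq : q ≤ T) (hH : Measurable fun z : ℝ × Ω => H z.1 z.2)
    (hfin : ∫⁻ ω, (∫⁻ u in Icc p q, ‖H u ω‖ₑ ^ 2) ∂P ≠ ∞) :
    ∃ S : ℕ → SimpleProcess ℱ p q d,
      Tendsto (fun k => eLpNorm ((fun z : ℝ × Ω => (S k).eval z.1 z.2) - fun z => H z.1 z.2) 2
        ((volume.restrict (Icc p q)).prod P)) atTop (𝓝 0) ∧
      Tendsto (fun k => eLpNorm ((S k).total W - X) 2 P) atTop (𝓝 0) := by
  obtain ⟨ε, -, hε, hlim⟩ := exists_seq_strictAnti_tendsto' (show (0 : ℝ≥0∞) < 1 by norm_num)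
  choose S hS using fun k => h.exists_simple hH hfin (hε k).1
  have hm : ∀ k, Measurable fun z : ℝ × Ω => (S k).eval z.1 z.2 - H z.1 z.2 := fun k =>
    (S k).measurable_eval.sub hH
  refine ⟨S, tendsto_eLpNorm_two_iff.2 ?_, tendsto_eLpNorm_two_iff.2 ?_⟩
  · refine tendsto_of_tendsto_of_tendsto_of_le_of_le tendsto_const_nhds hlim (fun _ => zero_le)
      fun k => ?_
    exact (lintegral_prod_energy (H := fun u ω => (S k).eval u ω - H u ω) (hm k)).trans_le (hS k)
  · refine tendsto_of_tendsto_of_tendsto_of_le_of_le tendsto_const_nhds hlim (fun _ => zero_le)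
      fun k => ?_
    refine ((h.simple_sub (S k)).lintegral_sq_le hW hp hq (hm k) ?_).trans (hS k)
    exact (ae_lt_top (measurable_energy_of_measurable
      (H := fun u ω => (S k).eval u ω - H u ω) (hm k) _)
      (ne_top_of_le_ne_top (((hε k).2.trans ENNReal.one_lt_top).ne) (hS k))).mono fun ω hω => hω.ne

theorem integral_sq (h : HasItoIntegral ℱ P W p q H X) (hW : IsBrownianMotion ℱ P T W)
    (hp : 0 ≤ p) (hq : q ≤ T) (hH : Measurable fun z : ℝ × Ω => H z.1 z.2)
    (hfin : ∫⁻ ω, (∫⁻ u in Icc p q, ‖H u ω‖ₑ ^ 2) ∂P ≠ ∞) :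
    ∫ ω, X ω ^ 2 ∂P = ∫ z, ‖H z.1 z.2‖ ^ 2 ∂((volume.restrict (Icc p q)).prod P) := by
  obtain ⟨S, h1, h2⟩ := h.exists_seq hW hp hq hH hfin
  have t1 := tendsto_integral_inner (fun k => (S k).memLp_eval) (memLp_integrand hH hfin)
    (fun k => (S k).memLp_eval) (memLp_integrand hH hfin) h1 h1
  have t2 := tendsto_integral_inner (fun k => (S k).memLp_total hW hp hq)
    (h.memLp hW hp hq hH hfin) (fun k => (S k).memLp_total hW hp hq)
    (h.memLp hW hp hq hH hfin) h2 h2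
  simp_rw [real_inner_self_eq_norm_sq] at t1 t2
  simp_rw [(S _).integral_total_sq_eq hW hp hq] at t2
  rw [← tendsto_nhds_unique t2 t1]
  simp

theorem integral_mul_eq_zero (h : HasItoIntegral ℱ P W p q H X) (hW : IsBrownianMotion ℱ P T W)
    (hp : 0 ≤ p) (hq : q ≤ T) (hH : Measurable fun z : ℝ × Ω => H z.1 z.2)
    (hfin : ∫⁻ ω, (∫⁻ u in Icc p q, ‖H u ω‖ₑ ^ 2) ∂P ≠ ∞) {ξ : Ω → ℝ}
    (hξ : StronglyMeasurable[ℱ p] ξ) (hξ2 : MemLp ξ 2 P) : ∫ ω, ξ ω * X ω ∂P = 0 := by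
  obtain ⟨S, -, h2⟩ := h.exists_seq hW hp hq hH hfin
  have t := tendsto_integral_inner (fun _ => hξ2) hξ2 (fun k => (S k).memLp_total hW hp hq)
    (h.memLp hW hp hq hH hfin) (by simp) h2
  simp only [Real.inner_apply, (S _).integral_mul_total hW hp hq hξ hξ2] at t
  exact tendsto_nhds_unique t tendsto_const_nhds

theorem integral_mul_dexp (h : HasItoIntegral ℱ P W p q H X) (hW : IsBrownianMotion ℱ P T W)
    (hp : 0 ≤ p) (hpq : p ≤ q) (hq : q ≤ T) (hH : Measurable fun z : ℝ × Ω => H z.1 z.2)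
    (hfin : ∫⁻ ω, (∫⁻ u in Icc p q, ‖H u ω‖ₑ ^ 2) ∂P ≠ ∞)
    (g : StepFn (EuclideanSpace ℝ (Fin d))) (h0 : g.time 0 ≤ p) (hN : q ≤ g.time g.N) :
    ∫ ω, X ω * g.dexp (fun u => W u ω) p q ∂P
      = ∫ z, ⟪H z.1 z.2, g.dexp (fun u => W u z.2) p q • g.eval z.1⟫
        ∂((volume.restrict (Icc p q)).prod P) := by
  obtain ⟨S, h1, h2⟩ := h.exists_seq hW hp hq hH hfin
  have hd := (g.dexp_sq hW hp hpq hq).1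
  have hG : MemLp (fun z : ℝ × Ω => g.dexp (fun u => W u z.2) p q • g.eval z.1) 2
      ((volume.restrict (Icc p q)).prod P) := by
    obtain ⟨C, hC⟩ := g.exists_bound_eval
    refine (hd.comp_snd _).of_le_mul (c := C) ?_ (Eventually.of_forall fun z => ?_)
    · exact ((hd.comp_snd _).aestronglyMeasurable.smul
        (g.measurable_eval.comp measurable_fst).aestronglyMeasurable)
    · rw [norm_smul, mul_comm]
      exact mul_le_mul_of_nonneg_right (hC _) (norm_nonneg _)
  have t1 := tendsto_integral_inner (fun k => (S k).memLp_eval) (memLp_integrand hH hfin)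
    (fun _ => hG) hG h1 (by simp)
  have t2 := tendsto_integral_inner (fun k => (S k).memLp_total hW hp hq)
    (h.memLp hW hp hq hH hfin) (fun _ => hd) hd h2 (by simp)
  simp_rw [← (S _).integral_total_mul_dexp hW hp hq g h0 hN] at t1
  simp only [Real.inner_apply] at t2
  exact tendsto_nhds_unique t2 t1

end HasItoIntegral

end Duality

/-! ### Moments of scalar linear equations -/

/-- Cauchy–Schwarz for the measure f du, from the discriminant of the nonnegative quadratic x ↦ ∫ f
(g - x)². -/
theorem sq_integral_mul_le {f g : ℝ → ℝ} {a b : ℝ} (hab : a ≤ b) (hf : IntegrableOn f (Icc a b))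
    (hf0 : ∀ u, 0 ≤ f u) (hg : ContinuousOn g (Icc a b)) :
    (∫ u in a..b, f u * g u) ^ 2 ≤ (∫ u in a..b, f u) * ∫ u in a..b, f u * g u ^ 2 := by
  have hi : ∀ {r : ℝ → ℝ}, ContinuousOn r (Icc a b) →
      IntervalIntegrable (fun u => f u * r u) volume a b := fun hr =>
    (intervalIntegrable_iff_integrableOn_Icc_of_le hab).2 (hf.mul_continuousOn hr isCompact_Icc)
  have hf' : IntervalIntegrable f volume a b :=
    (intervalIntegrable_iff_integrableOn_Icc_of_le hab).2 hf
  have key : ∀ x : ℝ, 0 ≤ (∫ u in a..b, f u) * (x * x) + (-2 * ∫ u in a..b, f u * g u) * x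
      + ∫ u in a..b, f u * g u ^ 2 := by
    intro x
    have h0 : 0 ≤ ∫ u in a..b, (f u * (x * x) + f u * g u * (-2 * x) + f u * g u ^ 2) :=
      intervalIntegral.integral_nonneg hab fun u _ => by
        have := mul_nonneg (hf0 u) (sq_nonneg (g u - x))
        nlinarith
    rw [intervalIntegral.integral_add ((hf'.mul_const _).add ((hi hg).mul_const _)) (hi (r := fun u => g u ^ 2) (hg.pow 2)),
      intervalIntegral.integral_add (hf'.mul_const _) ((hi hg).mul_const _),
      intervalIntegral.integral_mul_const, intervalIntegral.integral_mul_const] at h0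
    linarith
  have := discrim_le_zero key
  unfold discrim at this
  nlinarith

/-- Cauchy–Schwarz puts the square of the forcing term inside the integral; the bound is then linear
in the squares and suited to Tonelli's theorem. -/
theorem sq_le_of_linear_equation {κ x c : ℝ → ℝ} {a b : ℝ} (hκ : IntegrableOn κ (Icc a b))
    (hx : ContinuousOn x (Icc a b)) (hc : ContinuousOn c (Icc a b))
    (h : ∀ s ∈ Icc a b, x s = c s + ∫ u in a..s, κ u * x u) :
    ∀ s ∈ Icc a b, x s ^ 2 ≤ 2 * c s ^ 2 + 2 * (2 * Real.exp (2 * ∫ u in a..b, |κ u|)) ^ 2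
      * (∫ u in a..b, |κ u|) * ∫ u in a..s, |κ u| * c u ^ 2 := by
  intro s hs
  have hsub : Icc a s ⊆ Icc a b := Icc_subset_Icc_right hs.2
  have h1 := abs_le_of_linear_equation hκ hx hc h s hs
  have h2 := sq_integral_mul_le hs.1 ((hκ.mono_set hsub).abs) (fun u => abs_nonneg _)
    (hc.mono hsub).abs
  simp_rw [sq_abs] at h2
  have h3 : ∫ u in a..s, |κ u| ≤ ∫ u in a..b, |κ u| :=
    intervalIntegral.integral_mono_interval le_rfl hs.1 hs.2
      (Eventually.of_forall fun u => abs_nonneg _)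
      ((intervalIntegrable_iff_integrableOn_Icc_of_le (hs.1.trans hs.2)).2 hκ.abs)
  have h4 : 0 ≤ ∫ u in a..s, |κ u| * c u ^ 2 :=
    intervalIntegral.integral_nonneg hs.1 fun u _ => by positivity
  have h5 : (∫ u in a..s, |κ u| * |c u|) ^ 2 ≤ (∫ u in a..b, |κ u|) * ∫ u in a..s, |κ u| * c u ^ 2 :=
    h2.trans (mul_le_mul_of_nonneg_right h3 h4)
  set K := 2 * Real.exp (2 * ∫ u in a..b, |κ u|)
  set J := ∫ u in a..s, |κ u| * |c u|
  calc x s ^ 2 = |x s| ^ 2 := (sq_abs _).symm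
    _ ≤ (|c s| + K * J) ^ 2 := by gcongr
    _ ≤ 2 * |c s| ^ 2 + 2 * (K ^ 2 * J ^ 2) := by nlinarith [sq_nonneg (|c s| - K * J)]
    _ ≤ 2 * c s ^ 2 + 2 * (K ^ 2 * ((∫ u in a..b, |κ u|) * ∫ u in a..s, |κ u| * c u ^ 2)) := by
        rw [sq_abs]; gcongr
    _ = _ := by ring

/-- The running integral of a nonnegative function, capped at `c`, is controlled by the part of the
integral which is accumulated before the level `c` is reached. -/
theorem min_lintegral_le {f : ℝ → ℝ≥0∞} (hf : Measurable f) {a b : ℝ}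
    (hfin : ∫⁻ u in Icc a b, f u ≠ ∞) (c : ℝ≥0∞) :
    min (∫⁻ u in Icc a b, f u) c
      ≤ ∫⁻ u in Icc a b, {u | ∫⁻ v in Icc a u, f v < c}.indicator f u := by
  set F : ℝ → ℝ≥0∞ := fun u => ∫⁻ v in Icc a u, f v with hF
  have hFmono : Monotone F := fun u v huv => lintegral_mono_set (Icc_subset_Icc_right huv)
  rcases lt_or_ge (F b) c with hlt | hge
  · refine (min_le_left _ _).trans (le_of_eq ?_)
    refine setLIntegral_congr_fun measurableSet_Icc fun u hu => ?_
    exact (indicator_of_mem (show u ∈ {u | F u < c} from (hFmono hu.2).trans_lt hlt) f).symm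
  rcases eq_or_ne c 0 with rfl | hc
  · simp
  have hab : a ≤ b := by
    by_contra hcon
    simp only [hF, Icc_eq_empty hcon, Measure.restrict_empty, lintegral_zero_measure] at hge
    exact hc (le_antisymm hge zero_le)
  have hcont : ContinuousOn F (Icc a b) := by
    have hi : IntegrableOn (fun u => (f u).toReal) (Icc a b) :=
      integrable_toReal_of_lintegral_ne_top hf.aemeasurable hfin
    have hae : ∀ᵐ u ∂(volume.restrict (Icc a b)), f u < ∞ := ae_lt_top hf hfin
    have h1 := ENNReal.continuous_ofReal.comp_continuousOn
      (intervalIntegral.continuousOn_primitive_Icc hi)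
    refine h1.congr fun u hu => ?_
    have hsub : Icc a u ⊆ Icc a b := Icc_subset_Icc_right hu.2
    have hae' : ∀ᵐ v ∂(volume.restrict (Icc a u)), f v < ∞ :=
      ae_mono (Measure.restrict_mono hsub le_rfl) hae
    simp only [Function.comp_apply]
    rw [integral_toReal hf.aemeasurable hae', ENNReal.ofReal_toReal]
    exact ne_top_of_le_ne_top hfin (lintegral_mono_set hsub)
  have hcomp : IsCompact {u ∈ Icc a b | c ≤ F u} := by
    have := hcont.preimage_isClosed_of_isClosed isClosed_Icc (isClosed_Ici (a := c))
    exact isCompact_Icc.of_isClosed_subset this inter_subset_left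
  -- The first time at which the running integral reaches c, which exists by continuity. Before it
  -- the indicator is 1, and the integral up to it is already at least c.
  obtain ⟨τ, hτ, hleast⟩ := hcomp.exists_isLeast ⟨b, ⟨hab, le_rfl⟩, hge⟩
  refine (min_le_right _ _).trans (hτ.2.trans ?_)
  calc F τ = ∫⁻ u in Ico a τ, f u := setLIntegral_congr Ico_ae_eq_Icc.symm
    _ = ∫⁻ u in Ico a τ, {u | F u < c}.indicator f u := by
        refine setLIntegral_congr_fun measurableSet_Ico fun u hu => ?_
        refine (indicator_of_mem (show u ∈ {u | F u < c} from ?_) f).symm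
        by_contra hcon
        exact absurd (hleast ⟨⟨hu.1, hu.2.le.trans hτ.1.2⟩, not_lt.1 hcon⟩) (not_le.2 hu.2)
    _ ≤ ∫⁻ u in Icc a b, {u | F u < c}.indicator f u :=
        lintegral_mono_set fun u hu => ⟨hu.1, hu.2.le.trans hτ.1.2⟩

/-! ### Scalar solutions and their noise -/

section Scalar

variable {Ω : Type*} {mΩ : MeasurableSpace Ω} {d : ℕ}

/-- Measurable coefficients with the integrability of the standing assumption. -/
structure IsCoefficient (μ : ℝ → ℝ) (σ : ℝ → EuclideanSpace ℝ (Fin d)) (T : ℝ) : Prop where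
  measurable_drift : Measurable μ
  measurable_vol : Measurable σ
  integrable_drift : IntegrableOn μ (Icc 0 T)
  integrable_vol : IntegrableOn (fun u => ‖σ u‖ ^ 2) (Icc 0 T)

/-- A solution with continuous paths minus its drift. -/
noncomputable def noise (μ : ℝ → ℝ) (t : ℝ) (Y : ℝ → Ω → ℝ) (s : ℝ) (ω : Ω) : ℝ :=
  Y s ω - ∫ u in t..s, μ u * Y u ω

/-- A solution of `dY = Y (μ ds + σ dW)` on `[t, T]` all of whose paths are continuous. -/
structure IsScalarSolution (ℱ : Filtration ℝ mΩ) (P : Measure Ω)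
    (W : ℝ → Ω → EuclideanSpace ℝ (Fin d)) (μ : ℝ → ℝ) (σ : ℝ → EuclideanSpace ℝ (Fin d))
    (T t y : ℝ) (Y : ℝ → Ω → ℝ) : Prop where
  measurable : ∀ s, Measurable (Y s)
  adapted : ∀ s ∈ Icc t T, StronglyMeasurable[ℱ s] (Y s)
  continuous : ∀ ω, Continuous fun s => Y s ω
  initial : ∀ᵐ ω ∂P, Y t ω = y
  ito : ∀ p q, t ≤ p → p ≤ q → q ≤ T → HasItoIntegral ℱ P W p q (fun u ω => Y u ω • σ u)
    (fun ω => noise μ t Y q ω - noise μ t Y p ω)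

variable {ℱ : Filtration ℝ mΩ} {P : Measure Ω} {W : ℝ → Ω → EuclideanSpace ℝ (Fin d)}
  {μ : ℝ → ℝ} {σ : ℝ → EuclideanSpace ℝ (Fin d)} {T t y : ℝ} {Y : ℝ → Ω → ℝ}

namespace IsCoefficient

theorem drift_on (hc : IsCoefficient μ σ T) {p q : ℝ} (hp : 0 ≤ p) (hq : q ≤ T) :
    IntegrableOn μ (Icc p q) := hc.integrable_drift.mono_set (Icc_subset_Icc hp hq)

theorem vol_on (hc : IsCoefficient μ σ T) {p q : ℝ} (hp : 0 ≤ p) (hq : q ≤ T) :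
    IntegrableOn (fun u => ‖σ u‖ ^ 2) (Icc p q) :=
  hc.integrable_vol.mono_set (Icc_subset_Icc hp hq)

theorem lintegral_vol (hc : IsCoefficient μ σ T) {p q : ℝ} (hp : 0 ≤ p) (hq : q ≤ T) :
    ∫⁻ u in Icc p q, ‖σ u‖ₑ ^ 2 ≠ ∞ := by
  have := (hc.vol_on hp hq).lintegral_lt_top
  refine ne_of_lt (lt_of_eq_of_lt (lintegral_congr fun u => ?_) this)
  rw [ENNReal.ofReal_pow (norm_nonneg _), ofReal_norm]

end IsCoefficient

namespace IsScalarSolution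

theorem measurable_uncurry (hY : IsScalarSolution ℱ P W μ σ T t y Y) :
    Measurable fun z : ℝ × Ω => Y z.1 z.2 :=
  measurable_uncurry_of_continuous_of_measurable hY.continuous hY.measurable

theorem measurable_integrand (hY : IsScalarSolution ℱ P W μ σ T t y Y) (hc : IsCoefficient μ σ T) :
    Measurable fun z : ℝ × Ω => Y z.1 z.2 • σ z.1 :=
  hY.measurable_uncurry.smul (hc.measurable_vol.comp measurable_fst)

theorem energy_ne_top (hY : IsScalarSolution ℱ P W μ σ T t y Y) (hc : IsCoefficient μ σ T)
    (ht : 0 ≤ t) {s : ℝ} (hs : s ≤ T) (ω : Ω) : ∫⁻ u in Icc t s, ‖Y u ω • σ u‖ₑ ^ 2 ≠ ∞ := by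
  obtain ⟨C, hC⟩ := isCompact_Icc.exists_bound_of_continuousOn
    (hY.continuous ω).continuousOn (s := Icc t s)
  have : ∫⁻ u in Icc t s, ‖Y u ω • σ u‖ₑ ^ 2
      ≤ ∫⁻ u in Icc t s, ENNReal.ofReal (C ^ 2) * ‖σ u‖ₑ ^ 2 := by
    refine setLIntegral_mono' measurableSet_Icc fun u hu => ?_
    rw [enorm_smul, mul_pow]
    gcongr
    rw [← ofReal_norm, ← ENNReal.ofReal_pow (norm_nonneg _)]
    exact ENNReal.ofReal_le_ofReal (pow_le_pow_left₀ (norm_nonneg _) (hC u hu) 2)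
  refine ne_top_of_le_ne_top ?_ this
  rw [lintegral_const_mul _ (hc.measurable_vol.enorm.pow_const 2)]
  exact ENNReal.mul_ne_top ENNReal.ofReal_ne_top (hc.lintegral_vol ht hs)

theorem continuousOn_noise (hY : IsScalarSolution ℱ P W μ σ T t y Y) (hc : IsCoefficient μ σ T)
    (ht : 0 ≤ t) (ω : Ω) : ContinuousOn (fun s => noise μ t Y s ω) (Icc t T) := by
  refine (hY.continuous ω).continuousOn.sub ?_
  rcases le_or_gt t T with h | h
  · have := intervalIntegral.continuousOn_primitive_interval (μ := volume) (a := t) (b := T)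
      (f := fun u => μ u * Y u ω) (by
        rw [uIcc_of_le h]
        exact (hc.drift_on ht le_rfl).mul_continuousOn (hY.continuous ω).continuousOn isCompact_Icc)
    rwa [uIcc_of_le h] at this
  · rw [Icc_eq_empty (not_le.2 h)]
    exact continuousOn_empty _

theorem measurable_noise (hY : IsScalarSolution ℱ P W μ σ T t y Y) (hc : IsCoefficient μ σ T)
    (s : ℝ) : Measurable (noise μ t Y s) := by
  refine (hY.measurable s).sub ?_
  have : StronglyMeasurable fun z : Ω × ℝ => μ z.2 * Y z.2 z.1 :=
    ((hc.measurable_drift.comp measurable_snd).mul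
      (hY.measurable_uncurry.comp measurable_swap)).stronglyMeasurable
  exact ((this.integral_prod_right' (ν := volume.restrict (Ioc t s))).sub
    (this.integral_prod_right' (ν := volume.restrict (Ioc s t)))).measurable

/-- A jointly measurable extension of the noise. -/
theorem measurable_noise_clamp (hY : IsScalarSolution ℱ P W μ σ T t y Y)
    (hc : IsCoefficient μ σ T) (ht : 0 ≤ t) (htT : t ≤ T) :
    Measurable fun z : ℝ × Ω => noise μ t Y (clamp t T z.1) z.2 := by
  refine measurable_uncurry_of_continuous_of_measurable
    (u := fun u ω => noise μ t Y (clamp t T u) ω) (fun ω => ?_)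
    fun u => hY.measurable_noise hc _
  refine (hY.continuousOn_noise hc ht ω).comp_continuous ?_ fun u => clamp_mem htT u
  unfold clamp
  fun_prop

variable [IsProbabilityMeasure P]

/-- A localized bound of the noise. -/
theorem lintegral_noise_le (hY : IsScalarSolution ℱ P W μ σ T t y Y) (hc : IsCoefficient μ σ T)
    (hW : IsBrownianMotion ℱ P T W) (ht : 0 ≤ t) {s : ℝ} (hs : s ∈ Icc t T) {c : ℝ} (hc0 : 0 ≤ c) :
    ∫⁻ ω, {ω | ∫⁻ u in Icc t s, ‖Y u ω • σ u‖ₑ ^ 2 < ENNReal.ofReal c}.indicator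
        (fun ω => ‖noise μ t Y s ω‖ₑ ^ 2) ω ∂P
      ≤ 2 * ENNReal.ofReal (y ^ 2)
        + 2 * ∫⁻ ω, min (∫⁻ u in Icc t s, ‖Y u ω • σ u‖ₑ ^ 2) (ENNReal.ofReal c) ∂P := by
  have h := (hY.ito t s le_rfl hs.1 hs.2).lintegral_indicator_sq_le hW ht hs.2
    (hY.measurable_integrand hc) hc0
  calc _ ≤ ∫⁻ ω, (2 * ENNReal.ofReal (y ^ 2)
        + 2 * {ω | ∫⁻ u in Icc t s, ‖Y u ω • σ u‖ₑ ^ 2 < ENNReal.ofReal c}.indicator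
        (fun ω => ‖noise μ t Y s ω - noise μ t Y t ω‖ₑ ^ 2) ω) ∂P := by
        refine lintegral_mono_ae ?_
        filter_upwards [hY.initial] with ω hω
        by_cases hA : ω ∈ {ω | ∫⁻ u in Icc t s, ‖Y u ω • σ u‖ₑ ^ 2 < ENNReal.ofReal c}
        · rw [indicator_of_mem hA, indicator_of_mem hA]
          have e : noise μ t Y t ω = y := by simp [noise, hω]
          -- The noise at time s is y plus the Itô integral over [t, s].
          have := HasItoIntegral.enorm_sub_sq_le y (-(noise μ t Y s ω - noise μ t Y t ω))
          rw [e, sub_neg_eq_add, add_sub_cancel, enorm_neg] at this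
          rw [e]
          refine this.trans (le_of_eq ?_)
          congr 2
          rw [← ofReal_norm, ← ENNReal.ofReal_pow (norm_nonneg _), Real.norm_eq_abs, sq_abs]
        · rw [indicator_of_notMem hA]
          exact zero_le
    _ = 2 * ENNReal.ofReal (y ^ 2) + 2 * ∫⁻ ω, {ω | ∫⁻ u in Icc t s, ‖Y u ω • σ u‖ₑ ^ 2
          < ENNReal.ofReal c}.indicator
        (fun ω => ‖noise μ t Y s ω - noise μ t Y t ω‖ₑ ^ 2) ω ∂P := by
        rw [lintegral_add_left measurable_const, lintegral_const, measure_univ, mul_one,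
          lintegral_const_mul' _ _ (by norm_num)]
    _ ≤ _ := by gcongr

end IsScalarSolution

end Scalar

/-! ### Square integrability of scalar solutions, by localization -/

section Moments

variable {Ω : Type*} {mΩ : MeasurableSpace Ω} {d : ℕ}
  {ℱ : Filtration ℝ mΩ} {P : Measure Ω} {W : ℝ → Ω → EuclideanSpace ℝ (Fin d)}
  {μ : ℝ → ℝ} {σ : ℝ → EuclideanSpace ℝ (Fin d)} {T t y : ℝ} {Y : ℝ → Ω → ℝ}

theorem measurable_running_energy {f : ℝ × Ω → ℝ≥0∞} (hf : Measurable f) (t : ℝ) :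
    Measurable fun z : ℝ × Ω => ∫⁻ v in Icc t z.1, f (v, z.2) := by
  have e : ∀ z : ℝ × Ω, ∫⁻ v in Icc t z.1, f (v, z.2)
      = ∫⁻ v, {x : (ℝ × Ω) × ℝ | x.2 ∈ Icc t x.1.1}.indicator
        (fun x => f (x.2, x.1.2)) (z, v) := by
    intro z
    rw [← lintegral_indicator measurableSet_Icc]
    rfl
  simp_rw [e]
  refine Measurable.lintegral_prod_right' (f := {x : (ℝ × Ω) × ℝ | x.2 ∈ Icc t x.1.1}.indicator
    (fun x => f (x.2, x.1.2))) (Measurable.indicator (by fun_prop) ?_)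
  exact (measurableSet_le measurable_const measurable_snd).inter
    (measurableSet_le measurable_snd (measurable_fst.comp measurable_fst))

theorem enorm_sq_eq_ofReal (x : ℝ) : ‖x‖ₑ ^ 2 = ENNReal.ofReal (x ^ 2) := by
  rw [← ofReal_norm, ← ENNReal.ofReal_pow (norm_nonneg _), Real.norm_eq_abs, sq_abs]

theorem ofReal_integral_Icc {f : ℝ → ℝ} {a b : ℝ} (hab : a ≤ b) (hf : IntegrableOn f (Icc a b))
    (hf0 : ∀ u, 0 ≤ f u) :
    ENNReal.ofReal (∫ u in a..b, f u) = ∫⁻ u in Icc a b, ENNReal.ofReal (f u) := by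
  rw [intervalIntegral.integral_of_le hab, ← integral_Icc_eq_integral_Ioc,
    ofReal_integral_eq_lintegral_ofReal hf (Eventually.of_forall hf0)]

namespace IsScalarSolution

/-- Pathwise, Y solves a linear equation with the noise as forcing term, so it is controlled by the
noise. The bound is stated in extended nonnegative reals because nothing is known to be integrable
yet. -/
theorem enorm_sq_le (hY : IsScalarSolution ℱ P W μ σ T t y Y) (hc : IsCoefficient μ σ T)
    (ht : 0 ≤ t) {s : ℝ} (hs : s ∈ Icc t T) (ω : Ω) :
    ‖Y s ω‖ₑ ^ 2 ≤ 2 * ‖noise μ t Y s ω‖ₑ ^ 2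
      + ENNReal.ofReal (2 * (2 * Real.exp (2 * ∫ u in t..T, |μ u|)) ^ 2 * ∫ u in t..T, |μ u|)
        * ∫⁻ u in Icc t s, ‖μ u‖ₑ * ‖noise μ t Y u ω‖ₑ ^ 2 := by
  have htT := hs.1.trans hs.2
  have h := sq_le_of_linear_equation (hc.drift_on ht le_rfl) (hY.continuous ω).continuousOn
    (hY.continuousOn_noise hc ht ω) (fun s _ => by simp [noise]) s hs
  have hsub : Icc t s ⊆ Icc t T := Icc_subset_Icc_right hs.2
  have hL : 0 ≤ ∫ u in t..T, |μ u| :=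
    intervalIntegral.integral_nonneg htT fun u _ => abs_nonneg _
  have hμa : IntegrableOn (fun u => |μ u|) (Icc t s) := (hc.drift_on ht hs.2).abs
  have hi : IntegrableOn (fun u => |μ u| * noise μ t Y u ω ^ 2) (Icc t s) :=
    hμa.mul_continuousOn
      (((hY.continuousOn_noise hc ht ω).mono hsub).pow 2) isCompact_Icc
  have e : ∫⁻ u in Icc t s, ‖μ u‖ₑ * ‖noise μ t Y u ω‖ₑ ^ 2
      = ENNReal.ofReal (∫ u in t..s, |μ u| * noise μ t Y u ω ^ 2) := by
    rw [ofReal_integral_Icc hs.1 hi fun u => by positivity]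
    refine lintegral_congr fun u => ?_
    rw [ENNReal.ofReal_mul (abs_nonneg _), enorm_sq_eq_ofReal, ← Real.norm_eq_abs, ofReal_norm]
  have h0 : 0 ≤ ∫ u in t..s, |μ u| * noise μ t Y u ω ^ 2 :=
    intervalIntegral.integral_nonneg hs.1 fun u _ => by positivity
  rw [e, enorm_sq_eq_ofReal, enorm_sq_eq_ofReal, ← ENNReal.ofReal_mul (by positivity),
    show (2 : ℝ≥0∞) = ENNReal.ofReal 2 by simp, ← ENNReal.ofReal_mul (by norm_num),
    ← ENNReal.ofReal_add (by positivity) (by positivity)]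
  exact ENNReal.ofReal_le_ofReal h

variable [IsProbabilityMeasure P]

/-- A localized bound of the second moments of a solution. -/
theorem exists_lintegral_le (hY : IsScalarSolution ℱ P W μ σ T t y Y) (hc : IsCoefficient μ σ T)
    (hW : IsBrownianMotion ℱ P T W) (ht : 0 ≤ t) (htT : t ≤ T) :
    ∃ D : ℝ, 0 ≤ D ∧ ∀ s ∈ Icc t T, ∀ c : ℝ, 0 ≤ c →
      ∫⁻ ω, {ω | ∫⁻ u in Icc t s, ‖Y u ω • σ u‖ₑ ^ 2 < ENNReal.ofReal c}.indicator
        (fun ω => ‖Y s ω‖ₑ ^ 2) ω ∂P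
      ≤ ENNReal.ofReal D * (ENNReal.ofReal (y ^ 2)
        + ∫⁻ ω, min (∫⁻ u in Icc t s, ‖Y u ω • σ u‖ₑ ^ 2) (ENNReal.ofReal c) ∂P) := by
  set L := ∫ u in t..T, |μ u| with hLdef
  have hL : 0 ≤ L := intervalIntegral.integral_nonneg htT fun u _ => abs_nonneg _
  set M := 2 * (2 * Real.exp (2 * L)) ^ 2 * L with hM
  have hM0 : 0 ≤ M := by positivity
  clear_value M
  refine ⟨2 * (2 + M * L), by positivity, fun s hs c hc0 => ?_⟩
  set Q : ℝ → Ω → ℝ≥0∞ := fun s ω => ∫⁻ u in Icc t s, ‖Y u ω • σ u‖ₑ ^ 2 with hQ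
  set A : ℝ → Set Ω := fun s => {ω | Q s ω < ENNReal.ofReal c} with hA
  set R : ℝ≥0∞ := 2 * ENNReal.ofReal (y ^ 2)
        + 2 * ∫⁻ ω, min (Q s ω) (ENNReal.ofReal c) ∂P with hR
  have hQmono : ∀ {u v} ω, u ≤ v → Q u ω ≤ Q v ω := fun ω huv =>
    lintegral_mono_set (Icc_subset_Icc_right huv)
  have hQm : ∀ s, Measurable (Q s) := fun s =>
    measurable_energy_of_measurable (hY.measurable_integrand hc) (Icc t s)
  have hAm : ∀ s, MeasurableSet (A s) := fun s => measurableSet_lt (hQm s) measurable_const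
  -- The energy increases with time, so `A s` is contained in the corresponding event at the earlier
  -- time u, and the localized bound at u applies on `A s`.
  have hN : ∀ u ∈ Icc t s, ∫⁻ ω, (A s).indicator (fun ω => ‖noise μ t Y u ω‖ₑ ^ 2) ω ∂P ≤ R := by
    intro u hu
    refine le_trans ?_ ((hY.lintegral_noise_le hc hW ht ⟨hu.1, hu.2.trans hs.2⟩ hc0).trans ?_)
    · refine lintegral_mono fun ω => indicator_le_indicator_of_subset ?_ (fun _ => zero_le) ω
      exact fun ω (hω : Q s ω < _) => (hQmono ω hu.2).trans_lt hω
    · rw [hR]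
      gcongr
      exact hQmono _ hu.2
  have hmj : Measurable fun z : ℝ × Ω => ‖μ z.1‖ₑ * (A s).indicator
      (fun ω => ‖noise μ t Y (clamp t T z.1) ω‖ₑ ^ 2) z.2 := by
    refine (hc.measurable_drift.comp measurable_fst).enorm.mul ?_
    exact ((hY.measurable_noise_clamp hc ht htT).enorm.pow_const 2).indicator
      (measurable_snd (hAm s))
  have hswap : ∫⁻ ω, (A s).indicator (fun ω => ∫⁻ u in Icc t s, ‖μ u‖ₑ * ‖noise μ t Y u ω‖ₑ ^ 2) ω ∂P
      ≤ ENNReal.ofReal L * R := by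
    calc ∫⁻ ω, (A s).indicator (fun ω => ∫⁻ u in Icc t s, ‖μ u‖ₑ * ‖noise μ t Y u ω‖ₑ ^ 2) ω ∂P
        = ∫⁻ ω, (∫⁻ u in Icc t s, ‖μ u‖ₑ * (A s).indicator
            (fun ω => ‖noise μ t Y (clamp t T u) ω‖ₑ ^ 2) ω) ∂P := by
          refine lintegral_congr fun ω => ?_
          by_cases hω : ω ∈ A s
          · simp_rw [indicator_of_mem hω]
            refine setLIntegral_congr_fun measurableSet_Icc fun u hu => ?_
            rw [clamp_of_mem ⟨hu.1, hu.2.trans hs.2⟩]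
          · simp_rw [indicator_of_notMem hω]
            simp
      _ = ∫⁻ u in Icc t s, (∫⁻ ω, ‖μ u‖ₑ * (A s).indicator
            (fun ω => ‖noise μ t Y (clamp t T u) ω‖ₑ ^ 2) ω ∂P) :=
          (lintegral_lintegral_swap (μ := volume.restrict (Icc t s))
            (f := fun u ω => ‖μ u‖ₑ * (A s).indicator
            (fun ω => ‖noise μ t Y (clamp t T u) ω‖ₑ ^ 2) ω) hmj.aemeasurable).symm
      _ ≤ ∫⁻ u in Icc t s, ‖μ u‖ₑ * R := by
          refine setLIntegral_mono' measurableSet_Icc fun u hu => ?_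
          rw [lintegral_const_mul' _ _ enorm_ne_top, clamp_of_mem ⟨hu.1, hu.2.trans hs.2⟩]
          gcongr
          exact hN u hu
      _ ≤ ∫⁻ u in Icc t T, ‖μ u‖ₑ * R := lintegral_mono_set (Icc_subset_Icc_right hs.2)
      _ = ENNReal.ofReal L * R := by
          rw [lintegral_mul_const _ hc.measurable_drift.enorm, hLdef,
            ofReal_integral_Icc htT (hc.drift_on ht le_rfl).abs fun u => abs_nonneg _]
          simp_rw [← Real.norm_eq_abs, ofReal_norm]
  calc ∫⁻ ω, (A s).indicator (fun ω => ‖Y s ω‖ₑ ^ 2) ω ∂P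
      ≤ ∫⁻ ω, (2 * (A s).indicator (fun ω => ‖noise μ t Y s ω‖ₑ ^ 2) ω + ENNReal.ofReal M *
          (A s).indicator (fun ω => ∫⁻ u in Icc t s, ‖μ u‖ₑ * ‖noise μ t Y u ω‖ₑ ^ 2) ω) ∂P := by
        refine lintegral_mono fun ω => ?_
        by_cases hω : ω ∈ A s
        · simp_rw [indicator_of_mem hω]
          rw [hM]
          exact hY.enorm_sq_le hc ht hs ω
        · simp_rw [indicator_of_notMem hω]
          exact zero_le
    _ = 2 * ∫⁻ ω, (A s).indicator (fun ω => ‖noise μ t Y s ω‖ₑ ^ 2) ω ∂P + ENNReal.ofReal M *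
          ∫⁻ ω, (A s).indicator (fun ω => ∫⁻ u in Icc t s, ‖μ u‖ₑ * ‖noise μ t Y u ω‖ₑ ^ 2) ω ∂P := by
        have hm1 : Measurable ((A s).indicator fun ω => ‖noise μ t Y s ω‖ₑ ^ 2) :=
          ((hY.measurable_noise hc s).enorm.pow_const 2).indicator (hAm s)
        rw [lintegral_add_left (hm1.const_mul 2), lintegral_const_mul' _ _ (by norm_num),
          lintegral_const_mul' _ _ ENNReal.ofReal_ne_top]
    _ ≤ 2 * R + ENNReal.ofReal M * (ENNReal.ofReal L * R) := by
        gcongr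
        exact hN s ⟨hs.1, le_rfl⟩
    _ = ENNReal.ofReal (2 * (2 + M * L)) * (ENNReal.ofReal (y ^ 2)
        + ∫⁻ ω, min (Q s ω) (ENNReal.ofReal c) ∂P) := by
        rw [hR, ← mul_add, ENNReal.ofReal_mul (by norm_num), ENNReal.ofReal_add (by norm_num)
          (by positivity), ENNReal.ofReal_mul hM0, ENNReal.ofReal_ofNat]
        ring

/-- After `min_lintegral_le` on each path and Tonelli's theorem, the indicator at time u involves
the energy up to u only. This is the form in which the localized bound on Y_u can be inserted and
the argument closed. -/
theorem capped_energy_le (hY : IsScalarSolution ℱ P W μ σ T t y Y) (hc : IsCoefficient μ σ T)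
    (ht : 0 ≤ t) {s : ℝ} (hs : s ≤ T) (c : ℝ≥0∞) :
    ∫⁻ ω, min (∫⁻ u in Icc t s, ‖Y u ω • σ u‖ₑ ^ 2) c ∂P
      ≤ ∫⁻ u in Icc t s, ‖σ u‖ₑ ^ 2 * ∫⁻ ω, {ω | ∫⁻ v in Icc t u, ‖Y v ω • σ v‖ₑ ^ 2 < c}.indicator
        (fun ω => ‖Y u ω‖ₑ ^ 2) ω ∂P := by
  have hf : Measurable fun z : ℝ × Ω => ‖Y z.1 z.2 • σ z.1‖ₑ ^ 2 :=
    (hY.measurable_integrand hc).enorm.pow_const 2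
  have hj : Measurable fun z : ℝ × Ω => {ω | ∫⁻ v in Icc t z.1, ‖Y v ω • σ v‖ₑ ^ 2 < c}.indicator
      (fun ω => ‖Y z.1 ω • σ z.1‖ₑ ^ 2) z.2 :=
    hf.indicator (measurableSet_lt (measurable_running_energy hf t) measurable_const)
  calc _ ≤ ∫⁻ ω, (∫⁻ u in Icc t s, {ω | ∫⁻ v in Icc t u, ‖Y v ω • σ v‖ₑ ^ 2 < c}.indicator
          (fun ω => ‖Y u ω • σ u‖ₑ ^ 2) ω) ∂P := by
        refine lintegral_mono fun ω => ?_
        exact min_lintegral_le (hf.comp (measurable_id.prodMk measurable_const))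
          (hY.energy_ne_top hc ht hs ω) c
    _ = ∫⁻ u in Icc t s, (∫⁻ ω, {ω | ∫⁻ v in Icc t u, ‖Y v ω • σ v‖ₑ ^ 2 < c}.indicator
          (fun ω => ‖Y u ω • σ u‖ₑ ^ 2) ω ∂P) :=
        (lintegral_lintegral_swap (μ := volume.restrict (Icc t s))
          (f := fun u ω => {ω | ∫⁻ v in Icc t u, ‖Y v ω • σ v‖ₑ ^ 2 < c}.indicator
          (fun ω => ‖Y u ω • σ u‖ₑ ^ 2) ω) hj.aemeasurable).symm
    _ = _ := by
        refine lintegral_congr fun u => ?_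
        rw [← lintegral_const_mul' _ _ (by simp)]
        refine lintegral_congr fun ω => ?_
        by_cases hω : ω ∈ {ω | ∫⁻ v in Icc t u, ‖Y v ω • σ v‖ₑ ^ 2 < c}
        · rw [indicator_of_mem hω, indicator_of_mem hω, enorm_smul, mul_pow, mul_comm]
        · rw [indicator_of_notMem hω, indicator_of_notMem hω, mul_zero]

/-- The capped energy of a solution is bounded uniformly in the cap. -/
theorem exists_capped_energy_bound (hY : IsScalarSolution ℱ P W μ σ T t y Y)
    (hc : IsCoefficient μ σ T) (hW : IsBrownianMotion ℱ P T W) (ht : 0 ≤ t) (htT : t ≤ T) :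
    ∃ B : ℝ, ∀ c : ℝ, 0 ≤ c →
      ∫⁻ ω, min (∫⁻ u in Icc t T, ‖Y u ω • σ u‖ₑ ^ 2) (ENNReal.ofReal c) ∂P ≤ ENNReal.ofReal B := by
  obtain ⟨D, hD, hbd⟩ := hY.exists_lintegral_le hc hW ht htT
  have hκ : IntegrableOn (fun u => D * ‖σ u‖ ^ 2) (Icc t T) := (hc.vol_on ht le_rfl).const_mul D
  set κ : ℝ → ℝ := fun u => D * ‖σ u‖ ^ 2 with hκdef
  have hκ0 : ∀ u, 0 ≤ κ u := fun u => by positivity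
  refine ⟨2 * (y ^ 2 * ∫ u in t..T, κ u) * Real.exp (2 * ∫ u in t..T, κ u), fun c hc0 => ?_⟩
  -- With κ = D‖σ‖² one gets G(s) ≤ ∫ κ (y² + G). The cap makes G bounded beforehand, as Grönwall's
  -- inequality requires, while the resulting bound does not involve c.
  set G : ℝ → ℝ≥0∞ := fun s =>
    ∫⁻ ω, min (∫⁻ u in Icc t s, ‖Y u ω • σ u‖ₑ ^ 2) (ENNReal.ofReal c) ∂P with hG
  have hGc : ∀ s, G s ≤ ENNReal.ofReal c := fun s =>
    (lintegral_mono fun ω => min_le_right _ _).trans (by simp)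
  have hGt : ∀ s, G s ≠ ∞ := fun s => ne_top_of_le_ne_top ENNReal.ofReal_ne_top (hGc s)
  have hGm : Monotone G := fun u v huv => lintegral_mono fun ω =>
    min_le_min_right _ (lintegral_mono_set (Icc_subset_Icc_right huv))
  have hgb : ∀ s, (G s).toReal ≤ c := fun s => ENNReal.toReal_le_of_le_ofReal hc0 (hGc s)
  have hgm : Measurable fun s => (G s).toReal := hGm.measurable.ennreal_toReal
  have hκg : IntegrableOn (fun u => κ u * (G u).toReal) (Icc t T) := by
    refine hκ.mul_bdd (c := c) hgm.aestronglyMeasurable (Eventually.of_forall fun u => ?_)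
    rw [Real.norm_of_nonneg ENNReal.toReal_nonneg]
    exact hgb u
  have hint : ∀ s ∈ Icc t T, (G s).toReal
      ≤ y ^ 2 * (∫ u in t..T, κ u) + ∫ u in t..s, κ u * (G u).toReal := by
    intro s hs
    have hsub : Icc t s ⊆ Icc t T := Icc_subset_Icc_right hs.2
    have hi1 : IntervalIntegrable κ volume t s :=
      (intervalIntegrable_iff_integrableOn_Icc_of_le hs.1).2 (hκ.mono_set hsub)
    have hi2 : IntervalIntegrable (fun u => κ u * (G u).toReal) volume t s :=
      (intervalIntegrable_iff_integrableOn_Icc_of_le hs.1).2 (hκg.mono_set hsub)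
    have h1 : G s ≤ ENNReal.ofReal (∫ u in t..s, (κ u * y ^ 2 + κ u * (G u).toReal)) := by
      rw [ofReal_integral_Icc (f := fun u => κ u * y ^ 2 + κ u * (G u).toReal) hs.1
        (((hκ.mono_set hsub).mul_const (y ^ 2)).fun_add (hκg.mono_set hsub))
        fun u => add_nonneg (mul_nonneg (hκ0 u) (sq_nonneg _))
          (mul_nonneg (hκ0 u) ENNReal.toReal_nonneg)]
      refine (hY.capped_energy_le hc ht hs.2 _).trans
        (setLIntegral_mono' measurableSet_Icc fun u hu => ?_)
      calc _ ≤ ‖σ u‖ₑ ^ 2 * (ENNReal.ofReal D * (ENNReal.ofReal (y ^ 2) + G u)) := by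
            gcongr
            exact hbd u ⟨hu.1, hu.2.trans hs.2⟩ c hc0
        _ = ENNReal.ofReal (κ u * y ^ 2 + κ u * (G u).toReal) := by
            rw [← mul_add, ENNReal.ofReal_mul (hκ0 u), hκdef, ENNReal.ofReal_mul hD,
              ENNReal.ofReal_add (sq_nonneg _) ENNReal.toReal_nonneg,
              ENNReal.ofReal_toReal (hGt u), ENNReal.ofReal_pow (norm_nonneg _), ofReal_norm]
            ring
    have h2 := ENNReal.toReal_le_of_le_ofReal (intervalIntegral.integral_nonneg hs.1 fun u _ =>
      add_nonneg (mul_nonneg (hκ0 u) (sq_nonneg _))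
          (mul_nonneg (hκ0 u) ENNReal.toReal_nonneg)) h1
    rw [intervalIntegral.integral_add (hi1.mul_const _) hi2,
      intervalIntegral.integral_mul_const] at h2
    have h3 : ∫ u in t..s, κ u ≤ ∫ u in t..T, κ u :=
      intervalIntegral.integral_mono_interval le_rfl hs.1 hs.2
        (Eventually.of_forall hκ0)
        ((intervalIntegrable_iff_integrableOn_Icc_of_le htT).2 hκ)
    nlinarith [sq_nonneg y]
  have := gronwall hκ (fun u _ => hκ0 u) (fun u _ => ENNReal.toReal_nonneg) (fun u _ => hgb u)
    hint T ⟨htT, le_rfl⟩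
  exact (ENNReal.le_ofReal_iff_toReal_le (hGt T) (ENNReal.toReal_nonneg.trans this)).2 this

/-- The uniform bound on the capped energies and Fatou's lemma as the cap tends to infinity. From
here on the L² theory applies to the solution without localization. -/
theorem lintegral_energy_ne_top (hY : IsScalarSolution ℱ P W μ σ T t y Y)
    (hc : IsCoefficient μ σ T) (hW : IsBrownianMotion ℱ P T W) (ht : 0 ≤ t) (htT : t ≤ T) :
    ∫⁻ ω, (∫⁻ u in Icc t T, ‖Y u ω • σ u‖ₑ ^ 2) ∂P ≠ ∞ := by
  obtain ⟨B, hB⟩ := hY.exists_capped_energy_bound hc hW ht htT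
  have hQm := measurable_energy_of_measurable (H := fun u ω => Y u ω • σ u) (hY.measurable_integrand hc) (Icc t T)
  refine ne_top_of_le_ne_top (ENNReal.ofReal_ne_top (r := B)) ?_
  calc _ ≤ ∫⁻ ω, liminf (fun n : ℕ => min (∫⁻ u in Icc t T, ‖Y u ω • σ u‖ₑ ^ 2)
          (ENNReal.ofReal n)) atTop ∂P := by
        refine lintegral_mono fun ω => ?_
        have h : Tendsto (fun n : ℕ => min (∫⁻ u in Icc t T, ‖Y u ω • σ u‖ₑ ^ 2)
            (ENNReal.ofReal n)) atTop (𝓝 (∫⁻ u in Icc t T, ‖Y u ω • σ u‖ₑ ^ 2)) := by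
          have := (tendsto_const_nhds (x := ∫⁻ u in Icc t T, ‖Y u ω • σ u‖ₑ ^ 2)).min
            ENNReal.tendsto_nat_nhds_top
          simpa using this
        rw [h.liminf_eq]
    _ ≤ liminf (fun n : ℕ => ∫⁻ ω, min (∫⁻ u in Icc t T, ‖Y u ω • σ u‖ₑ ^ 2)
          (ENNReal.ofReal n) ∂P) atTop :=
        lintegral_liminf_le fun n => hQm.min measurable_const
    _ ≤ liminf (fun _ : ℕ => ENNReal.ofReal B) atTop :=
        liminf_le_liminf (Eventually.of_forall fun n => hB n (Nat.cast_nonneg n))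
    _ = ENNReal.ofReal B := by simp

theorem lintegral_energy_ne_top' (hY : IsScalarSolution ℱ P W μ σ T t y Y)
    (hc : IsCoefficient μ σ T) (hW : IsBrownianMotion ℱ P T W) (ht : 0 ≤ t) (htT : t ≤ T)
    {p q : ℝ} (hp : t ≤ p) (hq : q ≤ T) :
    ∫⁻ ω, (∫⁻ u in Icc p q, ‖Y u ω • σ u‖ₑ ^ 2) ∂P ≠ ∞ :=
  ne_top_of_le_ne_top (hY.lintegral_energy_ne_top hc hW ht htT)
    (lintegral_mono fun _ => lintegral_mono_set (Icc_subset_Icc hp hq))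

/-- Solutions have bounded second moments. -/
theorem exists_sq_bound (hY : IsScalarSolution ℱ P W μ σ T t y Y)
    (hc : IsCoefficient μ σ T) (hW : IsBrownianMotion ℱ P T W) (ht : 0 ≤ t) (htT : t ≤ T) :
    ∃ C : ℝ, ∀ s ∈ Icc t T, MemLp (Y s) 2 P ∧ ∫ ω, Y s ω ^ 2 ∂P ≤ C := by
  obtain ⟨D, hD, hbd⟩ := hY.exists_lintegral_le hc hW ht htT
  set R : ℝ≥0∞ := ENNReal.ofReal D * (ENNReal.ofReal (y ^ 2)
        + ∫⁻ ω, (∫⁻ u in Icc t T, ‖Y u ω • σ u‖ₑ ^ 2) ∂P) with hRdef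
  have hR : R ≠ ∞ := ENNReal.mul_ne_top ENNReal.ofReal_ne_top
    (ENNReal.add_ne_top.2 ⟨ENNReal.ofReal_ne_top, hY.lintegral_energy_ne_top hc hW ht htT⟩)
  have key : ∀ s ∈ Icc t T, ∫⁻ ω, ‖Y s ω‖ₑ ^ 2 ∂P ≤ R := by
    intro s hs
    have hQm := measurable_energy_of_measurable (H := fun u ω => Y u ω • σ u) (hY.measurable_integrand hc) (Icc t s)
    calc ∫⁻ ω, ‖Y s ω‖ₑ ^ 2 ∂P
        ≤ ∫⁻ ω, liminf (fun n : ℕ => {ω | ∫⁻ u in Icc t s, ‖Y u ω • σ u‖ₑ ^ 2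
            < ENNReal.ofReal n}.indicator (fun ω => ‖Y s ω‖ₑ ^ 2) ω) atTop ∂P := by
          refine lintegral_mono fun ω => ?_
          have : Tendsto (fun n : ℕ => {ω | ∫⁻ u in Icc t s, ‖Y u ω • σ u‖ₑ ^ 2
            < ENNReal.ofReal n}.indicator (fun ω => ‖Y s ω‖ₑ ^ 2) ω) atTop
              (𝓝 (‖Y s ω‖ₑ ^ 2)) := by
            obtain ⟨N, hN⟩ := ENNReal.exists_nat_gt (hY.energy_ne_top hc ht hs.2 ω)
            refine tendsto_const_nhds.congr' (eventually_atTop.2 ⟨N, fun k hk => ?_⟩)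
            dsimp only
            rw [indicator_of_mem]
            simp only [mem_ofPred_eq, ENNReal.ofReal_natCast]
            exact hN.trans_le (by exact_mod_cast hk)
          rw [this.liminf_eq]
      _ ≤ liminf (fun n : ℕ => ∫⁻ ω, {ω | ∫⁻ u in Icc t s, ‖Y u ω • σ u‖ₑ ^ 2
            < ENNReal.ofReal n}.indicator (fun ω => ‖Y s ω‖ₑ ^ 2) ω ∂P) atTop :=
          lintegral_liminf_le fun n => ((hY.measurable s).enorm.pow_const 2).indicator
            (measurableSet_lt hQm measurable_const)
      _ ≤ liminf (fun _ : ℕ => R) atTop := by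
          refine liminf_le_liminf (Eventually.of_forall fun n => ?_)
          refine (hbd s hs n (Nat.cast_nonneg n)).trans ?_
          rw [hRdef]
          gcongr
          exact (min_le_left _ _).trans (lintegral_mono_set (Icc_subset_Icc_right hs.2))
      _ = R := by simp
  refine ⟨R.toReal, fun s hs => ?_⟩
  have hm : MemLp (Y s) 2 P := memLp_two_of_lintegral (hY.measurable s).aestronglyMeasurable
    (ne_top_of_le_ne_top hR (key s hs))
  refine ⟨hm, ?_⟩
  have h1 := ofReal_integral_norm_sq hm
  simp only [Real.norm_eq_abs, sq_abs] at h1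
  refine (ENNReal.ofReal_le_iff_le_toReal hR).1 ?_
  rw [h1]
  exact key s hs

end IsScalarSolution

end Moments

/-! ### The solution as a Doléans exponential -/

section Exponential

variable {Ω : Type*} {mΩ : MeasurableSpace Ω} {d : ℕ}
  {ℱ : Filtration ℝ mΩ} {P : Measure Ω} {W : ℝ → Ω → EuclideanSpace ℝ (Fin d)}
  {μ : ℝ → ℝ} {σ : ℝ → EuclideanSpace ℝ (Fin d)} {T t y : ℝ} {Y : ℝ → Ω → ℝ}

theorem integral_abs_mul_le {f g : Ω → ℝ} (hf : MemLp f 2 P) (hg : MemLp g 2 P) :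
    ∫ ω, |f ω * g ω| ∂P ≤ ∫ ω, f ω ^ 2 ∂P + ∫ ω, g ω ^ 2 ∂P := by
  rw [← integral_add hf.integrable_sq hg.integrable_sq]
  refine integral_mono (hf.integrable_mul hg).abs (hf.integrable_sq.add hg.integrable_sq)
    fun ω => ?_
  simp only [abs_mul]
  nlinarith [sq_nonneg (|f ω| - |g ω|), sq_abs (f ω), sq_abs (g ω), sq_nonneg (f ω),
    sq_nonneg (g ω)]

theorem integral_swap [IsProbabilityMeasure P] {m : ℝ → ℝ} (hm : Measurable m) {a b C : ℝ}
    (hab : a ≤ b) (hmi : IntegrableOn m (Icc a b)) {Φ : ℝ → Ω → ℝ}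
    (hΦ : Measurable fun z : ℝ × Ω => Φ z.1 z.2) (hi : ∀ u ∈ Icc a b, Integrable (Φ u) P)
    (hC : ∀ u ∈ Icc a b, ∫ ω, |Φ u ω| ∂P ≤ C) :
    Integrable (fun z : ℝ × Ω => m z.1 * Φ z.1 z.2) ((volume.restrict (Icc a b)).prod P) ∧
    IntervalIntegrable (fun u => m u * ∫ ω, Φ u ω ∂P) volume a b ∧
    ∫ ω, (∫ u in a..b, m u * Φ u ω) ∂P = ∫ u in a..b, m u * ∫ ω, Φ u ω ∂P := by
  have hmeas : Measurable fun z : ℝ × Ω => m z.1 * Φ z.1 z.2 := (hm.comp measurable_fst).mul hΦ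
  have hI : Integrable (fun z : ℝ × Ω => m z.1 * Φ z.1 z.2)
      ((volume.restrict (Icc a b)).prod P) := by
    rw [integrable_prod_iff hmeas.aestronglyMeasurable]
    refine ⟨(ae_restrict_iff' measurableSet_Icc).2 (Eventually.of_forall fun u hu =>
      (hi u hu).const_mul (m u)), ?_⟩
    refine (hmi.abs.mul_const C).mono'
      (hmeas.norm.stronglyMeasurable.integral_prod_right').aestronglyMeasurable
      ((ae_restrict_iff' measurableSet_Icc).2 (Eventually.of_forall fun u hu => ?_))
    rw [Real.norm_of_nonneg (integral_nonneg fun _ => norm_nonneg _)]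
    simp_rw [norm_mul, Real.norm_eq_abs, integral_const_mul]
    exact mul_le_mul_of_nonneg_left (hC u hu) (abs_nonneg _)
  refine ⟨hI, ?_, ?_⟩
  · rw [intervalIntegrable_iff_integrableOn_Icc_of_le hab]
    have := hI.integral_prod_left
    simp_rw [integral_const_mul] at this
    exact this
  · have h1 := integral_prod_symm _ hI
    rw [integral_prod _ hI] at h1
    simp_rw [intervalIntegral.integral_of_le hab, ← integral_Icc_eq_integral_Ioc]
    rw [← h1]
    simp_rw [integral_const_mul]

namespace IsScalarSolution

theorem intervalIntegrable_drift (hY : IsScalarSolution ℱ P W μ σ T t y Y)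
    (hc : IsCoefficient μ σ T) (ht : 0 ≤ t) {r : ℝ} (hr : r ∈ Icc t T) (ω : Ω) :
    IntervalIntegrable (fun u => μ u * Y u ω) volume t r :=
  (intervalIntegrable_iff_integrableOn_Icc_of_le hr.1).2
    ((hc.drift_on ht hr.2).mul_continuousOn (hY.continuous ω).continuousOn isCompact_Icc)

variable [IsProbabilityMeasure P]

theorem memLp_noise_sub (hY : IsScalarSolution ℱ P W μ σ T t y Y) (hc : IsCoefficient μ σ T)
    (hW : IsBrownianMotion ℱ P T W) (ht : 0 ≤ t) {p q : ℝ} (hp : t ≤ p) (hpq : p ≤ q)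
    (hq : q ≤ T) : MemLp (fun ω => noise μ t Y q ω - noise μ t Y p ω) 2 P :=
  (hY.ito p q hp hpq hq).memLp hW (ht.trans hp) hq (hY.measurable_integrand hc)
    (hY.lintegral_energy_ne_top' hc hW ht (hp.trans (hpq.trans hq)) hp hq)

theorem noise_initial (μ : ℝ → ℝ) (t : ℝ) (Y : ℝ → Ω → ℝ) : noise μ t Y t = Y t := by
  ext ω
  simp [noise]

theorem memLp_initial (hY : IsScalarSolution ℱ P W μ σ T t y Y) : MemLp (Y t) 2 P :=
  (memLp_congr_ae hY.initial).2 (memLp_const y)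

theorem integral_noise_sub_sq (hY : IsScalarSolution ℱ P W μ σ T t y Y)
    (hc : IsCoefficient μ σ T) (hW : IsBrownianMotion ℱ P T W) (ht : 0 ≤ t) {r : ℝ}
    (hr : r ∈ Icc t T) : ∫ ω, (noise μ t Y r ω - noise μ t Y t ω) ^ 2 ∂P
      = ∫ u in t..r, ‖σ u‖ ^ 2 * ∫ ω, Y u ω ^ 2 ∂P := by
  have hfin := hY.lintegral_energy_ne_top' hc hW ht (hr.1.trans hr.2) le_rfl hr.2
  rw [(hY.ito t r le_rfl hr.1 hr.2).integral_sq hW ht hr.2 (hY.measurable_integrand hc) hfin,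
    integral_prod _ (HasItoIntegral.memLp_integrand (H := fun u ω => Y u ω • σ u)
      (hY.measurable_integrand hc) hfin).norm.integrable_sq,
    intervalIntegral.integral_of_le hr.1, ← integral_Icc_eq_integral_Ioc]
  refine integral_congr_ae (Eventually.of_forall fun u => ?_)
  simp only [norm_smul, mul_pow, Real.norm_eq_abs, sq_abs]
  rw [integral_mul_const, mul_comm]

theorem exists_noise_bound (hY : IsScalarSolution ℱ P W μ σ T t y Y)
    (hc : IsCoefficient μ σ T) (hW : IsBrownianMotion ℱ P T W) (ht : 0 ≤ t) (htT : t ≤ T) :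
    ∃ C : ℝ, ∀ s ∈ Icc t T, MemLp (noise μ t Y s) 2 P ∧ ∫ ω, noise μ t Y s ω ^ 2 ∂P ≤ C := by
  obtain ⟨C, hC⟩ := hY.exists_sq_bound hc hW ht htT
  have hm : ∀ s ∈ Icc t T, MemLp (noise μ t Y s) 2 P := by
    intro s hs
    have := (hY.memLp_noise_sub hc hW ht le_rfl hs.1 hs.2).add hY.memLp_initial
    refine (memLp_congr_ae (Eventually.of_forall fun ω => ?_)).1 this
    simp [noise_initial]
  refine ⟨2 * (∫ u in t..T, ‖σ u‖ ^ 2 * C) + 2 * C, fun s hs => ⟨hm s hs, ?_⟩⟩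
  have h1 := hY.integral_noise_sub_sq hc hW ht hs
  have h2 : ∫ u in t..s, ‖σ u‖ ^ 2 * ∫ ω, Y u ω ^ 2 ∂P ≤ ∫ u in t..T, ‖σ u‖ ^ 2 * C := by
    have hi : ∀ s ∈ Icc t T, IntervalIntegrable (fun u => ‖σ u‖ ^ 2 * C) volume t s := fun s hs =>
      (intervalIntegrable_iff_integrableOn_Icc_of_le hs.1).2 ((hc.vol_on ht hs.2).mul_const C)
    have hC0 : 0 ≤ C := (integral_nonneg fun _ => sq_nonneg _).trans (hC s hs).2
    refine le_trans ?_ (intervalIntegral.integral_mono_interval le_rfl hs.1 hs.2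
      (Eventually.of_forall fun u => by positivity) (hi T ⟨htT, le_rfl⟩))
    have hmb : Measurable fun u => ∫ ω, Y u ω ^ 2 ∂P :=
      ((hY.measurable_uncurry.pow_const 2).stronglyMeasurable.integral_prod_right').measurable
    refine intervalIntegral.integral_mono_on hs.1 ?_ (hi s hs) fun u hu =>
      mul_le_mul_of_nonneg_left (hC u ⟨hu.1, hu.2.trans hs.2⟩).2 (sq_nonneg _)
    refine (hi s hs).mono_fun
      (((hc.measurable_vol.norm.pow_const 2).mul hmb).aestronglyMeasurable) ?_
    rw [uIoc_of_le hs.1]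
    refine (ae_restrict_iff' measurableSet_Ioc).2 (Eventually.of_forall fun u hu => ?_)
    dsimp only
    rw [Real.norm_of_nonneg (mul_nonneg (sq_nonneg _) (integral_nonneg fun _ => sq_nonneg _)),
      Real.norm_of_nonneg (mul_nonneg (sq_nonneg _) hC0)]
    exact mul_le_mul_of_nonneg_left (hC u ⟨hu.1.le, hu.2.trans hs.2⟩).2 (sq_nonneg _)
  have h3 := hC t ⟨le_rfl, htT⟩
  have hX := hY.memLp_noise_sub hc hW ht le_rfl hs.1 hs.2
  calc ∫ ω, noise μ t Y s ω ^ 2 ∂P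
      ≤ ∫ ω, (2 * (noise μ t Y s ω - noise μ t Y t ω) ^ 2 + 2 * Y t ω ^ 2) ∂P := by
        refine integral_mono (hm s hs).integrable_sq
          ((hX.integrable_sq.const_mul 2).add (h3.1.integrable_sq.const_mul 2)) fun ω => ?_
        simp only [noise_initial]
        nlinarith [sq_nonneg (noise μ t Y s ω - Y t ω - Y t ω)]
    _ = 2 * ∫ ω, (noise μ t Y s ω - noise μ t Y t ω) ^ 2 ∂P + 2 * ∫ ω, Y t ω ^ 2 ∂P := by
        rw [integral_add (hX.integrable_sq.const_mul 2) (h3.1.integrable_sq.const_mul 2),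
          integral_const_mul, integral_const_mul]
    _ ≤ _ := by linarith [h3.2]

/-- The second moment of a solution. -/
theorem integral_sq_eq (hY : IsScalarSolution ℱ P W μ σ T t y Y)
    (hc : IsCoefficient μ σ T) (hW : IsBrownianMotion ℱ P T W) (ht : 0 ≤ t) {r : ℝ}
    (hr : r ∈ Icc t T) :
    ∫ ω, Y r ω ^ 2 ∂P = y ^ 2 * Real.exp (∫ u in t..r, (2 * μ u + ‖σ u‖ ^ 2)) := by
  have htT := hr.1.trans hr.2
  obtain ⟨C, hC⟩ := hY.exists_sq_bound hc hW ht htT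
  obtain ⟨C', hC'⟩ := hY.exists_noise_bound hc hW ht htT
  have hmb : Measurable fun u => ∫ ω, Y u ω ^ 2 ∂P :=
    ((hY.measurable_uncurry.pow_const 2).stronglyMeasurable.integral_prod_right').measurable
  have hb : ∀ u ∈ Icc t T, |∫ ω, Y u ω ^ 2 ∂P| ≤ C := fun u hu => by
    rw [abs_of_nonneg (integral_nonneg fun _ => sq_nonneg _)]
    exact (hC u hu).2
  -- It remains to show E Y_r² = y² + ∫(2μ + ‖σ‖²) E Y_u² du, Itô's formula for Y² in the mean.
  -- Write Y = N + D with noise N and drift integral D: E N² comes from the isometry, E[N D] from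
  -- orthogonality of the noise increments and E D² from `sq_integral_eq`.
  refine eq_mul_exp_integral (((hc.drift_on ht le_rfl).const_mul 2).fun_add (hc.vol_on ht le_rfl))
    hmb.aestronglyMeasurable hb (fun r hr => ?_) r hr
  have hsub : Icc t r ⊆ Icc t T := Icc_subset_Icc_right hr.2
  have hN := hC' r hr
  have hNm := hN.1
  set D : ℝ → Ω → ℝ := fun u ω => ∫ v in t..u, μ v * Y v ω with hD
  have hYD : ∀ u ω, Y u ω = noise μ t Y u ω + D u ω := fun u ω => by simp [noise, hD]
  have hDm : ∀ u ∈ Icc t T, MemLp (D u) 2 P := fun u hu => by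
    refine (memLp_congr_ae (Eventually.of_forall fun ω => ?_)).1 ((hC u hu).1.sub (hC' u hu).1)
    simp [noise, hD]
  have hDb : ∀ u ∈ Icc t T, ∫ ω, D u ω ^ 2 ∂P ≤ 2 * C + 2 * C' := by
    intro u hu
    have h1 := hC u hu
    have h2 := hC' u hu
    calc ∫ ω, D u ω ^ 2 ∂P ≤ ∫ ω, (2 * Y u ω ^ 2 + 2 * noise μ t Y u ω ^ 2) ∂P := by
          refine integral_mono (hDm u hu).integrable_sq
            ((h1.1.integrable_sq.const_mul 2).add (h2.1.integrable_sq.const_mul 2)) fun ω => ?_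
          simp only [hYD u ω]
          nlinarith [sq_nonneg (noise μ t Y u ω + noise μ t Y u ω + D u ω)]
      _ = 2 * ∫ ω, Y u ω ^ 2 ∂P + 2 * ∫ ω, noise μ t Y u ω ^ 2 ∂P := by
          rw [integral_add (h1.1.integrable_sq.const_mul 2) (h2.1.integrable_sq.const_mul 2),
            integral_const_mul, integral_const_mul]
      _ ≤ _ := by linarith [h1.2, h2.2]
  -- the drift against itself
  have hdd := integral_swap (P := P) hc.measurable_drift hr.1 (hc.drift_on ht hr.2)
    (Φ := fun u ω => Y u ω * (Y u ω - noise μ t Y (clamp t T u) ω)) (C := C + (2 * C + 2 * C'))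
    (hY.measurable_uncurry.mul
      (hY.measurable_uncurry.sub (hY.measurable_noise_clamp hc ht htT)))
    (fun u hu => by
      rw [clamp_of_mem (hsub hu)]
      exact (hC u (hsub hu)).1.integrable_mul ((hC u (hsub hu)).1.sub (hC' u (hsub hu)).1))
    (fun u hu => by
      rw [clamp_of_mem (hsub hu)]
      refine (integral_abs_mul_le (hC u (hsub hu)).1
        ((hC u (hsub hu)).1.sub (hC' u (hsub hu)).1)).trans (add_le_add (hC u (hsub hu)).2 ?_)
      refine le_trans (le_of_eq (integral_congr_ae (Eventually.of_forall fun ω => ?_)))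
        (hDb u (hsub hu))
      simp [noise, hD])
  have hD2 : ∫ ω, D r ω ^ 2 ∂P = 2 * ∫ u in t..r, μ u * ∫ ω,
      Y u ω * (Y u ω - noise μ t Y (clamp t T u) ω) ∂P := by
    rw [← hdd.2.2, ← integral_const_mul]
    refine integral_congr_ae (Eventually.of_forall fun ω => ?_)
    simp only [hD]
    rw [sq_integral_eq (hY.intervalIntegrable_drift hc ht hr ω)]
    congr 1
    refine intervalIntegral.integral_congr fun u hu => ?_
    rw [uIcc_of_le hr.1] at hu
    simp only [clamp_of_mem (hsub hu), noise]
    ring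
  -- the drift against the noise
  have hdn := integral_swap (P := P) hc.measurable_drift hr.1 (hc.drift_on ht hr.2)
    (Φ := fun u ω => Y u ω * noise μ t Y r ω) (C := C + C')
    (hY.measurable_uncurry.mul ((hY.measurable_noise hc r).comp measurable_snd))
    (fun u hu => (hC u (hsub hu)).1.integrable_mul hNm)
    (fun u hu => (integral_abs_mul_le (hC u (hsub hu)).1 hNm).trans
      (add_le_add (hC u (hsub hu)).2 hN.2))
  -- N_r - N_u is the Itô integral over [u, r], hence orthogonal to the ℱ_u-measurable Y_u. The
  -- clamp does nothing on [t, T]; it only provides joint measurability.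
  have horth : ∀ u ∈ Icc t r, ∫ ω, Y u ω * noise μ t Y r ω ∂P
      = ∫ ω, Y u ω * noise μ t Y (clamp t T u) ω ∂P := by
    intro u hu
    rw [clamp_of_mem (hsub hu)]
    have h0 := (hY.ito u r hu.1 hu.2 hr.2).integral_mul_eq_zero hW (ht.trans hu.1) hr.2
      (hY.measurable_integrand hc) (hY.lintegral_energy_ne_top' hc hW ht htT hu.1 hr.2)
      (hY.adapted u (hsub hu)) (hC u (hsub hu)).1
    simp_rw [mul_sub] at h0
    have i1 : Integrable (fun ω => Y u ω * noise μ t Y r ω) P :=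
      (hC u (hsub hu)).1.integrable_mul hNm
    have i2 : Integrable (fun ω => Y u ω * noise μ t Y u ω) P :=
      (hC u (hsub hu)).1.integrable_mul (hC' u (hsub hu)).1
    rw [integral_sub i1 i2] at h0
    linarith
  have hND : ∫ ω, noise μ t Y r ω * D r ω ∂P = ∫ u in t..r, μ u * ∫ ω,
      Y u ω * noise μ t Y (clamp t T u) ω ∂P := by
    have e : ∫ ω, noise μ t Y r ω * D r ω ∂P
        = ∫ ω, (∫ u in t..r, μ u * (Y u ω * noise μ t Y r ω)) ∂P := by
      refine integral_congr_ae (Eventually.of_forall fun ω => ?_)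
      simp only [hD]
      rw [← intervalIntegral.integral_const_mul]
      refine intervalIntegral.integral_congr fun u _ => ?_
      ring
    rw [e, hdn.2.2]
    refine intervalIntegral.integral_congr fun u hu => ?_
    rw [uIcc_of_le hr.1] at hu
    simp only [horth u hu]
  have hNN : ∫ ω, noise μ t Y r ω ^ 2 ∂P
      = y ^ 2 + ∫ u in t..r, ‖σ u‖ ^ 2 * ∫ ω, Y u ω ^ 2 ∂P := by
    have hX := hY.memLp_noise_sub hc hW ht le_rfl hr.1 hr.2
    have h0 := (hY.ito t r le_rfl hr.1 hr.2).integral_mul_eq_zero hW ht hr.2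
      (hY.measurable_integrand hc) (hY.lintegral_energy_ne_top' hc hW ht htT le_rfl hr.2)
      (stronglyMeasurable_const (b := (1 : ℝ))) (memLp_const 1)
    simp only [one_mul] at h0
    rw [← hY.integral_noise_sub_sq hc hW ht hr]
    have e : ∀ᵐ ω ∂P, noise μ t Y r ω ^ 2 = y ^ 2 + (2 * y) * (noise μ t Y r ω - noise μ t Y t ω)
        + (noise μ t Y r ω - noise μ t Y t ω) ^ 2 := by
      filter_upwards [hY.initial] with ω hω
      rw [noise_initial, hω]
      ring
    have hX1 : Integrable (fun ω => noise μ t Y r ω - noise μ t Y t ω) P :=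
      hX.integrable (by norm_num)
    rw [integral_congr_ae e, integral_add ((integrable_const _).fun_add (hX1.const_mul _))
      hX.integrable_sq, integral_add (integrable_const _) (hX1.const_mul _), integral_const_mul, h0]
    simp
  have hsq : ∫ ω, Y r ω ^ 2 ∂P = ∫ ω, noise μ t Y r ω ^ 2 ∂P
      + 2 * (∫ ω, noise μ t Y r ω * D r ω ∂P) + ∫ ω, D r ω ^ 2 ∂P := by
    have i1 : Integrable (fun ω => noise μ t Y r ω * D r ω) P := hNm.integrable_mul (hDm r hr)
    have e : ∀ ω, Y r ω ^ 2 = noise μ t Y r ω ^ 2 + 2 * (noise μ t Y r ω * D r ω) + D r ω ^ 2 :=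
      fun ω => by rw [hYD]; ring
    simp_rw [e]
    rw [integral_add (hNm.integrable_sq.fun_add (i1.const_mul 2)) (hDm r hr).integrable_sq,
      integral_add hNm.integrable_sq (i1.const_mul 2), integral_const_mul]
  have hi2 : IntervalIntegrable (fun u => ‖σ u‖ ^ 2 * ∫ ω, Y u ω ^ 2 ∂P) volume t r := by
    refine (intervalIntegrable_iff_integrableOn_Icc_of_le hr.1).2
      ((hc.vol_on ht hr.2).mul_bdd (c := C) hmb.aestronglyMeasurable ?_)
    exact (ae_restrict_iff' measurableSet_Icc).2 (Eventually.of_forall fun u hu => hb u (hsub hu))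
  have hi3 : IntervalIntegrable (fun u => μ u * ∫ ω,
      Y u ω * noise μ t Y (clamp t T u) ω ∂P) volume t r := by
    refine hdn.2.1.congr fun u hu => ?_
    rw [uIoc_of_le hr.1] at hu
    simp only [horth u (Ioc_subset_Icc_self hu)]
  rw [hsq, hNN, hND, hD2]
  -- The cross term contributes 2μ E[Y_u N_u] and the squared drift 2μ E[Y_u (Y_u - N_u)], together
  -- 2μ E Y_u².
  have e : ∀ u ∈ Icc t r, (2 * μ u + ‖σ u‖ ^ 2) * ∫ ω, Y u ω ^ 2 ∂P
      = ‖σ u‖ ^ 2 * ∫ ω, Y u ω ^ 2 ∂P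
        + (2 * (μ u * ∫ ω, Y u ω * noise μ t Y (clamp t T u) ω ∂P)
        + 2 * (μ u * ∫ ω, Y u ω * (Y u ω - noise μ t Y (clamp t T u) ω) ∂P)) := by
    intro u hu
    rw [clamp_of_mem (hsub hu)]
    have i1 : Integrable (fun ω => Y u ω * noise μ t Y u ω) P :=
      (hC u (hsub hu)).1.integrable_mul (hC' u (hsub hu)).1
    have i2 : Integrable (fun ω => Y u ω * (Y u ω - noise μ t Y u ω)) P :=
      (hC u (hsub hu)).1.integrable_mul ((hC u (hsub hu)).1.sub (hC' u (hsub hu)).1)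
    have e2 : ∫ ω, Y u ω ^ 2 ∂P = ∫ ω, Y u ω * noise μ t Y u ω ∂P
        + ∫ ω, Y u ω * (Y u ω - noise μ t Y u ω) ∂P := by
      rw [← integral_add i1 i2]
      refine integral_congr_ae (Eventually.of_forall fun ω => ?_)
      ring
    rw [e2]
    ring
  rw [intervalIntegral.integral_congr (g := fun u => _) (fun u hu => e u (by
    rwa [uIcc_of_le hr.1] at hu)), intervalIntegral.integral_add hi2
    ((hi3.const_mul 2).add (hdd.2.1.const_mul 2)),
    intervalIntegral.integral_add (hi3.const_mul 2) (hdd.2.1.const_mul 2),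
    intervalIntegral.integral_const_mul, intervalIntegral.integral_const_mul]
  ring

end IsScalarSolution

end Exponential

/-! ### The mean square distance of a solution to exponentials of step functions -/

section StepApproximation

variable {Ω : Type*} {mΩ : MeasurableSpace Ω} {d : ℕ}
  {ℱ : Filtration ℝ mΩ} {P : Measure Ω} {W : ℝ → Ω → EuclideanSpace ℝ (Fin d)}
  {μ : ℝ → ℝ} {σ : ℝ → EuclideanSpace ℝ (Fin d)} {T t y : ℝ} {Y : ℝ → Ω → ℝ}

namespace IsCoefficient

theorem memLp_vol (hc : IsCoefficient μ σ T) {p q : ℝ} (hp : 0 ≤ p) (hq : q ≤ T) :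
    MemLp σ 2 (volume.restrict (Icc p q)) :=
  memLp_two_of_lintegral hc.measurable_vol.aestronglyMeasurable (hc.lintegral_vol hp hq)

theorem integrableOn_inner (hc : IsCoefficient μ σ T) {p q : ℝ} (hp : 0 ≤ p) (hq : q ≤ T)
    (g : StepFn (EuclideanSpace ℝ (Fin d))) : IntegrableOn (fun u => ⟪σ u, g.eval u⟫) (Icc p q) := by
  obtain ⟨C, hC⟩ := g.exists_bound_eval
  refine (((hc.memLp_vol hp hq).integrable (by norm_num)).norm.mul_const C).mono'
    (hc.measurable_vol.inner g.measurable_eval).aestronglyMeasurable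
    (Eventually.of_forall fun u => ?_)
  exact (norm_inner_le_norm _ _).trans (mul_le_mul_of_nonneg_left (hC u) (norm_nonneg _))

end IsCoefficient

namespace IsScalarSolution

variable [IsProbabilityMeasure P]

/-- By duality with the exponential, the Itô part of Y contributes ∫⟨σ, g⟩ E[Y_u 𝓔_u(g)] du, so the
expectation solves a linear equation with coefficient μ + ⟨σ, g⟩. -/
theorem integral_mul_dexp_eq (hY : IsScalarSolution ℱ P W μ σ T t y Y)
    (hc : IsCoefficient μ σ T) (hW : IsBrownianMotion ℱ P T W) (ht : 0 ≤ t)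
    (g : StepFn (EuclideanSpace ℝ (Fin d))) (h0 : g.time 0 ≤ 0) (hN : T ≤ g.time g.N)
    {r : ℝ} (hr : r ∈ Icc t T) :
    ∫ ω, Y r ω * g.dexp (fun u => W u ω) t r ∂P
      = y * Real.exp (∫ u in t..r, (μ u + ⟪σ u, g.eval u⟫)) := by
  have htT := hr.1.trans hr.2
  obtain ⟨C, hC⟩ := hY.exists_sq_bound hc hW ht htT
  have hd : ∀ r ∈ Icc t T, MemLp (fun ω => g.dexp (fun u => W u ω) t r) 2 P := fun r hr =>
    (g.dexp_sq hW ht hr.1 hr.2).1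
  have hshift' : ∀ u v, u ∈ Icc t T → u ≤ v → v ≤ T →
      ∫ ω, Y u ω * g.dexp (fun u => W u ω) t v ∂P
        = ∫ ω, Y u ω * g.dexp (fun u => W u ω) t u ∂P := by
    intro u v hu huv hv
    refine Eq.trans (integral_congr_ae (Eventually.of_forall fun ω => ?_))
      (g.integral_mul_dexp hW (ht.trans hu.1) huv hv
      ((hY.adapted u hu).mul (g.stronglyMeasurable_dexp hW ht hu.1 hu.2))
      ((hC u hu).1.integrable_mul (hd u hu)))
    dsimp only
    rw [← g.dexp_mul_dexp (fun u => W u ω) hu.1 huv, mul_assoc]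
  -- The exponential is taken up to the fixed time T, which makes `a` measurable by Fubini's
  -- theorem. Since the exponential is a martingale, T may be replaced by any time from u on.
  set a : ℝ → ℝ := fun u => ∫ ω, Y u ω * g.dexp (fun u => W u ω) t T ∂P with ha
  have hshift : ∀ u v, u ∈ Icc t T → u ≤ v → v ≤ T →
      ∫ ω, Y u ω * g.dexp (fun u => W u ω) t v ∂P = a u := fun u v hu huv hv =>
    (hshift' u v hu huv hv).trans (hshift' u T hu hu.2 le_rfl).symm
  have hdm : ∀ r ∈ Icc t T, Measurable fun ω => g.dexp (fun u => W u ω) t r := fun r hr =>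
    ((g.stronglyMeasurable_dexp hW ht hr.1 hr.2).mono (ℱ.le r)).measurable
  have hΦm : ∀ r ∈ Icc t T, Measurable fun z : ℝ × Ω =>
      Y z.1 z.2 * g.dexp (fun u => W u z.2) t r := fun r hr =>
    hY.measurable_uncurry.mul ((hdm r hr).comp measurable_snd)
  have ham : Measurable a :=
    ((hΦm T ⟨htT, le_rfl⟩).stronglyMeasurable.integral_prod_right').measurable
  have hbd : ∀ r ∈ Icc t T, ∀ u ∈ Icc t r, ∫ ω, |Y u ω * g.dexp (fun u => W u ω) t r| ∂P
      ≤ C + ∫ ω, g.dexp (fun u => W u ω) t r ^ 2 ∂P := fun r hr u hu =>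
    (integral_abs_mul_le (hC u ⟨hu.1, hu.2.trans hr.2⟩).1 (hd r hr)).trans
      (add_le_add_left (hC u ⟨hu.1, hu.2.trans hr.2⟩).2 _)
  have hab : ∀ u ∈ Icc t T, |a u| ≤ C + ∫ ω, g.dexp (fun u => W u ω) t T ^ 2 ∂P := fun u hu =>
    (abs_integral_le_integral_abs).trans (hbd T ⟨htT, le_rfl⟩ u hu)
  rw [hshift r r hr le_rfl hr.2]
  refine eq_mul_exp_integral ((hc.drift_on ht le_rfl).fun_add
    (hc.integrableOn_inner ht le_rfl g)) ham.aestronglyMeasurable hab (fun r hr => ?_) r hr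
  have hi : ∀ u ∈ Icc t r, Integrable (fun ω => Y u ω * g.dexp (fun u => W u ω) t r) P :=
    fun u hu => (hC u ⟨hu.1, hu.2.trans hr.2⟩).1.integrable_mul (hd r hr)
  have hconv : ∀ m : ℝ → ℝ, ∫ u in t..r, m u * ∫ ω, Y u ω * g.dexp (fun u => W u ω) t r ∂P
      = ∫ u in t..r, m u * a u := fun m => by
    refine intervalIntegral.integral_congr fun u hu => ?_
    rw [uIcc_of_le hr.1] at hu
    simp only [hshift u r ⟨hu.1, hu.2.trans hr.2⟩ hu.2 hr.2]
  obtain ⟨-, hd2, hd3⟩ := integral_swap hc.measurable_drift hr.1 (hc.drift_on ht hr.2)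
    (hΦm r hr) hi (hbd r hr)
  obtain ⟨hs1, hs2, -⟩ := integral_swap (hc.measurable_vol.inner g.measurable_eval) hr.1
    (hc.integrableOn_inner ht hr.2 g) (hΦm r hr) hi (hbd r hr)
  have hci : ∀ {m : ℝ → ℝ}, IntervalIntegrable (fun u => m u *
      ∫ ω, Y u ω * g.dexp (fun u => W u ω) t r ∂P) volume t r →
      IntervalIntegrable (fun u => m u * a u) volume t r := fun h => by
    refine h.congr fun u hu => ?_
    rw [uIoc_of_le hr.1] at hu
    simp only [hshift u r ⟨hu.1.le, hu.2.trans hr.2⟩ hu.2 hr.2]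
  have hdual := (hY.ito t r le_rfl hr.1 hr.2).integral_mul_dexp hW ht hr.1 hr.2
    (hY.measurable_integrand hc) (hY.lintegral_energy_ne_top' hc hW ht htT le_rfl hr.2) g
    (h0.trans ht) (hr.2.trans hN)
  have hX : ∫ ω, (noise μ t Y r ω - noise μ t Y t ω) * g.dexp (fun u => W u ω) t r ∂P
      = ∫ u in t..r, ⟪σ u, g.eval u⟫ * a u := by
    rw [hdual, ← hconv, intervalIntegral.integral_of_le hr.1, ← integral_Icc_eq_integral_Ioc]
    have e : ∀ z : ℝ × Ω, ⟪Y z.1 z.2 • σ z.1, g.dexp (fun u => W u z.2) t r • g.eval z.1⟫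
        = ⟪σ z.1, g.eval z.1⟫ * (Y z.1 z.2 * g.dexp (fun u => W u z.2) t r) := fun z => by
      rw [real_inner_smul_left, real_inner_smul_right]
      ring
    simp_rw [e]
    rw [integral_prod _ hs1]
    simp_rw [integral_const_mul]
  have hD : ∫ ω, (∫ u in t..r, μ u * Y u ω) * g.dexp (fun u => W u ω) t r ∂P
      = ∫ u in t..r, μ u * a u := by
    rw [← hconv, ← hd3]
    refine integral_congr_ae (Eventually.of_forall fun ω => ?_)
    dsimp only
    rw [← intervalIntegral.integral_mul_const]
    refine intervalIntegral.integral_congr fun u _ => ?_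
    ring
  have h1 : ∫ ω, y * g.dexp (fun u => W u ω) t r ∂P = y := by
    rw [g.integral_mul_dexp hW ht hr.1 hr.2 stronglyMeasurable_const (integrable_const _)]
    simp
  have hXm := hY.memLp_noise_sub hc hW ht le_rfl hr.1 hr.2
  have hDm : MemLp (fun ω => ∫ u in t..r, μ u * Y u ω) 2 P := by
    have := ((hC r hr).1.sub hXm).sub hY.memLp_initial
    refine (memLp_congr_ae (Eventually.of_forall fun ω => ?_)).1 this
    simp only [Pi.sub_apply, noise_initial]
    rw [noise]
    ring
  have hsplit : ∀ᵐ ω ∂P, Y r ω * g.dexp (fun u => W u ω) t r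
      = y * g.dexp (fun u => W u ω) t r
        + ((noise μ t Y r ω - noise μ t Y t ω) * g.dexp (fun u => W u ω) t r
        + (∫ u in t..r, μ u * Y u ω) * g.dexp (fun u => W u ω) t r) := by
    filter_upwards [hY.initial] with ω hω
    rw [noise_initial, hω, noise]
    ring
  have i1 : Integrable (fun ω => (noise μ t Y r ω - noise μ t Y t ω)
      * g.dexp (fun u => W u ω) t r) P := hXm.integrable_mul (hd r hr)
  have i2 : Integrable (fun ω => (∫ u in t..r, μ u * Y u ω) * g.dexp (fun u => W u ω) t r) P :=
    hDm.integrable_mul (hd r hr)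
  rw [← hshift r r hr le_rfl hr.2, integral_congr_ae hsplit,
    integral_add (((hd r hr).integrable (by norm_num)).const_mul y) (i1.fun_add i2),
    integral_add i1 i2, h1]
  simp_rw [add_mul]
  rw [intervalIntegral.integral_add (hci hd2) (hci hs2), ← hX, ← hD]
  ring

/-- Expand the square and insert the three moments. The point is that the right side tends to 0 as g
→ σ in L². -/
theorem integral_sub_dexp_sq (hY : IsScalarSolution ℱ P W μ σ T t y Y)
    (hc : IsCoefficient μ σ T) (hW : IsBrownianMotion ℱ P T W) (ht : 0 ≤ t)
    (g : StepFn (EuclideanSpace ℝ (Fin d))) (h0 : g.time 0 ≤ 0) (hN : T ≤ g.time g.N)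
    {r : ℝ} (hr : r ∈ Icc t T) :
    ∫ ω, (Y r ω - y * Real.exp (∫ u in t..r, μ u) * g.dexp (fun u => W u ω) t r) ^ 2 ∂P
      = (y * Real.exp (∫ u in t..r, μ u)) ^ 2 * (Real.exp (∫ u in t..r, ‖σ u‖ ^ 2)
        - 2 * Real.exp (∫ u in t..r, ⟪σ u, g.eval u⟫)
        + Real.exp (∫ u in t..r, ‖g.eval u‖ ^ 2)) := by
  obtain ⟨C, hC⟩ := hY.exists_sq_bound hc hW ht (hr.1.trans hr.2)
  have hYm := (hC r hr).1
  obtain ⟨hd, hd2⟩ := g.dexp_sq hW ht hr.1 hr.2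
  set c := y * Real.exp (∫ u in t..r, μ u) with hcdef
  have e : ∀ ω, (Y r ω - c * g.dexp (fun u => W u ω) t r) ^ 2
      = Y r ω ^ 2 + (-2 * c) * (Y r ω * g.dexp (fun u => W u ω) t r)
        + c ^ 2 * g.dexp (fun u => W u ω) t r ^ 2 := fun ω => by ring
  have i1 : Integrable (fun ω => Y r ω * g.dexp (fun u => W u ω) t r) P := hYm.integrable_mul hd
  have ii : ∀ {f : ℝ → ℝ}, IntegrableOn f (Icc t r) → IntervalIntegrable f volume t r := fun h =>
    (intervalIntegrable_iff_integrableOn_Icc_of_le hr.1).2 h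
  simp_rw [e]
  rw [integral_add (hYm.integrable_sq.fun_add (i1.const_mul _)) (hd.integrable_sq.const_mul _),
    integral_add hYm.integrable_sq (i1.const_mul _), integral_const_mul, integral_const_mul, hd2,
    hY.integral_sq_eq hc hW ht hr, hY.integral_mul_dexp_eq hc hW ht g h0 hN hr,
    intervalIntegral.integral_add ((ii (hc.drift_on ht hr.2)).const_mul 2)
      (ii (hc.vol_on ht hr.2)),
    intervalIntegral.integral_add (ii (hc.drift_on ht hr.2))
      (ii (hc.integrableOn_inner ht hr.2 g)), intervalIntegral.integral_const_mul, Real.exp_add,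
    Real.exp_add, two_mul (∫ u in t..r, μ u), Real.exp_add, hcdef]
  ring

end IsScalarSolution

/-- Square integrable functions are limits of step functions. -/
theorem exists_stepFn_tendsto {E : Type} [NormedAddCommGroup E] [NormedSpace ℝ E] (hT : 0 ≤ T)
    {f : ℝ → E} (hf : MemLp f 2 (volume.restrict (Icc 0 T))) :
    ∃ g : ℕ → StepFn E, (∀ k, (g k).time 0 ≤ 0 ∧ T ≤ (g k).time (g k).N) ∧
      Tendsto (fun k => eLpNorm ((g k).eval - f) 2 (volume.restrict (Icc 0 T))) atTop (𝓝 0) := by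
  have key : ∀ ε : ℝ≥0∞, 0 < ε → ∃ g : StepFn E, (g.time 0 ≤ 0 ∧ T ≤ g.time g.N) ∧
      eLpNorm (g.eval - f) 2 (volume.restrict (Icc 0 T)) ≤ ε := by
    intro ε hε
    -- A continuous function with compact support is within ε/2 in L² and is uniformly continuous.
    -- Its values at the left end points of a fine grid are uniformly δ-close to it, and δ is chosen
    -- so that this costs at most ε/2 on [0, T].
    obtain ⟨φ, hφs, hφ, hφc, hφm⟩ := hf.exists_hasCompactSupport_eLpNorm_sub_le
      (by norm_num) (ENNReal.half_pos hε.ne').ne'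
    have huc : UniformContinuous φ := hφs.uniformContinuous_of_continuous hφc
    obtain ⟨δ, hδ, hδε⟩ : ∃ δ : ℝ, 0 < δ ∧
        (volume.restrict (Icc 0 T)) univ ^ (1 / (2 : ℝ)) * ENNReal.ofReal δ ≤ ε / 2 := by
      have hM : (volume.restrict (Icc 0 T)) univ ^ (1 / (2 : ℝ)) ≠ ∞ :=
        ENNReal.rpow_ne_top_of_nonneg (by norm_num) (measure_ne_top _ _)
      have h1 : Tendsto (fun δ : ℝ => (volume.restrict (Icc 0 T)) univ ^ (1 / (2 : ℝ))
          * ENNReal.ofReal δ) (𝓝 0) (𝓝 0) := by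
        have := ENNReal.Tendsto.const_mul (ENNReal.tendsto_ofReal (tendsto_id (x := 𝓝 (0 : ℝ))))
          (Or.inr hM)
        simpa using this
      have h2 := (h1.mono_left nhdsWithin_le_nhds).eventually_lt_const
        (ENNReal.half_pos hε.ne') (l := 𝓝[>] (0 : ℝ))
      obtain ⟨δ, h3, h4⟩ := (h2.and self_mem_nhdsWithin).exists
      exact ⟨δ, h4, h3.le⟩
    obtain ⟨η, hη, hηδ⟩ := Metric.uniformContinuous_iff.1 huc δ hδ
    obtain ⟨N, hN⟩ := exists_nat_gt (T / η)
    have hN0 : (0 : ℝ) < N + 1 := by positivity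
    have hstep : T / (N + 1) < η := by
      rw [div_lt_iff₀ hN0]
      rw [div_lt_iff₀ hη] at hN
      nlinarith
    let g : StepFn E :=
      { N := N + 1
        time := fun k => k * (T / (N + 1))
        mono := fun k l hkl => mul_le_mul_of_nonneg_right (by exact_mod_cast hkl) (by positivity)
        val := fun k => φ (k * (T / (N + 1))) }
    have hg0 : g.time 0 = 0 := by simp [g]
    have hgN : g.time g.N = T := by
      simp only [g]
      push_cast
      field_simp
    refine ⟨g, ⟨hg0.le, hgN.ge⟩, ?_⟩
    have hclose : ∀ᵐ u ∂(volume.restrict (Icc 0 T)), ‖(g.eval - φ) u‖ ≤ δ := by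
      rw [Measure.restrict_congr_set Ioc_ae_eq_Icc.symm]
      refine (ae_restrict_iff' measurableSet_Ioc).2 (Eventually.of_forall fun u hu => ?_)
      obtain ⟨k, hk, hku⟩ := g.exists_mem_Ioc (u := u) (by rwa [hg0, hgN])
      rw [Pi.sub_apply, g.eval_of_mem hk hku, ← dist_eq_norm]
      refine (hηδ ?_).le
      rw [Real.dist_eq, abs_lt]
      simp only [g, mem_Ioc] at hku
      push_cast at hku
      constructor <;> nlinarith [hku.1, hku.2]
    have hmeas : AEStronglyMeasurable g.eval (volume.restrict (Icc 0 T)) := by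
      unfold StepFn.eval
      exact (Finset.stronglyMeasurable_fun_sum _ fun k _ =>
        stronglyMeasurable_const.indicator measurableSet_Ioc).aestronglyMeasurable
    calc eLpNorm (g.eval - f) 2 (volume.restrict (Icc 0 T))
        = eLpNorm ((g.eval - φ) + (φ - f)) 2 (volume.restrict (Icc 0 T)) := by
          congr 1; abel
      _ ≤ eLpNorm (g.eval - φ) 2 (volume.restrict (Icc 0 T))
          + eLpNorm (φ - f) 2 (volume.restrict (Icc 0 T)) :=
          eLpNorm_add_le (hmeas.sub hφm.1) (hφm.1.sub hf.1) (by norm_num)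
      _ ≤ ε / 2 + ε / 2 := by
          refine add_le_add ?_ ?_
          · refine (eLpNorm_le_of_ae_bound hclose).trans (le_trans (le_of_eq ?_) hδε)
            norm_num
          · rw [eLpNorm_sub_comm]
            exact hφ
      _ = ε := ENNReal.add_halves ε
  obtain ⟨ε, -, hε, hlim⟩ := exists_seq_strictAnti_tendsto' (show (0 : ℝ≥0∞) < 1 by norm_num)
  choose g hg1 hg2 using fun k => key (ε k) (hε k).1
  exact ⟨g, hg1, tendsto_of_tendsto_of_tendsto_of_le_of_le tendsto_const_nhds hlim
    (fun _ => zero_le) hg2⟩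

end StepApproximation

/-! ### Almost sure convergence and positivity of the limit -/

section Increments

variable {Ω : Type*} {mΩ : MeasurableSpace Ω} {d : ℕ}
  {ℱ : Filtration ℝ mΩ} {P : Measure Ω} {W : ℝ → Ω → EuclideanSpace ℝ (Fin d)} {T : ℝ}

/-- Finitely many sequences which converge in `L²` converge almost surely along a common
subsequence. -/
theorem exists_seq_tendsto_ae_of_finite {ι : Type*} [Fintype ι] {f : ℕ → ι → Ω → ℝ}
    {f' : ι → Ω → ℝ} (hf : ∀ k j, AEStronglyMeasurable (f k j) P)
    (hf' : ∀ j, AEStronglyMeasurable (f' j) P)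
    (h : ∀ j, Tendsto (fun k => eLpNorm (f k j - f' j) 2 P) atTop (𝓝 0)) :
    ∃ ns : ℕ → ℕ, StrictMono ns ∧
      ∀ᵐ ω ∂P, ∀ j, Tendsto (fun k => f (ns k) j ω) atTop (𝓝 (f' j ω)) := by
  have hm : ∀ k j, AEMeasurable (fun ω => ‖f k j ω - f' j ω‖ₑ ^ 2) P := fun k j =>
    ((hf k j).sub (hf' j)).enorm.pow_const 2
  have hlim : Tendsto (fun k => ∫⁻ ω, ∑ j, ‖f k j ω - f' j ω‖ₑ ^ 2 ∂P) atTop (𝓝 0) := by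
    have : ∀ k, ∫⁻ ω, ∑ j, ‖f k j ω - f' j ω‖ₑ ^ 2 ∂P
        = ∑ j, ∫⁻ ω, ‖f k j ω - f' j ω‖ₑ ^ 2 ∂P := fun k =>
      lintegral_finsetSum' _ fun j _ => hm k j
    simp_rw [this]
    have := tendsto_finsetSum (Finset.univ : Finset ι) fun j _ =>
      tendsto_eLpNorm_two_iff.1 (h j)
    simpa using this
  obtain ⟨ns, hns, hae⟩ := exists_seq_tendsto_zero (m := P)
    (A := fun k ω => ∑ j, ‖f k j ω - f' j ω‖ₑ ^ 2) (fun ε hε => by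
      -- The Markov inequality used below needs a finite threshold. For ε = ∞ the event lies in the
      -- one with threshold 1.
      rcases eq_or_ne ε ∞ with rfl | hεt
      · refine tendsto_of_tendsto_of_tendsto_of_le_of_le tendsto_const_nhds
          (h := fun k => ∫⁻ ω, ∑ j, ‖f k j ω - f' j ω‖ₑ ^ 2 ∂P) hlim (fun _ => zero_le)
          fun k => ?_
        have := mul_meas_ge_le_lintegral₀ (μ := P)
          (Finset.aemeasurable_fun_sum Finset.univ fun j _ => hm k j) 1
        rw [one_mul] at this
        refine le_trans (measure_mono (t := {ω | 1 ≤ ∑ j, ‖f k j ω - f' j ω‖ₑ ^ 2})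
          fun ω hω => ?_) this
        rw [mem_ofPred_eq] at hω ⊢
        exact le_top.trans hω
      · have h2 := ENNReal.Tendsto.div_const hlim (Or.inr hε.ne')
        rw [ENNReal.zero_div] at h2
        refine tendsto_of_tendsto_of_tendsto_of_le_of_le tendsto_const_nhds h2 (fun _ => zero_le)
          fun k => ?_
        exact meas_ge_le_lintegral_div
          (Finset.aemeasurable_fun_sum Finset.univ fun j _ => hm k j) hε.ne' hεt)
  refine ⟨ns, hns, hae.mono fun ω hω j => ?_⟩
  have h1 : Tendsto (fun k => ‖f (ns k) j ω - f' j ω‖ₑ ^ 2) atTop (𝓝 0) :=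
    tendsto_of_tendsto_of_tendsto_of_le_of_le tendsto_const_nhds hω (fun _ => zero_le) fun k =>
      Finset.single_le_sum (f := fun j => ‖f (ns k) j ω - f' j ω‖ₑ ^ 2) (fun _ _ => zero_le)
        (Finset.mem_univ j)
  have h2 := h1.ennrpow_const (1 / 2 : ℝ)
  simp only [sq_rpow_half] at h2
  refine tendsto_iff_edist_tendsto_0.2 ?_
  simpa [edist_eq_enorm_sub] using h2

namespace StepFn

theorem memLp_eval {E : Type} [NormedAddCommGroup E] (h : StepFn E) (p q : ℝ) : MemLp h.eval 2 (volume.restrict (Icc p q)) := by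
  obtain ⟨C, hC⟩ := h.exists_bound_eval
  refine MemLp.of_bound ?_ C (Eventually.of_forall hC)
  unfold eval
  exact (Finset.stronglyMeasurable_fun_sum _ fun k _ =>
    stronglyMeasurable_const.indicator measurableSet_Ioc).aestronglyMeasurable

section Comp

variable {E F : Type} [NormedAddCommGroup E] [NormedAddCommGroup F] [NormedSpace ℝ E]
  [NormedSpace ℝ F]

/-- The image of a step function under a linear map. -/
def comp (h : StepFn E) (L : E →L[ℝ] F) : StepFn F where
  N := h.N
  time := h.time
  mono := h.mono
  val k := L (h.val k)

theorem eval_comp (h : StepFn E) (L : E →L[ℝ] F) (u : ℝ) : (h.comp L).eval u = L (h.eval u) :=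
  (h.map_eval (fun _ v => L v) (fun _ => map_zero L) u).symm

theorem tendsto_eval_comp {f : ℝ → E} {g : ℕ → StepFn E} (L : E →L[ℝ] F)
    (hg : Tendsto (fun k => eLpNorm ((g k).eval - f) 2 (volume.restrict (Icc 0 T))) atTop (𝓝 0))
    {p q : ℝ} (hp : 0 ≤ p) (hq : q ≤ T) :
    Tendsto (fun k => eLpNorm (((g k).comp L).eval - fun u => L (f u)) 2
      (volume.restrict (Icc p q))) atTop (𝓝 0) := by
  have h1 := ENNReal.Tendsto.const_mul hg (Or.inr (ENNReal.ofReal_ne_top (r := ‖L‖)))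
  rw [mul_zero] at h1
  refine tendsto_of_tendsto_of_tendsto_of_le_of_le tendsto_const_nhds h1 (fun _ => zero_le)
    fun k => ?_
  calc _ ≤ ENNReal.ofReal ‖L‖ * eLpNorm ((g k).eval - f) 2 (volume.restrict (Icc p q)) := by
        refine eLpNorm_le_mul_eLpNorm_of_ae_le_mul (Eventually.of_forall fun u => ?_) 2
        rw [Pi.sub_apply, eval_comp, ← map_sub]
        exact L.le_opNorm _
    _ ≤ _ := by
        gcongr

end Comp

variable {E : Type} [NormedAddCommGroup E] [InnerProductSpace ℝ E]

theorem tendsto_integral_norm_sq {f : ℝ → E} {g : ℕ → StepFn E} {p q : ℝ} (hpq : p ≤ q)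
    (hf : MemLp f 2 (volume.restrict (Icc p q)))
    (hg : Tendsto (fun k => eLpNorm ((g k).eval - f) 2 (volume.restrict (Icc p q))) atTop (𝓝 0)) :
    Tendsto (fun k => ∫ u in p..q, ‖(g k).eval u‖ ^ 2) atTop (𝓝 (∫ u in p..q, ‖f u‖ ^ 2)) := by
  have := tendsto_integral_inner (fun k => (g k).memLp_eval p q) hf
    (fun k => (g k).memLp_eval p q) hf hg hg
  simp_rw [real_inner_self_eq_norm_sq] at this
  simpa only [intervalIntegral.integral_of_le hpq, ← integral_Icc_eq_integral_Ioc] using this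

theorem tendsto_integral_inner_eval {f : ℝ → E} {g : ℕ → StepFn E} {p q : ℝ} (hpq : p ≤ q)
    (hf : MemLp f 2 (volume.restrict (Icc p q)))
    (hg : Tendsto (fun k => eLpNorm ((g k).eval - f) 2 (volume.restrict (Icc p q))) atTop (𝓝 0)) :
    Tendsto (fun k => ∫ u in p..q, ⟪f u, (g k).eval u⟫) atTop (𝓝 (∫ u in p..q, ‖f u‖ ^ 2)) := by
  have := tendsto_integral_inner (fun _ => hf) hf
    (fun k => (g k).memLp_eval p q) hf (by simp) hg
  simp_rw [real_inner_self_eq_norm_sq] at this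
  simpa only [intervalIntegral.integral_of_le hpq, ← integral_Icc_eq_integral_Ioc] using this

end StepFn

variable [IsProbabilityMeasure P]

/-- Limits of Doléans exponentials of bounded energy are almost surely positive. -/
theorem pos_of_tendsto_dexp (hW : IsBrownianMotion ℱ P T W) {p q : ℝ} (hp : 0 ≤ p) (hpq : p ≤ q)
    (hq : q ≤ T) {g : ℕ → StepFn (EuclideanSpace ℝ (Fin d))} {v : ℝ}
    (hg : Tendsto (fun k => ∫ u in p..q, ‖(g k).eval u‖ ^ 2) atTop (𝓝 v)) {R : Ω → ℝ}
    (hR : ∀ᵐ ω ∂P, Tendsto (fun k => (g k).dexp (fun u => W u ω) p q) atTop (𝓝 (R ω))) :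
    ∀ᵐ ω ∂P, 0 < R ω := by
  have hint : ∀ k, Integrable (fun ω => Real.exp (-(g k).incr (fun u => W u ω) p q)) P ∧
      ∫ ω, Real.exp (-(g k).incr (fun u => W u ω) p q) ∂P
        = Real.exp ((∫ u in p..q, ‖(g k).eval u‖ ^ 2) / 2) := by
    intro k
    obtain ⟨-, h2, h3⟩ := (g k).exp_incr hW hp hpq hq (-1) 0 (ξ := fun _ => (1 : ℝ))
      stronglyMeasurable_const (integrable_const _)
    simp only [one_mul, zero_mul, add_zero, neg_mul, integral_const, probReal_univ,
      smul_eq_mul, mul_one] at h2 h3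
    refine ⟨h2, h3.trans ?_⟩
    congr 1
    ring
  -- The expectations of exp(-∫g dW) are exp(½∫‖g‖²), which converge, so the lower limit is
  -- integrable and almost surely finite. Where the exponentials tend to 0 while the energies
  -- converge, exp(-∫g dW) tends to infinity; so this happens on a null set only.
  have hfat : ∫⁻ ω, liminf (fun k => ENNReal.ofReal
      (Real.exp (-(g k).incr (fun u => W u ω) p q))) atTop ∂P ≠ ∞ := by
    refine ne_top_of_le_ne_top ?_ (lintegral_liminf_le' fun k =>
      (hint k).1.aestronglyMeasurable.aemeasurable.ennreal_ofReal)
    have : Tendsto (fun k => ∫⁻ ω, ENNReal.ofReal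
        (Real.exp (-(g k).incr (fun u => W u ω) p q)) ∂P) atTop
        (𝓝 (ENNReal.ofReal (Real.exp (v / 2)))) := by
      have e : ∀ k, ∫⁻ ω, ENNReal.ofReal (Real.exp (-(g k).incr (fun u => W u ω) p q)) ∂P
          = ENNReal.ofReal (Real.exp ((∫ u in p..q, ‖(g k).eval u‖ ^ 2) / 2)) := fun k => by
        rw [← (hint k).2, ofReal_integral_eq_lintegral_ofReal (hint k).1
          (Eventually.of_forall fun _ => (Real.exp_pos _).le)]
      simp_rw [e]
      exact ENNReal.tendsto_ofReal ((Real.continuous_exp.tendsto _).comp (hg.div_const 2))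
    rw [this.liminf_eq]
    exact ENNReal.ofReal_ne_top
  have hm : AEMeasurable (fun ω => liminf (fun k => ENNReal.ofReal
      (Real.exp (-(g k).incr (fun u => W u ω) p q))) atTop) P := by
    refine Measurable.aemeasurable ?_
    refine Measurable.liminf fun k => ?_
    exact (((((g k).stronglyMeasurable_incr hW hp hpq hq).mono (ℱ.le q)).measurable.neg).exp
      ).ennreal_ofReal
  filter_upwards [ae_lt_top' hm hfat, hR] with ω h1 h2
  have h0 : 0 ≤ R ω := ge_of_tendsto' h2 fun k => (Real.exp_pos _).le
  refine lt_of_le_of_ne h0 fun hne => ?_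
  rw [← hne] at h2
  have h3 : Tendsto (fun k => ((g k).dexp (fun u => W u ω) p q)⁻¹) atTop atTop :=
    (tendsto_nhdsWithin_iff.2 ⟨h2, Eventually.of_forall fun k => Real.exp_pos _⟩).inv_tendsto_nhdsGT_zero
  have h4 : Tendsto (fun k => Real.exp (-((∫ u in p..q, ‖(g k).eval u‖ ^ 2) / 2))) atTop
      (𝓝 (Real.exp (-(v / 2)))) :=
    (Real.continuous_exp.tendsto _).comp (hg.div_const 2).neg
  have h5 := h3.atTop_mul_pos (Real.exp_pos _) h4
  have h6 : ∀ k, ((g k).dexp (fun u => W u ω) p q)⁻¹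
      * Real.exp (-((∫ u in p..q, ‖(g k).eval u‖ ^ 2) / 2))
      = Real.exp (-(g k).incr (fun u => W u ω) p q) := by
    intro k
    rw [StepFn.dexp, ← Real.exp_neg, ← Real.exp_add]
    congr 1
    ring
  simp_rw [h6] at h5
  have h7 := ENNReal.tendsto_ofReal_atTop.comp h5
  have h8 : liminf (fun k => ENNReal.ofReal
      (Real.exp (-(g k).incr (fun u => W u ω) p q))) atTop = ∞ := h7.liminf_eq
  exact h1.ne h8

end Increments

/-! ### The law of the logarithmic increments -/

section Law

variable {Ω : Type*} {mΩ : MeasurableSpace Ω} {n d : ℕ}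
  {ℱ : Filtration ℝ mΩ} {P : Measure Ω} {W : ℝ → Ω → EuclideanSpace ℝ (Fin d)} {T t : ℝ}
  {μ : ℝ → EuclideanSpace ℝ (Fin n)} {σ : ℝ → Matrix (Fin n) (Fin d) ℝ}

/-- The rows of a matrix-valued function, as Euclidean vectors. -/
noncomputable def row (σ : ℝ → Matrix (Fin n) (Fin d) ℝ) (i : Fin n) (u : ℝ) :
    EuclideanSpace ℝ (Fin d) := WithLp.toLp 2 (σ u i)

theorem norm_row_sq (σ : ℝ → Matrix (Fin n) (Fin d) ℝ) (i : Fin n) (u : ℝ) :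
    ‖row σ i u‖ ^ 2 = ∑ j, σ u i j ^ 2 := by
  simp [EuclideanSpace.norm_sq_eq, row]

theorem isCoefficient_row (hμ : Measurable μ) (hσ : ∀ i j, Measurable fun u => σ u i j)
    (hint : IntegrableOn (fun u => ‖μ u‖ + ∑ i, ∑ j, σ u i j ^ 2) (Icc 0 T)) (i : Fin n) :
    IsCoefficient (fun u => μ u i) (row σ i) T := by
  have h1 : Measurable fun u => μ u i := by fun_prop
  have h2 : Measurable (row σ i) := (WithLp.measurable_toLp 2 _).comp (measurable_pi_lambda _ (hσ i))
  have h3 : ∀ u, 0 ≤ ∑ i, ∑ j, σ u i j ^ 2 := fun u => by positivity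
  refine ⟨h1, h2, hint.mono' h1.aestronglyMeasurable (Eventually.of_forall fun u => ?_),
    hint.mono' (h2.norm.pow_const 2).aestronglyMeasurable (Eventually.of_forall fun u => ?_)⟩
  · have := PiLp.norm_apply_le (μ u) i
    linarith [h3 u]
  · rw [Real.norm_of_nonneg (sq_nonneg _), norm_row_sq]
    have := Finset.single_le_sum (f := fun i => ∑ j, σ u i j ^ 2) (fun i _ => by positivity)
      (Finset.mem_univ i)
    linarith [norm_nonneg (μ u)]

/-- Each component of a solution has a modification which is a scalar solution. -/
theorem IsSolution.exists_isScalarSolution (hℱ : IsCompleteFiltration ℱ P) (ht : 0 ≤ t)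
    (htT : t ≤ T) {y : EuclideanSpace ℝ (Fin n)} {Y : ℝ → Ω → EuclideanSpace ℝ (Fin n)}
    (hY : IsSolution ℱ P W μ σ T t y Y) (i : Fin n) : ∃ Z : ℝ → Ω → ℝ,
      IsScalarSolution ℱ P W (fun u => μ u i) (row σ i) T t (y i) Z ∧
      ∀ᵐ ω ∂P, ∀ s ∈ Icc t T, Z s ω = Y s ω i := by
  classical
  set N : Set Ω := {ω | ¬ ContinuousOn (fun s => Y s ω) (Icc t T)} with hN
  have hN0 : P N = 0 := hY.continuous
  have hNm : ∀ s, 0 ≤ s → MeasurableSet[ℱ s] N := fun s hs => ℱ.mono hs _ (hℱ N hN0)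
  -- Zero on the null set of discontinuous paths, and frozen outside [t, T]: every path becomes
  -- continuous on ℝ, hence Z is jointly measurable. Completeness of the filtration keeps it
  -- adapted.
  set Z : ℝ → Ω → ℝ := fun s ω => if ω ∈ N then 0 else Y (clamp t T s) ω i with hZ
  have hcl : ∀ s, clamp t T s ∈ Icc t T := fun s => clamp_mem htT s
  have hZm : ∀ s, StronglyMeasurable[ℱ (clamp t T s)] (Z s) := fun s =>
    StronglyMeasurable.ite (hNm _ (ht.trans (hcl s).1)) stronglyMeasurable_const
      (stronglyMeasurable_eval_apply (hY.adapted _ (hcl s)) i)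
  have hZY : ∀ᵐ ω ∂P, ∀ s ∈ Icc t T, Z s ω = Y s ω i := by
    filter_upwards [hY.continuous] with ω hω s hs
    have : ω ∉ N := fun h => h hω
    simp only [hZ, if_neg this, clamp_of_mem hs]
  refine ⟨Z, ⟨fun s => ((hZm s).mono (ℱ.le _)).measurable, fun s hs => ?_, fun ω => ?_, ?_, ?_⟩, hZY⟩
  · have := hZm s
    rwa [clamp_of_mem hs] at this
  · by_cases hω : ω ∈ N
    · simp only [hZ, if_pos hω]
      exact continuous_const
    · simp only [hZ, if_neg hω]
      have h1 : ContinuousOn (fun s => Y s ω) (Icc t T) := not_not.1 hω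
      have h2 : Continuous fun s => Y (clamp t T s) ω := by
        refine h1.comp_continuous ?_ hcl
        unfold clamp
        fun_prop
      exact (EuclideanSpace.proj (𝕜 := ℝ) i).continuous.comp h2
  · filter_upwards [hZY, hY.initial] with ω h1 h2
    rw [h1 t ⟨le_rfl, htT⟩, h2]
  · intro p q hp hpq hq
    obtain ⟨I, hI, hdyn⟩ := hY.dynamics i
    have hnoise : ∀ᵐ ω ∂P, ∀ s ∈ Icc t T, noise (fun u => μ u i) t Z s ω = y i + I s ω := by
      filter_upwards [hZY, hdyn] with ω h1 h2 s hs
      have e : ∫ u in t..s, μ u i * Z u ω = ∫ u in t..s, Y u ω i * μ u i := by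
        refine intervalIntegral.integral_congr fun u hu => ?_
        rw [uIcc_of_le hs.1] at hu
        simp only [h1 u ⟨hu.1, hu.2.trans hs.2⟩, mul_comm]
      rw [noise, e, h1 s hs, h2 s hs]
      ring
    refine (hI.hasItoIntegral hp hpq hq).congr ?_ ?_
    · filter_upwards [hZY] with ω h1 u hu
      rw [h1 u ⟨hp.trans hu.1, hu.2.trans hq⟩]
      rfl
    · filter_upwards [hnoise] with ω h1
      rw [h1 q ⟨hp.trans hpq, hq⟩, h1 p ⟨hp, hpq.trans hq⟩]
      ring

/-- Solutions are limits of Doléans exponentials of step functions. -/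
theorem IsScalarSolution.tendsto_dexp [IsProbabilityMeasure P] {μ : ℝ → ℝ}
    {σ : ℝ → EuclideanSpace ℝ (Fin d)} {y : ℝ} {Y : ℝ → Ω → ℝ}
    (hY : IsScalarSolution ℱ P W μ σ T t y Y)
    (hc : IsCoefficient μ σ T) (hW : IsBrownianMotion ℱ P T W) (ht : 0 ≤ t) (hy : 0 < y)
    {g : ℕ → StepFn (EuclideanSpace ℝ (Fin d))}
    (hg : ∀ k, (g k).time 0 ≤ 0 ∧ T ≤ (g k).time (g k).N)
    {r : ℝ} (hr : r ∈ Icc t T)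
    (hlim : Tendsto (fun k => eLpNorm ((g k).eval - σ) 2 (volume.restrict (Icc t r))) atTop (𝓝 0)) :
    Tendsto (fun k => eLpNorm ((fun ω => (g k).dexp (fun u => W u ω) t r)
      - fun ω => Y r ω / (y * Real.exp (∫ u in t..r, μ u))) 2 P) atTop (𝓝 0) := by
  set c := y * Real.exp (∫ u in t..r, μ u) with hcdef
  have hc0 : 0 < c := by positivity
  obtain ⟨C, hC⟩ := hY.exists_sq_bound hc hW ht (hr.1.trans hr.2)
  have hYm := (hC r hr).1
  rw [tendsto_eLpNorm_two_iff]
  have e : ∀ k, ∫⁻ ω, ‖((fun ω => (g k).dexp (fun u => W u ω) t r)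
      - fun ω => Y r ω / c) ω‖ₑ ^ 2 ∂P
      = ENNReal.ofReal (Real.exp (∫ u in t..r, ‖σ u‖ ^ 2)
        - 2 * Real.exp (∫ u in t..r, ⟪σ u, (g k).eval u⟫)
        + Real.exp (∫ u in t..r, ‖(g k).eval u‖ ^ 2)) := by
    intro k
    have hd := ((g k).dexp_sq hW ht hr.1 hr.2).1
    have hm : MemLp ((fun ω => (g k).dexp (fun u => W u ω) t r)
      - fun ω => Y r ω / c) 2 P := hd.sub (by simpa only [div_eq_mul_inv] using hYm.mul_const c⁻¹)
    rw [← ofReal_integral_norm_sq hm]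
    congr 1
    have h1 := hY.integral_sub_dexp_sq hc hW ht (g k) (hg k).1 (hg k).2 hr
    rw [← hcdef] at h1
    have h2 : ∀ ω, ‖((fun ω => (g k).dexp (fun u => W u ω) t r) - fun ω => Y r ω / c) ω‖ ^ 2
        = (c ^ 2)⁻¹ * (Y r ω - c * (g k).dexp (fun u => W u ω) t r) ^ 2 := fun ω => by
      rw [Real.norm_eq_abs, sq_abs, Pi.sub_apply]
      field_simp
      ring
    simp_rw [h2]
    rw [integral_const_mul, h1, inv_mul_cancel_left₀ (by positivity)]
  simp_rw [e]
  have hσ := hc.memLp_vol ht hr.2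
  have l1 := (Real.continuous_exp.tendsto _).comp (StepFn.tendsto_integral_inner_eval hr.1 hσ hlim)
  have l2 := (Real.continuous_exp.tendsto _).comp (StepFn.tendsto_integral_norm_sq hr.1 hσ hlim)
  have l3 := ENNReal.tendsto_ofReal (((tendsto_const_nhds
    (x := Real.exp (∫ u in t..r, ‖σ u‖ ^ 2))).sub (l1.const_mul 2)).add l2)
  -- The limit of the mean square distance, in which all three exponents equal ∫‖σ‖².
  have e0 : Real.exp (∫ u in t..r, ‖σ u‖ ^ 2) - 2 * Real.exp (∫ u in t..r, ‖σ u‖ ^ 2)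
      + Real.exp (∫ u in t..r, ‖σ u‖ ^ 2) = 0 := by ring
  rw [e0, ENNReal.ofReal_zero] at l3
  exact l3

/-- The mean of the logarithmic increment. -/
noncomputable def logMean (μ : ℝ → EuclideanSpace ℝ (Fin n)) (σ : ℝ → Matrix (Fin n) (Fin d) ℝ)
    (s r : ℝ) : EuclideanSpace ℝ (Fin n) :=
  WithLp.toLp 2 fun i => (∫ u in s..r, μ u i) - (∫ u in s..r, ‖row σ i u‖ ^ 2) / 2

/-- The covariance matrix of the logarithmic increment. -/
noncomputable def logCov (σ : ℝ → Matrix (Fin n) (Fin d) ℝ) (s r : ℝ) : Matrix (Fin n) (Fin n) ℝ :=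
  Matrix.of fun i j => ∫ u in s..r, ⟪row σ i u, row σ j u⟫

/-- The law of the logarithmic increment. -/
noncomputable def logLaw (μ : ℝ → EuclideanSpace ℝ (Fin n)) (σ : ℝ → Matrix (Fin n) (Fin d) ℝ)
    (s r : ℝ) : Measure (EuclideanSpace ℝ (Fin n)) :=
  multivariateGaussian (logMean μ σ s r) (logCov σ s r)

theorem intervalIntegrable_inner_row (hc : ∀ i, IsCoefficient (fun u => μ u i) (row σ i) T)
    {s r : ℝ} (hs : 0 ≤ s) (hsr : s ≤ r) (hr : r ≤ T) (i j : Fin n) :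
    IntervalIntegrable (fun u => ⟪row σ i u, row σ j u⟫) volume s r := by
  refine (intervalIntegrable_iff_integrableOn_Icc_of_le hsr).2 ?_
  have h1 := ((hc i).memLp_vol hs hr).norm.integrable_mul ((hc j).memLp_vol hs hr).norm
  refine h1.mono' ((hc i).measurable_vol.inner (hc j).measurable_vol).aestronglyMeasurable
    (Eventually.of_forall fun u => norm_inner_le_norm _ _)

theorem dotProduct_logCov (hc : ∀ i, IsCoefficient (fun u => μ u i) (row σ i) T)
    {s r : ℝ} (hs : 0 ≤ s) (hsr : s ≤ r) (hr : r ≤ T) (x : Fin n → ℝ) :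
    x ⬝ᵥ (logCov σ s r).mulVec x = ∫ u in s..r, ‖∑ i, x i • row σ i u‖ ^ 2 := by
  have hi := intervalIntegrable_inner_row hc hs hsr hr
  have e : ∀ u, ‖∑ i, x i • row σ i u‖ ^ 2 = ∑ i, ∑ j, x i * x j * ⟪row σ i u, row σ j u⟫ := by
    intro u
    rw [← real_inner_self_eq_norm_sq, sum_inner]
    refine Finset.sum_congr rfl fun i _ => ?_
    rw [inner_sum]
    refine Finset.sum_congr rfl fun j _ => ?_
    rw [real_inner_smul_left, real_inner_smul_right]
    ring
  have hsum : ∀ i, IntervalIntegrable (fun u => ∑ j, x i * x j * ⟪row σ i u, row σ j u⟫)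
      volume s r := fun i => by
    have := IntervalIntegrable.sum Finset.univ fun j _ => (hi i j).const_mul (x i * x j)
    simpa only [Finset.sum_fn] using this
  simp_rw [e]
  rw [intervalIntegral.integral_finsetSum fun i _ => hsum i]
  simp only [dotProduct, Matrix.mulVec, Finset.mul_sum]
  refine Finset.sum_congr rfl fun i _ => ?_
  rw [intervalIntegral.integral_finsetSum fun j _ => (hi i j).const_mul _]
  refine Finset.sum_congr rfl fun j _ => ?_
  rw [intervalIntegral.integral_const_mul, logCov, Matrix.of_apply]
  ring

theorem isHermitian_logCov (σ : ℝ → Matrix (Fin n) (Fin d) ℝ) (s r : ℝ) :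
    (logCov σ s r).IsHermitian := by
  ext i j
  simp [logCov, Matrix.conjTranspose_apply, real_inner_comm]

theorem posSemidef_logCov (hc : ∀ i, IsCoefficient (fun u => μ u i) (row σ i) T)
    {s r : ℝ} (hs : 0 ≤ s) (hsr : s ≤ r) (hr : r ≤ T) : (logCov σ s r).PosSemidef := by
  refine Matrix.PosSemidef.of_dotProduct_mulVec_nonneg (isHermitian_logCov σ s r) fun x => ?_
  rw [star_trivial, dotProduct_logCov hc hs hsr hr]
  exact intervalIntegral.integral_nonneg hsr fun u _ => sq_nonneg _

/-- Under the nondegeneracy condition the covariance matrix is bounded below. -/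
theorem posSemidef_logCov_sub (hc : ∀ i, IsCoefficient (fun u => μ u i) (row σ i) T)
    {s r ε : ℝ} (hs : 0 ≤ s) (hsr : s ≤ r) (hr : r ≤ T)
    (hε : ∀ u ∈ Icc 0 T, ∀ z : Fin n → ℝ,
      ε * (z ⬝ᵥ z) ≤ z ⬝ᵥ ((σ u * (σ u).transpose).mulVec z)) :
    (logCov σ s r - (ε * (r - s)) • 1).PosSemidef := by
  refine Matrix.PosSemidef.of_dotProduct_mulVec_nonneg
    ((isHermitian_logCov σ s r).sub (Matrix.isHermitian_one.smul (IsSelfAdjoint.all _))) fun x => ?_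
  rw [star_trivial, Matrix.sub_mulVec, dotProduct_sub, dotProduct_logCov hc hs hsr hr,
    Matrix.smul_mulVec, Matrix.one_mulVec, dotProduct_smul, sub_nonneg, smul_eq_mul]
  have h1 : ∀ u, ‖∑ i, x i • row σ i u‖ ^ 2 = x ⬝ᵥ ((σ u * (σ u).transpose).mulVec x) := by
    intro u
    rw [← Matrix.mulVec_mulVec, Matrix.dotProduct_mulVec, Matrix.mulVec_transpose,
      EuclideanSpace.norm_sq_eq]
    simp [dotProduct, Matrix.vecMul, row, sq]
  have hint : IntervalIntegrable (fun u => ‖∑ i, x i • row σ i u‖ ^ 2) volume s r := by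
    refine (intervalIntegrable_iff_integrableOn_Icc_of_le hsr).2 ?_
    have : MemLp (fun u => ∑ i, x i • row σ i u) 2 (volume.restrict (Icc s r)) :=
      memLp_finsetSum _ fun i _ => ((hc i).memLp_vol hs hr).const_smul (x i)
    exact this.norm.integrable_sq
  calc ε * (r - s) * (x ⬝ᵥ x) = ∫ _ in s..r, ε * (x ⬝ᵥ x) := by
        rw [intervalIntegral.integral_const, smul_eq_mul]
        ring
    _ ≤ _ := intervalIntegral.integral_mono_on hsr (by simp) hint fun u hu => by
        rw [h1]
        exact hε u ⟨hs.trans hu.1, hu.2.trans hr⟩ x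

end Law

/-! ### Joint law of the logarithmic increments on events of the past -/

section Law

variable {Ω : Type*} {mΩ : MeasurableSpace Ω} {n d : ℕ}
  {ℱ : Filtration ℝ mΩ} {P : Measure Ω} {W : ℝ → Ω → EuclideanSpace ℝ (Fin d)} {T t : ℝ}
  {μ : ℝ → EuclideanSpace ℝ (Fin n)} {σ : ℝ → Matrix (Fin n) (Fin d) ℝ}

/-- Families of `n` vectors in `E`, with the `L²` norm. -/
abbrev Tuple (n : ℕ) (E : Type) : Type := PiLp 2 fun _ : Fin n => E

/-- The rows of a matrix-valued function, as a family of Euclidean vectors. -/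
noncomputable def rows (σ : ℝ → Matrix (Fin n) (Fin d) ℝ) (u : ℝ) :
    Tuple n (EuclideanSpace ℝ (Fin d)) :=
  WithLp.toLp 2 fun i => row σ i u

/-- The component of a family of vectors. -/
noncomputable def component {E : Type} [NormedAddCommGroup E] [NormedSpace ℝ E]
    (i : Fin n) : Tuple n E →L[ℝ] E :=
  PiLp.proj 2 _ i

theorem component_apply {E : Type} [NormedAddCommGroup E] [NormedSpace ℝ E]
    (i : Fin n) (v : Tuple n E) : component i v = v i := rfl

/-- The linear combination of the components of a family of vectors. -/
noncomputable def combination {E : Type} [NormedAddCommGroup E] [NormedSpace ℝ E]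
    (x : Fin n → ℝ) : Tuple n E →L[ℝ] E :=
  ∑ i, x i • component i

theorem combination_apply {E : Type} [NormedAddCommGroup E] [NormedSpace ℝ E]
    (x : Fin n → ℝ) (v : Tuple n E) : combination x v = ∑ i, x i • v i := by
  simp [combination, component_apply]

theorem component_rows (σ : ℝ → Matrix (Fin n) (Fin d) ℝ) (i : Fin n) :
    (fun u => component i (rows σ u)) = row σ i := rfl

theorem combination_rows (σ : ℝ → Matrix (Fin n) (Fin d) ℝ) (x : Fin n → ℝ) (u : ℝ) :
    combination x (rows σ u) = ∑ i, x i • row σ i u :=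
  combination_apply x (rows σ u)

/-- All rows are approximated on a common partition, so a linear combination of their Wiener
integrals is again the Wiener integral of one step function. This gives joint characteristic
functions. -/
theorem incr_comp_combination {E : Type} [NormedAddCommGroup E] [InnerProductSpace ℝ E]
    (g : StepFn (Tuple n E)) (x : Fin n → ℝ) (w : ℝ → E) (p q : ℝ) :
    (g.comp (combination x)).incr w p q
      = ∑ i, x i * (g.comp (component i)).incr w p q := by
  simp only [StepFn.incr, StepFn.comp, combination_apply, sum_inner, real_inner_smul_left,
    component_apply, Finset.mul_sum]
  exact Finset.sum_comm

variable [IsProbabilityMeasure P]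

theorem setIntegral_cexp_incr (hW : IsBrownianMotion ℱ P T W) {p q : ℝ} (hp : 0 ≤ p)
    (hpq : p ≤ q) (hq : q ≤ T) (g : StepFn (EuclideanSpace ℝ (Fin d))) {A : Set Ω}
    (hA : MeasurableSet[ℱ p] A) :
    ∫ ω in A, Complex.exp (g.incr (fun u => W u ω) p q * Complex.I) ∂P
      = P.real A * Complex.exp (-((∫ u in p..q, ‖g.eval u‖ ^ 2) / 2 : ℝ)) := by
  have hA' := ℱ.le p _ hA
  have h := g.integral_mul_cexp_incr hW hp hpq hq (ξ := A.indicator fun _ => (1 : ℂ))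
    (stronglyMeasurable_const.indicator hA) ((integrable_const _).indicator hA')
  rw [integral_indicator_const _ hA'] at h
  rw [← integral_indicator hA']
  simp only [Complex.real_smul, mul_one] at h
  rw [← h]
  refine integral_congr_ae (Eventually.of_forall fun ω => ?_)
  by_cases hω : ω ∈ A <;> simp [hω]

/-- Solutions are almost surely positive, and their logarithmic increments are limits of the
Wiener integrals of step functions. -/
theorem IsSolution.exists_steps (hℱ : IsCompleteFiltration ℱ P) (hW : IsBrownianMotion ℱ P T W)
    (hc : ∀ i, IsCoefficient (fun u => μ u i) (row σ i) T) (ht : 0 ≤ t)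
    {y : EuclideanSpace ℝ (Fin n)} (hy : y ∈ orthant n)
    {Y : ℝ → Ω → EuclideanSpace ℝ (Fin n)} (hY : IsSolution ℱ P W μ σ T t y Y) {s r : ℝ}
    (hts : t ≤ s) (hsr : s ≤ r) (hrT : r ≤ T) :
    ∃ g : ℕ → StepFn (Tuple n (EuclideanSpace ℝ (Fin d))),
      Tendsto (fun k => eLpNorm ((g k).eval - rows σ) 2
        (volume.restrict (Icc 0 T))) atTop (𝓝 0) ∧
      ∀ᵐ ω ∂P, Y s ω ∈ orthant n ∧ Y r ω ∈ orthant n ∧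
        ∀ i, Tendsto (fun k => ((g k).comp (component i)).incr
          (fun u => W u ω) s r) atTop
          (𝓝 ((logE (Y r ω) - logE (Y s ω) - logMean μ σ s r) i)) := by
  have htT : t ≤ T := hts.trans (hsr.trans hrT)
  have hs0 : 0 ≤ s := ht.trans hts
  choose Z hZ hZY using fun i => hY.exists_isScalarSolution hℱ ht htT i
  obtain ⟨g, hg, hlim⟩ := exists_stepFn_tendsto (ht.trans htT)
    (f := rows σ) (MemLp.of_eval_piLp fun i => (hc i).memLp_vol le_rfl le_rfl)
  set G : Fin n → ℕ → StepFn (EuclideanSpace ℝ (Fin d)) := fun i k =>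
    (g k).comp (component i) with hG
  have hGlim : ∀ i {p q : ℝ}, 0 ≤ p → q ≤ T → Tendsto (fun k => eLpNorm ((G i k).eval - row σ i) 2
      (volume.restrict (Icc p q))) atTop (𝓝 0) := fun i {_ _} hp hq => by
    have h := StepFn.tendsto_eval_comp (component i) hlim hp hq
    rwa [component_rows] at h
  have hGsq : ∀ i {p q : ℝ}, 0 ≤ p → p ≤ q → q ≤ T → Tendsto (fun k =>
      ∫ u in p..q, ‖(G i k).eval u‖ ^ 2) atTop (𝓝 (∫ u in p..q, ‖row σ i u‖ ^ 2)) :=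
    fun i {_ _} hp hpq hq => StepFn.tendsto_integral_norm_sq hpq ((hc i).memLp_vol hp hq)
      (hGlim i hp hq)
  -- All components at both times s and r are treated as one finite family, so that a single
  -- subsequence serves them all.
  set τ : Bool → ℝ := fun b => if b then r else s with hτ
  have hτm : ∀ b, τ b ∈ Icc t T := fun b => by
    cases b
    · exact ⟨hts, hsr.trans hrT⟩
    · exact ⟨hts.trans hsr, hrT⟩
  set R : Fin n × Bool → Ω → ℝ := fun j ω =>
    Z j.1 (τ j.2) ω / (y j.1 * Real.exp (∫ u in t..τ j.2, μ u j.1)) with hR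
  obtain ⟨ns, hns, hae⟩ := exists_seq_tendsto_ae_of_finite (P := P)
    (f := fun k (j : Fin n × Bool) ω => (G j.1 k).dexp (fun u => W u ω) t (τ j.2)) (f' := R)
    (fun k j => ((G j.1 k).dexp_sq hW ht (hτm j.2).1 (hτm j.2).2).1.aestronglyMeasurable)
    (fun j => (((hZ j.1).measurable _).div_const _).aestronglyMeasurable)
    (fun j => (hZ j.1).tendsto_dexp (hc j.1) hW ht (hy j.1) (fun k => hg k) (hτm j.2)
      (hGlim j.1 ht (hτm j.2).2))
  have hpos : ∀ᵐ ω ∂P, ∀ j, 0 < R j ω := by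
    refine ae_all_iff.2 fun j => ?_
    exact pos_of_tendsto_dexp hW ht (hτm j.2).1 (hτm j.2).2 (g := fun k => G j.1 (ns k))
      ((hGsq j.1 ht (hτm j.2).1 (hτm j.2).2).comp hns.tendsto_atTop)
      (hae.mono fun ω hω => hω j)
  refine ⟨fun k => g (ns k), hlim.comp hns.tendsto_atTop, ?_⟩
  filter_upwards [hae, hpos, ae_all_iff.2 hZY] with ω h1 h2 h3
  have hZpos : ∀ i b, 0 < Y (τ b) ω i := fun i b => by
    have := h2 (i, b)
    simp only [hR, h3 i (τ b) (hτm b)] at this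
    exact (div_pos_iff_of_pos_right (mul_pos (hy i) (Real.exp_pos _))).1 this
  refine ⟨fun i => hZpos i false, fun i => hZpos i true, fun i => ?_⟩
  have hlog : ∀ b, Real.log (R (i, b) ω) = Real.log (Y (τ b) ω i) - Real.log (y i)
      - ∫ u in t..τ b, μ u i := fun b => by
    simp only [hR, h3 i (τ b) (hτm b)]
    rw [Real.log_div (hZpos i b).ne' (mul_pos (hy i) (Real.exp_pos _)).ne',
      Real.log_mul (hy i).ne' (Real.exp_pos _).ne', Real.log_exp]
    ring
  have hl : ∀ b, Tendsto (fun k => Real.log ((G i (ns k)).dexp (fun u => W u ω) t (τ b))) atTop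
      (𝓝 (Real.log (R (i, b) ω))) := fun b => (h1 (i, b)).log (h2 (i, b)).ne'
  -- The logarithm of the exponential over (s, r] is the Wiener integral minus half the energy.
  -- Adding the half energy back leaves the Wiener integral, and on the limit side it produces the
  -- correction in `logMean`.
  have h4 := ((hl true).sub (hl false)).add
    (((hGsq i hs0 hsr hrT).comp hns.tendsto_atTop).div_const 2)
  have ii : ∀ {p q : ℝ}, 0 ≤ p → p ≤ q → q ≤ T →
      IntervalIntegrable (fun u => μ u i) volume p q := fun hp hpq hq =>
    (intervalIntegrable_iff_integrableOn_Icc_of_le hpq).2 ((hc i).drift_on hp hq)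
  have hsplit := intervalIntegral.integral_add_adjacent_intervals
    (ii ht hts (hsr.trans hrT)) (ii hs0 hsr hrT)
  have elim : Real.log (R (i, true) ω) - Real.log (R (i, false) ω)
      + (∫ u in s..r, ‖row σ i u‖ ^ 2) / 2
      = (logE (Y r ω) - logE (Y s ω) - logMean μ σ s r) i := by
    rw [hlog, hlog]
    simp only [hτ, logE, logMean, PiLp.sub_apply, if_true, Bool.false_eq_true, if_false]
    rw [← hsplit]
    ring
  rw [elim] at h4
  refine h4.congr fun k => ?_
  have e := (G i (ns k)).dexp_mul_dexp (fun u => W u ω) hts hsr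
  simp only [hτ, if_true, Bool.false_eq_true, if_false, Function.comp_apply]
  rw [← e]
  simp only [StepFn.dexp]
  rw [← Real.exp_add, Real.log_exp, Real.log_exp]
  ring

theorem IsSolution.ae_mem_orthant (hℱ : IsCompleteFiltration ℱ P) (hW : IsBrownianMotion ℱ P T W)
    (hc : ∀ i, IsCoefficient (fun u => μ u i) (row σ i) T) (ht : 0 ≤ t)
    {y : EuclideanSpace ℝ (Fin n)} (hy : y ∈ orthant n)
    {Y : ℝ → Ω → EuclideanSpace ℝ (Fin n)} (hY : IsSolution ℱ P W μ σ T t y Y) {s : ℝ}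
    (hts : t ≤ s) (hsT : s ≤ T) : ∀ᵐ ω ∂P, Y s ω ∈ orthant n := by
  obtain ⟨_, _, h⟩ := hY.exists_steps hℱ hW hc ht hy hts le_rfl hsT
  exact h.mono fun ω hω => hω.1

/-- The characteristic function of a logarithmic increment, conditionally on the past. -/
theorem IsSolution.setIntegral_cexp (hℱ : IsCompleteFiltration ℱ P)
    (hW : IsBrownianMotion ℱ P T W)
    (hc : ∀ i, IsCoefficient (fun u => μ u i) (row σ i) T) (ht : 0 ≤ t)
    {y : EuclideanSpace ℝ (Fin n)} (hy : y ∈ orthant n)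
    {Y : ℝ → Ω → EuclideanSpace ℝ (Fin n)} (hY : IsSolution ℱ P W μ σ T t y Y) {s r : ℝ}
    (hts : t ≤ s) (hsr : s ≤ r) (hrT : r ≤ T) {A : Set Ω} (hA : MeasurableSet[ℱ s] A)
    (x : EuclideanSpace ℝ (Fin n)) :
    ∫ ω in A, Complex.exp (⟪logE (Y r ω) - logE (Y s ω), x⟫ * Complex.I) ∂P
      = P.real A * charFun (logLaw μ σ s r) x := by
  obtain ⟨g, hlim, hae⟩ := hY.exists_steps hℱ hW hc ht hy hts hsr hrT
  have hs0 : 0 ≤ s := ht.trans hts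
  have hinner : ∀ v w : EuclideanSpace ℝ (Fin n), ⟪v, w⟫ = ∑ i, w i * v i := fun v w => by
    simp [PiLp.inner_apply]
  have hL : Tendsto (fun k => ∫ ω in A, Complex.exp
      (((g k).comp (combination x)).incr (fun u => W u ω) s r * Complex.I) ∂P) atTop
      (𝓝 (∫ ω in A, Complex.exp
        (⟪logE (Y r ω) - logE (Y s ω) - logMean μ σ s r, x⟫ * Complex.I) ∂P)) := by
    refine tendsto_integral_of_dominated_convergence (fun _ => 1) (fun k => ?_)
      (integrable_const _) (fun k => Eventually.of_forall fun ω => ?_) ?_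
    · have := ((((g k).comp (combination x)).stronglyMeasurable_incr hW hs0 hsr hrT).mono
        (ℱ.le r)).measurable
      exact (by fun_prop : Measurable fun ω => Complex.exp
        (((g k).comp (combination x)).incr (fun u => W u ω) s r * Complex.I)).aestronglyMeasurable
    · rw [Complex.norm_exp_ofReal_mul_I]
    · filter_upwards [ae_restrict_of_ae hae] with ω hω
      have h1 : Tendsto (fun k => ((g k).comp (combination x)).incr (fun u => W u ω) s r) atTop
          (𝓝 (⟪logE (Y r ω) - logE (Y s ω) - logMean μ σ s r, x⟫)) := by
        simp_rw [incr_comp_combination, hinner]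
        exact tendsto_finsetSum _ fun i _ => (hω.2.2 i).const_mul (x i)
      exact (Complex.continuous_exp.tendsto _).comp
        (((Complex.continuous_ofReal.tendsto _).comp h1).mul_const _)
  have hmem : MemLp (fun u => combination x (rows σ u)) 2
      (volume.restrict (Icc s r)) := by
    simp_rw [combination_apply]
    exact memLp_finsetSum _ fun i _ => ((hc i).memLp_vol hs0 hrT).const_smul (x i)
  have hlim' := StepFn.tendsto_eval_comp (combination x) hlim hs0 hrT
  have hsq := StepFn.tendsto_integral_norm_sq hsr hmem hlim'
  have hRlim : Tendsto (fun k => (P.real A : ℂ) * Complex.exp (-((∫ u in s..r,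
      ‖((g k).comp (combination x)).eval u‖ ^ 2) / 2 : ℝ))) atTop
      (𝓝 ((P.real A : ℂ) * Complex.exp (-((x ⬝ᵥ (logCov σ s r).mulVec x) / 2 : ℝ)))) := by
    rw [dotProduct_logCov hc hs0 hsr hrT]
    simp_rw [← combination_rows]
    exact ((Complex.continuous_exp.tendsto _).comp
      (((Complex.continuous_ofReal.tendsto _).comp (hsq.div_const 2)).neg)).const_mul _
  have heq := tendsto_nhds_unique (hL.congr fun k =>
    setIntegral_cexp_incr hW hs0 hsr hrT ((g k).comp (combination x)) hA) hRlim
  rw [logLaw, charFun_multivariateGaussian (posSemidef_logCov hc hs0 hsr hrT)]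
  -- The Wiener integrals are centred; the mean is restored as a deterministic phase.
  have e : ∀ ω, Complex.exp (⟪logE (Y r ω) - logE (Y s ω), x⟫ * Complex.I)
      = Complex.exp (⟪logE (Y r ω) - logE (Y s ω) - logMean μ σ s r, x⟫ * Complex.I)
        * Complex.exp (⟪x, logMean μ σ s r⟫ * Complex.I) := fun ω => by
    rw [← Complex.exp_add, ← add_mul, real_inner_comm _ x, ← Complex.ofReal_add, ← inner_add_left,
      sub_add_cancel]
  simp_rw [e]
  rw [integral_mul_const, heq, mul_assoc, ← Complex.exp_add]
  congr 2
  push_cast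
  ring

end Law

/-! ### The Markov property in logarithmic coordinates -/

section Markov

variable {Ω : Type*} {mΩ : MeasurableSpace Ω} {n d : ℕ}
  {ℱ : Filtration ℝ mΩ} {P : Measure Ω} {W : ℝ → Ω → EuclideanSpace ℝ (Fin d)} {T t : ℝ}
  {μ : ℝ → EuclideanSpace ℝ (Fin n)} {σ : ℝ → Matrix (Fin n) (Fin d) ℝ}
  {y : EuclideanSpace ℝ (Fin n)} {Y : ℝ → Ω → EuclideanSpace ℝ (Fin n)} {s r : ℝ}

instance isProbabilityMeasure_logLaw : IsProbabilityMeasure (logLaw μ σ s r) := by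
  unfold logLaw
  infer_instance

theorem IsSolution.measurable (hY : IsSolution ℱ P W μ σ T t y Y) (hs : s ∈ Icc t T) :
    Measurable[ℱ s] fun ω => logE (Y s ω) :=
  measurable_logE.comp (hY.adapted s hs).measurable

theorem IsSolution.measurable_logE (hY : IsSolution ℱ P W μ σ T t y Y) (hs : s ∈ Icc t T) :
    Measurable fun ω => logE (Y s ω) :=
  (hY.measurable hs).mono (ℱ.le s) le_rfl

variable [IsProbabilityMeasure P]

/-- The logarithmic increments are independent of the past, with law `logLaw`. -/
theorem IsSolution.map_restrict (hℱ : IsCompleteFiltration ℱ P)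
    (hW : IsBrownianMotion ℱ P T W)
    (hc : ∀ i, IsCoefficient (fun u => μ u i) (row σ i) T) (ht : 0 ≤ t)
    (hy : y ∈ orthant n) (hY : IsSolution ℱ P W μ σ T t y Y)
    (hts : t ≤ s) (hsr : s ≤ r) (hrT : r ≤ T) {A : Set Ω} (hA : MeasurableSet[ℱ s] A) :
    (P.restrict A).map (fun ω => logE (Y r ω) - logE (Y s ω)) = P A • logLaw μ σ s r := by
  have hm : Measurable fun ω => logE (Y r ω) - logE (Y s ω) := (hY.measurable_logE ⟨hts.trans hsr, hrT⟩).sub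
    (hY.measurable_logE ⟨hts, hsr.trans hrT⟩)
  have : IsFiniteMeasure (P A • logLaw μ σ s r) :=
    Measure.smul_finite _ (measure_ne_top P A)
  -- Finite measures are compared through their characteristic functions with the weight P A kept,
  -- so the case P A = 0 needs no separate treatment.
  refine Measure.ext_of_charFun (funext fun x => ?_)
  rw [charFun_apply, integral_map hm.aemeasurable (by fun_prop),
    charFun_apply, integral_smul_measure, ← charFun_apply]
  exact hY.setIntegral_cexp hℱ hW hc ht hy hts hsr hrT hA x

/-- The Markov property. -/
theorem IsSolution.setIntegral_comp (hℱ : IsCompleteFiltration ℱ P)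
    (hW : IsBrownianMotion ℱ P T W)
    (hc : ∀ i, IsCoefficient (fun u => μ u i) (row σ i) T) (ht : 0 ≤ t)
    (hy : y ∈ orthant n) (hY : IsSolution ℱ P W μ σ T t y Y)
    (hts : t ≤ s) (hsr : s ≤ r) (hrT : r ≤ T) {A : Set Ω} (hA : MeasurableSet[ℱ s] A)
    {G : EuclideanSpace ℝ (Fin n) → ℝ} (hG : Measurable G) {C : ℝ} (hGC : ∀ x, |G x| ≤ C) :
    ∫ ω in A, G (logE (Y r ω)) ∂P
      = ∫ ω in A, ∫ z, G (logE (Y s ω) + z) ∂(logLaw μ σ s r) ∂P := by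
  have hX := hY.measurable_logE ⟨hts, hsr.trans hrT⟩
  have hZ : Measurable fun ω => logE (Y r ω) - logE (Y s ω) := (hY.measurable_logE ⟨hts.trans hsr, hrT⟩).sub
    hX
  set X : Ω → EuclideanSpace ℝ (Fin n) := fun ω => logE (Y s ω) with hXdef
  set Z : Ω → EuclideanSpace ℝ (Fin n) := fun ω => logE (Y r ω) - logE (Y s ω) with hZdef
  set γ := logLaw μ σ s r with hγ
  have hprod : (P.restrict A).map (fun ω => (X ω, Z ω)) = ((P.restrict A).map X).prod γ := by
    -- Since X is ℱ s-measurable, X⁻¹B ∩ A is again an event of the past, and `map_restrict` for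
    -- this event is the product formula.
    refine (Measure.prod_eq fun B D hB hD => ?_).symm
    have hAB : MeasurableSet[ℱ s] (X ⁻¹' B ∩ A) :=
      MeasurableSet.inter (hY.measurable ⟨hts, hsr.trans hrT⟩ hB) hA
    have h1 := congrArg (fun ν => ν D) (hY.map_restrict hℱ hW hc ht hy hts hsr hrT hAB)
    rw [Measure.map_apply hZ hD, Measure.restrict_apply (hZ hD), Measure.smul_apply,
      smul_eq_mul] at h1
    rw [Measure.map_apply (hX.prodMk hZ) (hB.prod hD),
      Measure.restrict_apply (hX.prodMk hZ (hB.prod hD)), Measure.map_apply hX hB,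
      Measure.restrict_apply (hX hB), ← h1]
    congr 1
    ext ω
    simp only [mem_inter_iff, mem_preimage, mem_prod]
    tauto
  have hGm : Measurable fun p : EuclideanSpace ℝ (Fin n) × EuclideanSpace ℝ (Fin n) =>
      G (p.1 + p.2) := hG.comp (measurable_fst.add measurable_snd)
  have hfin : IsFiniteMeasure ((P.restrict A).map X) := Measure.isFiniteMeasure_map _ _
  have e : ∀ ω, G (logE (Y r ω)) = G (X ω + Z ω) := fun ω => by
    simp only [hXdef, hZdef, add_sub_cancel]
  simp_rw [e]
  rw [← integral_map (μ := P.restrict A) (φ := fun ω => (X ω, Z ω)) (hX.prodMk hZ).aemeasurable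
    (f := fun p : EuclideanSpace ℝ (Fin n) × EuclideanSpace ℝ (Fin n) => G (p.1 + p.2))
    hGm.aestronglyMeasurable, hprod, integral_prod _
    (Integrable.of_bound hGm.aestronglyMeasurable C (Eventually.of_forall fun p => hGC _)),
    integral_map hX.aemeasurable]
  exact hGm.stronglyMeasurable.integral_prod_right'.aestronglyMeasurable

/-- The conditional expectation form of the Markov property. -/
theorem IsSolution.condExp_comp (hℱ : IsCompleteFiltration ℱ P)
    (hW : IsBrownianMotion ℱ P T W)
    (hc : ∀ i, IsCoefficient (fun u => μ u i) (row σ i) T) (ht : 0 ≤ t)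
    (hy : y ∈ orthant n) (hY : IsSolution ℱ P W μ σ T t y Y)
    (hts : t ≤ s) (hsr : s ≤ r) (hrT : r ≤ T)
    {G : EuclideanSpace ℝ (Fin n) → ℝ} (hG : Measurable G) {C : ℝ} (hGC : ∀ x, |G x| ≤ C) :
    P[fun ω => G (logE (Y r ω)) | ℱ s]
      =ᵐ[P] fun ω => ∫ z, G (logE (Y s ω) + z) ∂(logLaw μ σ s r) := by
  have hGm : Measurable fun p : EuclideanSpace ℝ (Fin n) × EuclideanSpace ℝ (Fin n) =>
      G (p.1 + p.2) := hG.comp (measurable_fst.add measurable_snd)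
  have hK : StronglyMeasurable fun x => ∫ z, G (x + z) ∂(logLaw μ σ s r) :=
    hGm.stronglyMeasurable.integral_prod_right'
  have hKX : StronglyMeasurable[ℱ s] fun ω => ∫ z, G (logE (Y s ω) + z) ∂(logLaw μ σ s r) :=
    hK.comp_measurable (hY.measurable ⟨hts, hsr.trans hrT⟩)
  have hKint : Integrable (fun ω => ∫ z, G (logE (Y s ω) + z) ∂(logLaw μ σ s r)) P := by
    refine Integrable.of_bound (hKX.mono (ℱ.le s)).aestronglyMeasurable C
      (Eventually.of_forall fun ω => ?_)
    have := norm_integral_le_of_norm_le_const (μ := logLaw μ σ s r)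
      (f := fun z => G (logE (Y s ω) + z)) (Eventually.of_forall fun z => hGC _)
    simpa using this
  refine (ae_eq_condExp_of_forall_setIntegral_eq (ℱ.le s) ?_ (fun _ _ _ => hKint.integrableOn)
    (fun A hA _ => ?_) hKX.aestronglyMeasurable).symm
  · exact Integrable.of_bound
      (hG.comp (hY.measurable_logE ⟨hts.trans hsr, hrT⟩)).aestronglyMeasurable C
      (Eventually.of_forall fun ω => hGC _)
  · exact (hY.setIntegral_comp hℱ hW hc ht hy hts hsr hrT hA hG hGC).symm

end Markov

/-! ### The value function in logarithmic coordinates -/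

section Value

variable {Ω : Type*} {mΩ : MeasurableSpace Ω} {n d : ℕ}
  {ℱ : Filtration ℝ mΩ} {P : Measure Ω} {W : ℝ → Ω → EuclideanSpace ℝ (Fin d)} {T t : ℝ}
  {μ : ℝ → EuclideanSpace ℝ (Fin n)} {σ : ℝ → Matrix (Fin n) (Fin d) ℝ}
  {f : EuclideanSpace ℝ (Fin n) → ℝ} {s r C : ℝ}

/-- The value function in logarithmic coordinates. -/
noncomputable def logValue (μ : ℝ → EuclideanSpace ℝ (Fin n)) (σ : ℝ → Matrix (Fin n) (Fin d) ℝ)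
    (T : ℝ) (f : EuclideanSpace ℝ (Fin n) → ℝ) (s : ℝ) (x : EuclideanSpace ℝ (Fin n)) : ℝ :=
  ∫ z, f (expE (x + z)) ∂(logLaw μ σ s T)

theorem measurable_logValue (hf : Measurable f) (s : ℝ) : Measurable (logValue μ σ T f s) := by
  have h : Measurable fun p : EuclideanSpace ℝ (Fin n) × EuclideanSpace ℝ (Fin n) =>
      f (expE (p.1 + p.2)) :=
    hf.comp (continuous_expE.measurable.comp (measurable_fst.add measurable_snd))
  exact h.stronglyMeasurable.integral_prod_right'.measurable

theorem abs_logValue_le (hC : ∀ x, |f x| ≤ C) (s : ℝ) (x : EuclideanSpace ℝ (Fin n)) :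
    |logValue μ σ T f s x| ≤ C := by
  have := norm_integral_le_of_norm_le_const (μ := logLaw μ σ s T)
    (f := fun z => f (expE (x + z))) (Eventually.of_forall fun z => hC _)
  simpa [logValue] using this

/-- The covariance of the increment from s to T is at least ε(T - s), which is positive because s <
T. -/
theorem bddSmooth_logValue (hc : ∀ i, IsCoefficient (fun u => μ u i) (row σ i) T) {ε : ℝ}
    (hε : 0 < ε) (hnd : ∀ u ∈ Icc 0 T, ∀ z : Fin n → ℝ,
      ε * (z ⬝ᵥ z) ≤ z ⬝ᵥ ((σ u * (σ u).transpose).mulVec z))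
    (hf : Measurable f) (hC : ∀ x, |f x| ≤ C) (hs : s ∈ Ico 0 T) :
    BddSmooth (logValue μ σ T f s) :=
  bddSmooth_integral_gaussian (mul_pos hε (sub_pos.2 hs.2)) _
    (posSemidef_logCov_sub hc hs.1 hs.2.le le_rfl hnd)
    (g := fun x => f (expE x)) (hf.comp continuous_expE.measurable) fun _ => hC _

/-- A function which agrees almost surely with a measurable one is measurable with respect to a
complete filtration. -/
theorem IsCompleteFiltration.stronglyMeasurable_congr (hℱ : IsCompleteFiltration ℱ P)
    (hs : 0 ≤ s) {g h : Ω → ℝ} (hg : StronglyMeasurable[ℱ s] g) (hgh : h =ᵐ[P] g) :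
    StronglyMeasurable[ℱ s] h := by
  have hnull : ∀ A : Set Ω, P A = 0 → MeasurableSet[ℱ s] A := fun A hA => ℱ.mono hs _ (hℱ A hA)
  refine (measurable_iff_comap_le.2 ?_ : Measurable[ℱ s] h).stronglyMeasurable
  rintro _ ⟨B, hB, rfl⟩
  have hN : P {ω | h ω ≠ g ω} = 0 := hgh
  have e : h ⁻¹' B = (g ⁻¹' B ∩ {ω | h ω ≠ g ω}ᶜ) ∪ (h ⁻¹' B ∩ {ω | h ω ≠ g ω}) := by
    ext ω
    by_cases hω : h ω = g ω <;> simp [hω]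
  rw [e]
  exact MeasurableSet.union (MeasurableSet.inter (hg.measurable hB) (hnull _ hN).compl)
    (hnull _ (measure_mono_null inter_subset_right hN))

variable [IsProbabilityMeasure P] {y : EuclideanSpace ℝ (Fin n)}

theorem IsSolution.integral_comp {Y : ℝ → Ω → EuclideanSpace ℝ (Fin n)}
    (hℱ : IsCompleteFiltration ℱ P) (hW : IsBrownianMotion ℱ P T W)
    (hc : ∀ i, IsCoefficient (fun u => μ u i) (row σ i) T) (ht : 0 ≤ t)
    (hy : y ∈ orthant n) (hY : IsSolution ℱ P W μ σ T t y Y) (htr : t ≤ r) (hrT : r ≤ T)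
    {G : EuclideanSpace ℝ (Fin n) → ℝ} (hG : Measurable G) (hGC : ∀ x, |G x| ≤ C) :
    ∫ ω, G (logE (Y r ω)) ∂P = ∫ z, G (logE y + z) ∂(logLaw μ σ t r) := by
  have h := hY.setIntegral_comp hℱ hW hc ht hy le_rfl htr hrT MeasurableSet.univ hG hGC
  rw [setIntegral_univ, setIntegral_univ] at h
  rw [h, integral_congr_ae (g := fun _ => ∫ z, G (logE y + z) ∂(logLaw μ σ t r))
    (hY.initial.mono fun ω hω => by simp only [hω])]
  simp

/-- The Chapman–Kolmogorov identity: for the solution started from y at time s, the mean of f at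
time T is computed directly and by conditioning at time r. -/
theorem logValue_eq_integral {Y : ℝ → Ω → EuclideanSpace ℝ (Fin n)}
    (hℱ : IsCompleteFiltration ℱ P) (hW : IsBrownianMotion ℱ P T W)
    (hc : ∀ i, IsCoefficient (fun u => μ u i) (row σ i) T) (hs : 0 ≤ s)
    (hy : y ∈ orthant n) (hY : IsSolution ℱ P W μ σ T s y Y) (hsr : s ≤ r) (hrT : r ≤ T)
    (hf : Measurable f) (hC : ∀ x, |f x| ≤ C) :
    logValue μ σ T f s (logE y) = ∫ z, logValue μ σ T f r (logE y + z) ∂(logLaw μ σ s r) := by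
  have hG : Measurable fun x => f (expE x) := hf.comp continuous_expE.measurable
  have h1 := hY.integral_comp hℱ hW hc hs hy (hsr.trans hrT) le_rfl hG fun _ => hC _
  have h2 := hY.setIntegral_comp hℱ hW hc hs hy hsr hrT le_rfl MeasurableSet.univ hG fun _ => hC _
  have h3 := hY.integral_comp hℱ hW hc hs hy hsr hrT (measurable_logValue hf r)
    (abs_logValue_le (μ := μ) (σ := σ) (T := T) hC r)
  rw [setIntegral_univ, setIntegral_univ] at h2
  exact h1.symm.trans (h2.trans h3)

/-- Y_T lies in the orthant almost surely, so f(Y_T) is a function of log Y_T, whose law is known.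
-/
theorem value_eq_logValue
    {Y : ℝ → EuclideanSpace ℝ (Fin n) → ℝ → Ω → EuclideanSpace ℝ (Fin n)}
    (hℱ : IsCompleteFiltration ℱ P) (hW : IsBrownianMotion ℱ P T W)
    (hc : ∀ i, IsCoefficient (fun u => μ u i) (row σ i) T) (hs : s ∈ Icc 0 T)
    (hy : y ∈ orthant n) (hY : IsSolution ℱ P W μ σ T s y (Y s y))
    (hf : Measurable f) (hC : ∀ x, |f x| ≤ C) :
    value P T f Y s y = logValue μ σ T f s (logE y) := by
  have h1 := hY.integral_comp hℱ hW hc hs.1 hy hs.2 le_rfl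
    (hf.comp continuous_expE.measurable) fun _ => hC _
  refine Eq.trans (integral_congr_ae ?_) h1
  filter_upwards [hY.ae_mem_orthant hℱ hW hc hs.1 hy hs.2 le_rfl] with ω hω
  rw [Function.comp_apply, expE_logE hω]

end Value

end LogNormal

/-! ### Smoothness of the value function and the martingale property -/

open LogNormal in
theorem proposition4p1 {Ω : Type*} {mΩ : MeasurableSpace Ω} (P : Measure Ω)
    [IsProbabilityMeasure P] {n d : ℕ} (T : ℝ)
    (ℱ : Filtration ℝ mΩ) (hℱ : LogNormal.IsCompleteFiltration ℱ P)
    (W : ℝ → Ω → EuclideanSpace ℝ (Fin d)) (hW : LogNormal.IsBrownianMotion ℱ P T W)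
    (μ : ℝ → EuclideanSpace ℝ (Fin n)) (hμ : Measurable μ)
    (σ : ℝ → Matrix (Fin n) (Fin d) ℝ) (hσ : ∀ i j, Measurable fun u => σ u i j)
    (hint : IntegrableOn (fun u => ‖μ u‖ + ∑ i, ∑ j, σ u i j ^ 2) (Icc 0 T))
    (hnondeg : ∃ ε : ℝ, 0 < ε ∧ ∀ u ∈ Icc 0 T, ∀ z : Fin n → ℝ,
      ε * (z ⬝ᵥ z) ≤ z ⬝ᵥ ((σ u * (σ u).transpose).mulVec z))
    (Y : ℝ → EuclideanSpace ℝ (Fin n) → ℝ → Ω → EuclideanSpace ℝ (Fin n))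
    (hY : ∀ t ∈ Icc 0 T, ∀ y ∈ LogNormal.orthant n,
      LogNormal.IsSolution ℱ P W μ σ T t y (Y t y))
    (f : EuclideanSpace ℝ (Fin n) → ℝ) (hf : Measurable f) (hfb : ∃ C : ℝ, ∀ x, |f x| ≤ C) :
    (∀ s ∈ Ico 0 T, ContDiffOn ℝ ((⊤ : ℕ∞) : WithTop ℕ∞)
      (LogNormal.value P T f Y s) (LogNormal.orthant n)) ∧
    ∀ t ∈ Ico 0 T, ∀ y ∈ LogNormal.orthant n, ∀ (m : ℕ) (i : Fin m → Fin n),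
      Martingale
        (fun (s : Ico t T) ω => (∏ k, Y t y s ω (i k)) *
          LogNormal.mixedPartial i (LogNormal.value P T f Y s) (Y t y s ω))
        (LogNormal.restrictTo ℱ (Ico t T)) P := by
  obtain ⟨ε, hε, hnd⟩ := hnondeg
  obtain ⟨C, hC⟩ := hfb
  have hc := isCoefficient_row hμ hσ hint
  have hsmooth : ∀ s ∈ Ico 0 T, BddSmooth (logValue μ σ T f s) := fun s hs =>
    bddSmooth_logValue hc hε hnd hf hC hs
  have hval : ∀ s ∈ Ico 0 T, ∀ y ∈ orthant n,
      value P T f Y s y = logValue μ σ T f s (logE y) := fun s hs y hy =>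
    value_eq_logValue hℱ hW hc ⟨hs.1, hs.2.le⟩ hy (hY s ⟨hs.1, hs.2.le⟩ y hy) hf hC
  refine ⟨fun s hs => ?_, fun t ht y hy m i => ?_⟩
  · exact ((hsmooth s hs).1.comp_contDiffOn contDiffOn_logE).congr (hval s hs)
  have hYt := hY t ⟨ht.1, ht.2.le⟩ y hy
  have hmem : ∀ s ∈ Ico t T, s ∈ Ico 0 T := fun s hs => ⟨ht.1.trans hs.1, hs.2⟩
  -- The change to logarithmic coordinates is valid on the orthant, which contains Y_s only almost
  -- surely. So the process is identified up to a null set for each s.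
  have hae : ∀ s ∈ Ico t T, (fun ω => (∏ k, Y t y s ω (i k)) *
      mixedPartial i (value P T f Y s) (Y t y s ω))
      =ᵐ[P] fun ω => eulerOp m i (logValue μ σ T f s) (logE (Y t y s ω)) := fun s hs => by
    filter_upwards [hYt.ae_mem_orthant hℱ hW hc ht.1 hy hs.1 hs.2.le] with ω hω
    exact prod_mul_mixedPartial (hsmooth s (hmem s hs)) (hval s (hmem s hs)) m i _ hω
  have hEm : ∀ s ∈ Ico t T, Measurable (eulerOp m i (logValue μ σ T f s)) := fun s hs =>
    ((hsmooth s (hmem s hs)).eulerOp m i).1.continuous.measurable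
  refine ⟨fun s => ?_, fun s r hsr => ?_⟩
  -- The process is only almost surely equal to an ℱ_s-measurable one; completeness of the
  -- filtration makes it adapted itself.
  · exact hℱ.stronglyMeasurable_congr (hmem s s.2).1
      ((hEm s s.2).comp (hYt.measurable ⟨s.2.1, s.2.2.le⟩)).stronglyMeasurable (hae s s.2)
  · obtain ⟨K, hK⟩ := ((hsmooth r (hmem r r.2)).eulerOp m i).exists_bound
    have hsr' : (s : ℝ) ≤ r := hsr
    -- Every x is the logarithm of `expE x`, so the solution started there at time s gives the
    -- semigroup identity on the whole space, and it may be differentiated.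
    have hsemi : logValue μ σ T f s
        = fun x => ∫ z, logValue μ σ T f r (x + z) ∂(logLaw μ σ s r) := funext fun x => by
      have h := logValue_eq_integral hℱ hW hc (hmem s s.2).1 (expE_mem_orthant x)
        (hY s ⟨(hmem s s.2).1, s.2.2.le⟩ _ (expE_mem_orthant x)) hsr' r.2.2.le hf hC
      rwa [logE_expE] at h
    have h1 := hYt.condExp_comp hℱ hW hc ht.1 hy s.2.1 hsr' r.2.2.le (hEm r r.2) hK
    have h2 : eulerOp m i (logValue μ σ T f s)
        = fun x => ∫ z, eulerOp m i (logValue μ σ T f r) (x + z) ∂(logLaw μ σ s r) := by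
      rw [hsemi]
      exact eulerOp_integral (hsmooth r (hmem r r.2)) _ m i
    refine (condExp_congr_ae (hae r r.2)).trans (h1.trans ?_)
    filter_upwards [hae s s.2] with ω hω
    rw [hω, h2]
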